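/- Let $k$ be a field complete with respect to a discrete nontrivial nonarchimedean absolute value, with residue field of characteristic $p>0$. Let $\ell/k$ be a finite totally ramified extension (equal residue fields) with ramification index $e=p^n$, and let $\varpi$ be a uniformizer of $\ell$. Let $r\in\sqrt{|k^\times|}$, $r>0$, and let $A$ be a form of the closed disc of radius $r$ with respect to $\ell/k$, i.e. a strictly affinoid $k$-algebra such that $\ell\otimes_kA\cong\ell\otimes_kk\{r^{-1}T\}$ as $\ell$-algebras. For a ring $R$ with a submultiplicative nonarchimedean seminorm write $\widetilde R=\bigoplus_{\gamma>0}R_{\le\gamma}/R_{<\gamma}$ for its graded reduction, where fields carry their absolute values and $A$ its spectral seminorm; let $t\in\widetilde\ell$ be the principal symbol of $\varpi$. Thus $\widetilde\ell=\widetilde\ell_1[t^{\pm1}]$ and $\widetilde k=\widetilde\ell_1[t^{\pm p^n}]$. Suppose that $A$ has geometrically reduced graded reduction: $\widetilde k^{\,\mathrm{alg}}\otimes_{\widetilde k}\widetilde A$ is reduced, where $\widetilde k^{\,\mathrm{alg}}$ is a graded algebraic closure of $\widetilde k$. Fix an isomorphism of graded $\widetilde\ell$-algebras $\widetilde\ell\otimes_{\widetilde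 k}\widetilde A\cong\widetilde B:=\widetilde\ell[T]$, where $T$ is homogeneous of degree $r$, and use it as an identification. Put $m=p^n-1$, $L=\mathrm{Frac}(\widetilde B)$, and $R[S]_m=R[S]/(S^{m+1})$ for a commutative ring $R$. Let $\partial_L:L\to L[S]_m$ be the higher derivation of rank $m$ that is the identity on $\widetilde A$ and extends the standard higher derivation of $\widetilde\ell$, which is the $\widetilde k$-linear one with $t\mapsto t+S$; it maps $\widetilde B$ into $\widetilde B[S]_m$. Let $$\mathcal L_{\widetilde B}=\{\partial_L(z)/z:z\in L^\times\}\cap(\widetilde B[S]_m)^\times,\qquad \mathcal L'_{\widetilde B}=\{\partial_L(u)/u:u\in\widetilde B^\times\}.$$ Suppose that $\deg_T\partial_L(T)=1$, where $\deg_T$ of an element of $\widetilde B[S]_m$ is the largest degree in $T$ of its coefficients at $1,S,\dots,S^m$. Then: 1. $\mathcal L_{\widetilde B}/\mathcal L'_{\widetilde B}$ is a finite cyclic group of exponent dividing $p^n$. 2. If $\partial_L(T)/T\in\mathcal L_{\widetilde B}$, then its class generates $\mathcal L_{\widetilde B}/\mathcal L'_{\widetilde B}$. In any case there is $c\in\widetilde\ell$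 such that $\partial_L(T-c)/(T-c)$ lies in $\mathcal L_{\widetilde B}$ and its class generates $\mathcal L_{\widetilde B}/\mathcal L'_{\widetilde B}$. 3. $\mathrm{Pic}(A)$ is a finite cyclic group of exponent dividing $p^n$. More precisely, there is an isomorphism $\mathrm{Pic}(A)\cong\mathcal L_{\widetilde B}/\mathcal L'_{\widetilde B}$ with the following property: if $J\subseteq A$ is an invertible ideal, $\widetilde J\subseteq\widetilde A$ is the ideal generated by the symbols of the elements of $J$, and $0\ne z\in\widetilde B$ satisfies $\widetilde J\widetilde B=z\widetilde B$, then $\partial_L(z)/z\in\mathcal L_{\widetilde B}$ and the isomorphism sends the class of $J$ to the class of $\partial_L(z)/z$. -/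

import Mathlib

open scoped TensorProduct ENNReal

noncomputable section

/-! ### Graded reductions

`DegGroup` is the value group `ℝ_{>0}`, written additively because Mathlib's direct sums are graded
by additive monoids; `DegGroup.val g` is the positive real number `g`. -/

/-- The group `Γ = ℝ_{>0}` of degrees (in additive notation). -/
abbrev DegGroup : Type := Additive {x : ℝ // 0 < x}

/-- The positive real number underlying a degree, in `[0, ∞]`. -/
def DegGroup.val (g : DegGroup) : ℝ≥0∞ := ENNReal.ofReal (Additive.toMul g : {x : ℝ // 0 < x}).1

/-- The degree attached to a positive real number. -/
def DegGroup.of (x : ℝ) (hx : 0 < x) : DegGroup := Additive.ofMul ⟨x, hx⟩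

theorem DegGroup.val_add (g h : DegGroup) : (g + h).val = g.val * h.val := by
  unfold DegGroup.val
  rw [← ENNReal.ofReal_mul (Additive.toMul g).2.le]
  rfl

theorem DegGroup.val_zero : (0 : DegGroup).val = 1 := by
  unfold DegGroup.val
  rw [toMul_zero]
  simp

theorem DegGroup.val_pos (g : DegGroup) : 0 < g.val :=
  ENNReal.ofReal_pos.2 (Additive.toMul g).2

theorem DegGroup.val_ne_top (g : DegGroup) : g.val ≠ ⊤ := ENNReal.ofReal_ne_top

/-- A submultiplicative nonarchimedean seminorm (with values in `[0, ∞]`) on a ring. -/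
structure UltraSeminorm (A : Type*) [CommRing A] where
  toFun : A → ℝ≥0∞
  map_zero' : toFun 0 = 0
  map_neg' : ∀ a, toFun (-a) = toFun a
  add_le_max' : ∀ a b, toFun (a + b) ≤ max (toFun a) (toFun b)
  one_le' : toFun 1 ≤ 1
  mul_le' : ∀ a b, toFun (a * b) ≤ toFun a * toFun b

namespace UltraSeminorm

variable {A : Type*} [CommRing A] (v : UltraSeminorm A)

/-- `A_{≤ γ}`. -/
def leGroup (g : DegGroup) : AddSubgroup A where
  carrier := {a | v.toFun a ≤ g.val}
  zero_mem' := by simp [v.map_zero']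
  add_mem' := fun {a b} ha hb => (v.add_le_max' a b).trans (max_le ha hb)
  neg_mem' := fun {a} ha => by
    change v.toFun (-a) ≤ _
    rw [v.map_neg']
    exact ha

/-- `A_{< γ}`. -/
def ltGroup (g : DegGroup) : AddSubgroup A where
  carrier := {a | v.toFun a < g.val}
  zero_mem' := by
    change v.toFun 0 < _
    rw [v.map_zero']
    exact g.val_pos
  add_mem' := fun {a b} ha hb => (v.add_le_max' a b).trans_lt (max_lt ha hb)
  neg_mem' := fun {a} ha => by
    change v.toFun (-a) < _
    rw [v.map_neg']
    exact ha

/-- The homogeneous part `A_{≤ γ} / A_{< γ}`. -/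
abbrev Piece (g : DegGroup) : Type _ :=
  v.leGroup g ⧸ (v.ltGroup g).addSubgroupOf (v.leGroup g)

variable {v}

/-- The class in `A_{≤ γ} / A_{< γ}` of an element `a` with `|a| ≤ γ`. -/
def pieceMk (g : DegGroup) (a : A) (ha : v.toFun a ≤ g.val) : v.Piece g :=
  QuotientAddGroup.mk (⟨a, ha⟩ : v.leGroup g)

theorem pieceMk_surj {g : DegGroup} (x : v.Piece g) : ∃ a ha, x = pieceMk g a ha := by
  induction x using QuotientAddGroup.induction_on with
  | H z => exact ⟨z.1, z.2, rfl⟩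

theorem pieceMk_eq_zero {g : DegGroup} {a : A} (ha : v.toFun a ≤ g.val) (h : v.toFun a < g.val) :
    pieceMk g a ha = (0 : v.Piece g) :=
  (QuotientAddGroup.eq_zero_iff _).2 h

theorem pieceMk_sigma {g h : DegGroup} {a b : A} (hgh : g = h) (hab : a = b)
    (ha : v.toFun a ≤ g.val) (hb : v.toFun b ≤ h.val) :
    (⟨g, pieceMk g a ha⟩ : GradedMonoid v.Piece) = ⟨h, pieceMk h b hb⟩ := by
  subst hgh hab
  rfl

theorem mul_mem_le {g h : DegGroup} {a b : A} (ha : v.toFun a ≤ g.val) (hb : v.toFun b ≤ h.val) :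
    v.toFun (a * b) ≤ (g + h).val := by
  rw [DegGroup.val_add]
  exact (v.mul_le' a b).trans (mul_le_mul' ha hb)

theorem mul_mem_lt_left {g h : DegGroup} {a b : A} (ha : v.toFun a < g.val)
    (hb : v.toFun b ≤ h.val) : v.toFun (a * b) < (g + h).val := by
  rw [DegGroup.val_add]
  refine ((v.mul_le' a b).trans (mul_le_mul' le_rfl hb)).trans_lt ?_
  exact (ENNReal.mul_lt_mul_iff_left h.val_pos.ne' h.val_ne_top).2 ha

theorem mul_mem_lt_right {g h : DegGroup} {a b : A} (ha : v.toFun a ≤ g.val)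
    (hb : v.toFun b < h.val) : v.toFun (a * b) < (g + h).val := by
  rw [mul_comm, add_comm]
  exact mul_mem_lt_left hb ha

/-- Multiplication of homogeneous classes. -/
def pieceMul (g h : DegGroup) : v.Piece g →+ v.Piece h →+ v.Piece (g + h) :=
  QuotientAddGroup.lift _
    (AddMonoidHom.mk' (fun a : v.leGroup g =>
      QuotientAddGroup.lift _
        (AddMonoidHom.mk' (fun b : v.leGroup h => pieceMk (g + h) (a.1 * b.1) (mul_mem_le a.2 b.2))
          (fun b b' => congrArg QuotientAddGroup.mk (Subtype.ext (mul_add a.1 b.1 b'.1))))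
        (fun b hb => pieceMk_eq_zero _ (mul_mem_lt_right a.2 hb)))
      (fun a a' => by
        ext b
        exact congrArg QuotientAddGroup.mk (Subtype.ext (add_mul a.1 a'.1 b.1))))
    (fun a ha => by
      ext b
      exact pieceMk_eq_zero _ (mul_mem_lt_left ha b.2))

instance : GradedMonoid.GMul v.Piece where
  mul {g h} x y := pieceMul g h x y

instance : GradedMonoid.GOne v.Piece where
  one := pieceMk 0 1 (by rw [DegGroup.val_zero]; exact v.one_le')

theorem piece_mul_assoc (x y z : GradedMonoid v.Piece) : x * y * z = x * (y * z) := by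
  obtain ⟨g, x⟩ := x
  obtain ⟨h, y⟩ := y
  obtain ⟨i, z⟩ := z
  obtain ⟨a, ha, rfl⟩ := pieceMk_surj x
  obtain ⟨b, hb, rfl⟩ := pieceMk_surj y
  obtain ⟨c, hc, rfl⟩ := pieceMk_surj z
  exact pieceMk_sigma (add_assoc g h i) (mul_assoc a b c)
    (mul_mem_le (mul_mem_le ha hb) hc) (mul_mem_le ha (mul_mem_le hb hc))

theorem piece_mul_comm (x y : GradedMonoid v.Piece) : x * y = y * x := by
  obtain ⟨g, x⟩ := x
  obtain ⟨h, y⟩ := y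
  obtain ⟨a, ha, rfl⟩ := pieceMk_surj x
  obtain ⟨b, hb, rfl⟩ := pieceMk_surj y
  exact pieceMk_sigma (add_comm g h) (mul_comm a b) (mul_mem_le ha hb) (mul_mem_le hb ha)

theorem piece_one_mul (x : GradedMonoid v.Piece) : 1 * x = x := by
  obtain ⟨g, x⟩ := x
  obtain ⟨a, ha, rfl⟩ := pieceMk_surj x
  exact pieceMk_sigma (zero_add g) (one_mul a)
    (mul_mem_le (by rw [DegGroup.val_zero]; exact v.one_le') ha) ha

instance : DirectSum.GCommRing v.Piece where
  mul_zero x := map_zero (pieceMul _ _ x)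
  zero_mul y := by
    change pieceMul _ _ 0 y = 0
    simp
  mul_add x y z := map_add (pieceMul _ _ x) y z
  add_mul x y z := by
    change pieceMul _ _ (x + y) z = pieceMul _ _ x z + pieceMul _ _ y z
    simp
  mul_assoc := piece_mul_assoc
  one_mul := piece_one_mul
  mul_one x := (piece_mul_comm x 1).trans (piece_one_mul x)
  mul_comm := piece_mul_comm
  natCast n := n • GradedMonoid.GOne.one
  natCast_zero := zero_nsmul _
  natCast_succ n := succ_nsmul _ n
  intCast n := n • GradedMonoid.GOne.one
  intCast_ofNat n := natCast_zsmul _ n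
  intCast_negSucc_ofNat n := negSucc_zsmul _ n

variable (v) in
/-- The graded reduction `⨁_γ A_{≤ γ} / A_{< γ}` of `A` with respect to a seminorm, as a ring. -/
def GradedReduction : Type _ := DirectSum DegGroup v.Piece

instance : CommRing v.GradedReduction := inferInstanceAs (CommRing (DirectSum DegGroup v.Piece))

/-- The inclusion of the homogeneous part of degree `γ`. -/
def ofPiece (g : DegGroup) : v.Piece g →+ v.GradedReduction := DirectSum.of v.Piece g

variable (v) in
/-- The homogeneous elements of degree `γ` (including `0`). -/
def homogeneous (g : DegGroup) : AddSubgroup v.GradedReduction :=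
  (ofPiece (v := v) g).range

/-- The element `ã_γ` of the graded reduction given by `a` with `|a| ≤ γ`. -/
def symbol (g : DegGroup) (a : A) (ha : v.toFun a ≤ g.val) : v.GradedReduction :=
  ofPiece g (pieceMk g a ha)

theorem symbol_mul {g h : DegGroup} {a b : A} (ha : v.toFun a ≤ g.val) (hb : v.toFun b ≤ h.val) :
    symbol g a ha * symbol h b hb = symbol (g + h) (a * b) (mul_mem_le ha hb) :=
  DirectSum.of_mul_of (A := v.Piece) (pieceMk g a ha) (pieceMk h b hb)

theorem symbol_congr {g h : DegGroup} {a b : A} (hgh : g = h) (hab : a = b)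
    (ha : v.toFun a ≤ g.val) (hb : v.toFun b ≤ h.val) : symbol g a ha = symbol h b hb := by
  subst hgh hab
  rfl

theorem symbol_zero_one (h : v.toFun 1 ≤ (0 : DegGroup).val) : symbol 0 1 h = 1 := rfl

theorem symbol_eq_zero {g : DegGroup} {a : A} (ha : v.toFun a ≤ g.val) (h : v.toFun a < g.val) :
    symbol g a ha = 0 := by
  rw [symbol, pieceMk_eq_zero ha h, map_zero]

/-- A ring homomorphism out of a graded reduction, given on homogeneous parts. -/
def liftGraded {R : Type*} [CommRing R] (f : ∀ g, v.Piece g →+ R)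
    (h1 : ∀ h, f 0 (pieceMk 0 1 h) = 1)
    (hmul : ∀ (g h : DegGroup) (a b : A) (ha : v.toFun a ≤ g.val) (hb : v.toFun b ≤ h.val),
      f (g + h) (pieceMk (g + h) (a * b) (mul_mem_le ha hb)) =
        f g (pieceMk g a ha) * f h (pieceMk h b hb)) :
    v.GradedReduction →+* R :=
  DirectSum.toSemiring f (h1 _) (fun {g h} x y => by
    obtain ⟨a, ha, rfl⟩ := pieceMk_surj x
    obtain ⟨b, hb, rfl⟩ := pieceMk_surj y
    exact hmul g h a b ha hb)

theorem liftGraded_symbol {R : Type*} [CommRing R] (f : ∀ g, v.Piece g →+ R) (h1 hmul)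
    (g : DegGroup) (a : A) (ha : v.toFun a ≤ g.val) :
    liftGraded f h1 hmul (symbol g a ha) = f g (pieceMk g a ha) :=
  DirectSum.toSemiring_of f _ _ g _

theorem ringHom_ext_symbol {R : Type*} [CommRing R] {φ ψ : v.GradedReduction →+* R}
    (h : ∀ g a ha, φ (symbol g a ha) = ψ (symbol g a ha)) : φ = ψ := by
  apply DirectSum.ringHom_ext (A := v.Piece)
  intro g x
  obtain ⟨a, ha, rfl⟩ := pieceMk_surj x
  exact h g a ha

/-- A homomorphism that does not increase seminorms induces a map of graded reductions. -/
def gradedMap {B : Type*} [CommRing B] {w : UltraSeminorm B} (f : A →+* B)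
    (hf : ∀ a, w.toFun (f a) ≤ v.toFun a) : v.GradedReduction →+* w.GradedReduction :=
  liftGraded
    (fun g => (ofPiece g).comp (QuotientAddGroup.lift _
      (AddMonoidHom.mk'
        (fun a : v.leGroup g => pieceMk (v := w) g (f a.1) ((hf a.1).trans a.2))
        (fun a b => congrArg QuotientAddGroup.mk (Subtype.ext (map_add f a.1 b.1))))
      (fun a ha => pieceMk_eq_zero _ ((hf a.1).trans_lt ha))))
    (fun h => symbol_congr (v := w) rfl (map_one f) _ (by rw [DegGroup.val_zero]; exact w.one_le'))
    (fun g h a b ha hb =>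
      (symbol_congr (v := w) rfl (map_mul f a b) _
        (mul_mem_le ((hf a).trans ha) ((hf b).trans hb))).trans
        (symbol_mul (v := w) ((hf a).trans ha) ((hf b).trans hb)).symm)

theorem gradedMap_symbol {B : Type*} [CommRing B] {w : UltraSeminorm B} (f : A →+* B)
    (hf : ∀ a, w.toFun (f a) ≤ v.toFun a) (g : DegGroup) (a : A) (ha : v.toFun a ≤ g.val) :
    gradedMap f hf (symbol g a ha) = symbol g (f a) ((hf a).trans ha) :=
  liftGraded_symbol _ _ _ g a ha

end UltraSeminorm

/-! ### The graded residue fields of `k`, of `ℓ` and of an algebraic closure of `k` -/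

/-- The norm of a nonarchimedean field. -/
def fieldSeminorm (K : Type*) [NormedField K] [IsUltrametricDist K] : UltraSeminorm K where
  toFun x := ENNReal.ofReal ‖x‖
  map_zero' := by simp
  map_neg' a := by rw [norm_neg]
  add_le_max' a b := by
    rw [← ENNReal.ofReal_max]
    exact ENNReal.ofReal_le_ofReal (IsUltrametricDist.norm_add_le_max a b)
  one_le' := by simp
  mul_le' a b := by rw [norm_mul, ENNReal.ofReal_mul (norm_nonneg a)]

/-- The graded residue field of a nonarchimedean field. -/
abbrev GrResidue (K : Type*) [NormedField K] [IsUltrametricDist K] : Type _ :=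
  (fieldSeminorm K).GradedReduction

/-- The low priority keeps this from competing with `Algebra.id`. -/
instance (priority := 50) grResidueAlgebra (k ℓ : Type*) [NormedField k] [IsUltrametricDist k]
    [NormedField ℓ] [IsUltrametricDist ℓ] [NormedAlgebra k ℓ] :
    Algebra (GrResidue k) (GrResidue ℓ) :=
  (UltraSeminorm.gradedMap (v := fieldSeminorm k) (w := fieldSeminorm ℓ) (algebraMap k ℓ)
    (fun a => by simp only [fieldSeminorm, norm_algebraMap', le_refl])).toAlgebra

/-- The unique extension of the absolute value of `k` to an algebraic closure. -/
def algClosureSeminorm (k : Type*) [NontriviallyNormedField k] [IsUltrametricDist k] :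
    UltraSeminorm (AlgebraicClosure k) where
  toFun x := ENNReal.ofReal (spectralNorm k (AlgebraicClosure k) x)
  map_zero' := by rw [spectralNorm_zero, ENNReal.ofReal_zero]
  map_neg' a := by rw [spectralNorm_neg (Algebra.IsAlgebraic.isAlgebraic a)]
  add_le_max' a b := by
    rw [← ENNReal.ofReal_max]
    exact ENNReal.ofReal_le_ofReal (isNonarchimedean_spectralNorm a b)
  one_le' := by rw [spectralNorm_one, ENNReal.ofReal_one]
  mul_le' a b := by
    rw [← ENNReal.ofReal_mul (spectralNorm_nonneg a)]
    exact ENNReal.ofReal_le_ofReal (spectralNorm_mul (Algebra.IsAlgebraic.isAlgebraic a)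
      (Algebra.IsAlgebraic.isAlgebraic b))

/-- The graded residue field of an algebraic closure of `k`. Since the value group is divisible and
every homogeneous polynomial lifts to a polynomial over the algebraic closure, this is a graded
algebraic closure of the graded residue field of `k`. -/
abbrev GrAlgClosure (k : Type*) [NontriviallyNormedField k] [IsUltrametricDist k] : Type _ :=
  (algClosureSeminorm k).GradedReduction

instance (k : Type*) [NontriviallyNormedField k] [IsUltrametricDist k] :
    Algebra (GrResidue k) (GrAlgClosure k) :=
  (UltraSeminorm.gradedMap (v := fieldSeminorm k) (w := algClosureSeminorm k)
    (algebraMap k (AlgebraicClosure k))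
    (fun a => by simp only [fieldSeminorm, algClosureSeminorm, spectralNorm_extends,
      le_refl])).toAlgebra

/-! ### Affinoid algebras -/

/-- The Tate algebra `k{T_1, …, T_d}`. -/
def tateAlgebra (k : Type*) [NormedField k] [IsUltrametricDist k] (d : ℕ) :
    Subalgebra k (MvPowerSeries (Fin d) k) where
  __ := MvPowerSeries.IsRestricted.subring (R := k) (fun _ : Fin d => (1 : ℝ))
  algebraMap_mem' a := MvPowerSeries.isRestricted_C (fun _ : Fin d => (1 : ℝ)) a

/-- The algebra `k{r⁻¹T}` of the closed disc of radius `r`: power series `∑ a_i T^i` with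
`|a_i| r^i → 0`. -/
def discAlgebra (k : Type*) [NormedField k] [IsUltrametricDist k] (r : ℝ) :
    Subalgebra k (PowerSeries k) where
  __ := PowerSeries.IsRestricted.subring (R := k) r
  algebraMap_mem' a := PowerSeries.isRestricted_C r a

/-- A Banach algebra is strictly affinoid if it is the image of some `k{T_1, …, T_d}` under a
bounded surjective homomorphism of `k`-algebras (which is then open). -/
def IsStrictlyAffinoid (k A : Type*) [NontriviallyNormedField k] [IsUltrametricDist k]
    [NormedCommRing A] [NormedAlgebra k A] : Prop :=
  ∃ (d : ℕ) (φ : tateAlgebra k d →ₐ[k] A), Function.Surjective φ ∧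
    ∃ C : ℝ, ∀ f : tateAlgebra k d,
      ‖φ f‖ ≤ C * MvPowerSeries.gaussNorm (fun a : k => ‖a‖) (fun _ => 1)
        (f : MvPowerSeries (Fin d) k)

/-- The Berkovich spectrum: bounded multiplicative (nonarchimedean) seminorms. -/
def BerkovichSpectrum (A : Type*) [NormedCommRing A] : Type _ :=
  {x : MulRingSeminorm A // IsNonarchimedean x ∧ ∃ C : ℝ, ∀ f, x f ≤ C * ‖f‖}

/-- The spectral seminorm `|f| = sup_{x ∈ M(A)} |f|_x`. -/
def spectralSeminorm (A : Type*) [NormedCommRing A] : UltraSeminorm A where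
  toFun f := ⨆ x : BerkovichSpectrum A, ENNReal.ofReal (x.1 f)
  map_zero' := by simp
  map_neg' a := by simp only [map_neg_eq_map]
  add_le_max' a b := by
    refine iSup_le fun x => ?_
    refine (ENNReal.ofReal_le_ofReal (x.2.1 a b)).trans ?_
    rw [ENNReal.ofReal_max]
    exact max_le_max (le_iSup (fun x : BerkovichSpectrum A => ENNReal.ofReal (x.1 a)) x)
      (le_iSup (fun x : BerkovichSpectrum A => ENNReal.ofReal (x.1 b)) x)
  one_le' := by simp
  mul_le' a b := by
    refine iSup_le fun x => ?_
    rw [map_mul, ENNReal.ofReal_mul (apply_nonneg x.1 a)]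
    exact mul_le_mul' (le_iSup (fun x : BerkovichSpectrum A => ENNReal.ofReal (x.1 a)) x)
      (le_iSup (fun x : BerkovichSpectrum A => ENNReal.ofReal (x.1 b)) x)

/-- The graded reduction of an affinoid algebra with respect to its spectral seminorm. -/
abbrev GrRed (A : Type*) [NormedCommRing A] : Type _ := (spectralSeminorm A).GradedReduction

theorem spectralSeminorm_algebraMap_le (k A : Type*) [NormedField k] [NormedCommRing A]
    [NormedAlgebra k A] (a : k) :
    (spectralSeminorm A).toFun (algebraMap k A a) ≤ ENNReal.ofReal ‖a‖ := by
  refine iSup_le fun x => ENNReal.ofReal_le_ofReal ?_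
  obtain ⟨C, hC⟩ := x.2.2
  by_contra! hlt
  have ha : 0 < ‖a‖ := by
    rcases eq_or_ne a 0 with rfl | h
    · simp at hlt
    · exact norm_pos_iff.2 h
  set q := x.1 (algebraMap k A a) / ‖a‖ with hq
  have hq1 : 1 < q := (one_lt_div ha).2 hlt
  obtain ⟨N, hN⟩ := pow_unbounded_of_one_lt (C * ‖(1 : A)‖) hq1
  have h1 := hC (algebraMap k A (a ^ N))
  rw [map_pow, map_pow] at h1
  have hC0 : 0 ≤ C := by
    by_contra! hneg
    have h2 := hC 1
    rw [map_one] at h2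
    nlinarith [norm_nonneg (1 : A)]
  have h3 : ‖(algebraMap k A a) ^ N‖ ≤ ‖a‖ ^ N * ‖(1 : A)‖ := by
    rw [← map_pow, Algebra.algebraMap_eq_smul_one, ← norm_pow]
    exact norm_smul_le _ _
  have h4 : x.1 (algebraMap k A a) ^ N ≤ C * ‖(1 : A)‖ * ‖a‖ ^ N := by
    refine h1.trans ((mul_le_mul_of_nonneg_left h3 hC0).trans (le_of_eq (by ring)))
  have h5 : q ^ N ≤ C * ‖(1 : A)‖ := by
    rw [hq, div_pow]
    exact (div_le_iff₀ (pow_pos ha N)).2 h4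
  exact absurd hN (not_lt.2 h5)

instance (k A : Type*) [NormedField k] [IsUltrametricDist k] [NormedCommRing A]
    [NormedAlgebra k A] : Algebra (GrResidue k) (GrRed A) :=
  (UltraSeminorm.gradedMap (v := fieldSeminorm k) (w := spectralSeminorm A) (algebraMap k A)
    (spectralSeminorm_algebraMap_le k A)).toAlgebra

/-- The ideal of the graded reduction generated by the symbols of the elements of `J`. -/
def symbolIdeal {A : Type*} [NormedCommRing A] (J : Ideal A) : Ideal (GrRed A) :=
  Ideal.span {x | ∃ (g : DegGroup) (a : A) (ha : (spectralSeminorm A).toFun a ≤ g.val),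
    a ∈ J ∧ x = UltraSeminorm.symbol g a ha}

/-! ### Higher derivations and logarithmic derivatives -/

/-- The truncated polynomial ring `R[S]_m = R[S]/(S^{m+1})`. -/
abbrev TruncPoly (R : Type*) [CommRing R] (m : ℕ) : Type _ :=
  AdjoinRoot (Polynomial.X ^ (m + 1) : Polynomial R)

namespace TruncPoly

variable {R R' : Type*} [CommRing R] [CommRing R'] (m : ℕ)

/-- The inclusion of constants `R → R[S]_m`. -/
abbrev const (R : Type*) [CommRing R] : R →+* TruncPoly R m :=
  AdjoinRoot.of (Polynomial.X ^ (m + 1) : Polynomial R)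

/-- The class of the variable `S`. -/
abbrev S (R : Type*) [CommRing R] : TruncPoly R m :=
  AdjoinRoot.root (Polynomial.X ^ (m + 1) : Polynomial R)

theorem S_pow : S m R ^ (m + 1) = 0 := by
  have h := AdjoinRoot.eval₂_root (Polynomial.X ^ (m + 1) : Polynomial R)
  rwa [Polynomial.eval₂_X_pow] at h

/-- The augmentation `R[S]_m → R`, `f ↦ f mod S`. -/
def aug (R : Type*) [CommRing R] : TruncPoly R m →+* R :=
  AdjoinRoot.lift (RingHom.id R) 0 (by simp)

theorem aug_const (a : R) : aug m R (const m R a) = a := AdjoinRoot.lift_of _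

theorem aug_S : aug m R (S m R) = 0 := AdjoinRoot.lift_root _

/-- Functoriality of `R[S]_m` in `R`. -/
def map (f : R →+* R') : TruncPoly R m →+* TruncPoly R' m :=
  AdjoinRoot.map f _ _ (by simp)

theorem map_const (f : R →+* R') (a : R) : map m f (const m R a) = const m R' (f a) := by
  simp [map]

theorem map_S (f : R →+* R') : map m f (S m R) = S m R' := by
  simp [map]

theorem aug_map (f : R →+* R') (x : TruncPoly R m) : aug m R' (map m f x) = f (aug m R x) := by
  have : (aug m R').comp (map m f) = f.comp (aug m R) := by
    apply AdjoinRoot.ringHom_ext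
    · ext a
      simp [map_const, aug_const]
    · simp [map_S, aug_S]
  exact RingHom.congr_fun this x

/-- The coefficient of `S^j`, for `j ≤ m`. -/
def coeff (j : ℕ) (x : TruncPoly R m) : R :=
  (AdjoinRoot.modByMonicHom (Polynomial.monic_X_pow (m + 1)) x).coeff j

theorem isUnit_of_aug {x : TruncPoly R m} (hx : IsUnit (aug m R x)) : IsUnit x := by
  have hnil : IsNilpotent (x - const m R (aug m R x)) := by
    obtain ⟨q, rfl⟩ := AdjoinRoot.mk_surjective x
    have h0 : aug m R (AdjoinRoot.mk _ q) = q.coeff 0 := by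
      rw [aug, AdjoinRoot.lift_mk, Polynomial.eval₂_id, Polynomial.coeff_zero_eq_eval_zero]
    have h1 : AdjoinRoot.mk (Polynomial.X ^ (m + 1) : Polynomial R) q - const m R (q.coeff 0)
        = S m R * AdjoinRoot.mk _ q.divX := by
      have h2 := congrArg (AdjoinRoot.mk (Polynomial.X ^ (m + 1) : Polynomial R))
        (Polynomial.divX_mul_X_add q)
      rw [map_add, map_mul, AdjoinRoot.mk_X, AdjoinRoot.mk_C] at h2
      rw [← h2, add_sub_cancel_right, mul_comm]
    rw [h0, h1]
    exact ⟨m + 1, by rw [mul_pow, S_pow, zero_mul]⟩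
  have := hnil.isUnit_add_left_of_commute (hx.map (const m R)) (Commute.all _ _)
  rwa [add_sub_cancel] at this

/-- The monomial degree in `T` of an element of `R[T][S]_m`: the largest degree in `T` of a
coefficient of a power of `S`. -/
def degT (x : TruncPoly (Polynomial R) m) : ℕ :=
  (Finset.range (m + 1)).sup fun j => (coeff m j x).natDegree

end TruncPoly

/-- A higher derivation of rank `m` on `R`, given as a ring homomorphism `R → R[S]_m` that is a
section of the augmentation. -/
structure HigherDerivation (R : Type*) [CommRing R] (m : ℕ) where
  toRingHom : R →+* TruncPoly R m
  aug_apply : ∀ a, TruncPoly.aug m R (toRingHom a) = a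

namespace HigherDerivation

variable {R R' : Type*} [CommRing R] [CommRing R'] {m : ℕ} (D : HigherDerivation R m)

/-- Transport along a ring isomorphism. -/
def transport (e : R ≃+* R') : HigherDerivation R' m where
  toRingHom := ((TruncPoly.map m (e : R →+* R')).comp D.toRingHom).comp (e.symm : R' →+* R)
  aug_apply a := by simp [TruncPoly.aug_map, D.aug_apply]

/-- The unique extension to the (total) ring of fractions. -/
def toFrac : HigherDerivation (FractionRing R) m where
  toRingHom := IsLocalization.lift (M := nonZeroDivisors R)
    (g := (TruncPoly.map m (algebraMap R (FractionRing R))).comp D.toRingHom)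
    (fun y => TruncPoly.isUnit_of_aug m (by
      simp only [RingHom.comp_apply, TruncPoly.aug_map, D.aug_apply]
      exact IsLocalization.map_units _ y))
  aug_apply a := by
    have : (TruncPoly.aug m (FractionRing R)).comp (IsLocalization.lift (M := nonZeroDivisors R)
        (g := (TruncPoly.map m (algebraMap R (FractionRing R))).comp D.toRingHom)
        (fun y => TruncPoly.isUnit_of_aug m (by
          simp only [RingHom.comp_apply, TruncPoly.aug_map, D.aug_apply]
          exact IsLocalization.map_units _ y))) = RingHom.id (FractionRing R) := by
      apply IsLocalization.ringHom_ext (nonZeroDivisors R)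
      ext b
      simp [TruncPoly.aug_map, D.aug_apply]
    exact RingHom.congr_fun this a

/-- The logarithmic derivative `z ↦ ∂(z)/z`, `L^× → (L[S]_m)^×`, where `L` is the ring of fractions
of `R` and `∂` is extended to `L`. -/
def dlog : (FractionRing R)ˣ →* (TruncPoly (FractionRing R) m)ˣ :=
  Units.map (D.toFrac.toRingHom : FractionRing R →* TruncPoly (FractionRing R) m) /
    Units.map (TruncPoly.const m (FractionRing R) : FractionRing R →* TruncPoly (FractionRing R) m)

/-- The group of integral logarithmic derivatives
`𝓛_R = {∂(z)/z | z ∈ L^×} ∩ (R[S]_m)^×`. -/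
def integralLog : Subgroup (TruncPoly (FractionRing R) m)ˣ :=
  D.dlog.range ⊓
    (Units.map (TruncPoly.map m (algebraMap R (FractionRing R)) :
      TruncPoly R m →* TruncPoly (FractionRing R) m)).range

/-- The subgroup `𝓛'_R = {∂(u)/u | u ∈ R^×}`. -/
def unitLog : Subgroup (TruncPoly (FractionRing R) m)ˣ :=
  (D.dlog.comp (Units.map (algebraMap R (FractionRing R) : R →* FractionRing R))).range

/-- The quotient `𝓛_R / 𝓛'_R`. -/
abbrev LogQuotient : Type _ := D.integralLog ⧸ D.unitLog.subgroupOf D.integralLog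

/-- The class in `𝓛_R / 𝓛'_R` of an element of `𝓛_R`. -/
def logClass (w : (TruncPoly (FractionRing R) m)ˣ) (hw : w ∈ D.integralLog) : D.LogQuotient :=
  QuotientGroup.mk ⟨w, hw⟩

end HigherDerivation

/-- A non-zero-divisor of `R` as a unit of the ring of fractions. -/
def fracUnit {R : Type*} [CommRing R] (z : R) (hz : z ∈ nonZeroDivisors R) : (FractionRing R)ˣ :=
  (IsLocalization.map_units (FractionRing R) (⟨z, hz⟩ : nonZeroDivisors R)).unit

/-! ### Totally wildly ramified extensions and the standard higher derivation -/

/-- `ϖ` is a uniformizer of a discretely valued field. -/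
structure IsUniformizer {K : Type*} [NormedField K] (ϖ : K) : Prop where
  pos : 0 < ‖ϖ‖
  lt_one : ‖ϖ‖ < 1
  zpow : ∀ x : K, x ≠ 0 → ∃ i : ℤ, ‖x‖ = ‖ϖ‖ ^ i

/-- The value group `|K^×|`. -/
def valueGroup (K : Type*) [NormedField K] : Subgroup ℝˣ :=
  (Units.map ((normHom : K →*₀ ℝ) : K →* ℝ)).range

/-- `ℓ/k` is totally ramified with ramification index `e = p^n`, where `p > 0` is the characteristic
of the residue field of `k`. -/
structure IsTotallyWildlyRamified (k ℓ : Type*) [NormedField k] [NormedField ℓ]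
    [NormedAlgebra k ℓ] (p n : ℕ) : Prop where
  prime : p.Prime
  residueChar : ‖(p : k)‖ < 1
  residue : ∀ x : ℓ, ‖x‖ ≤ 1 → ∃ a : k, ‖a‖ ≤ 1 ∧ ‖x - algebraMap k ℓ a‖ < 1
  index : (valueGroup k).relIndex (valueGroup ℓ) = p ^ n


section StandardDerivation

open UltraSeminorm

variable {ℓ : Type*} [NormedField ℓ] [IsUltrametricDist ℓ] {ϖ : ℓ} (hϖ : IsUniformizer ϖ)

/-- The degree `|ϖ|`. -/
def uniformizerDeg : DegGroup := DegGroup.of ‖ϖ‖ hϖ.pos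

theorem val_neg_uniformizerDeg :
    (fieldSeminorm ℓ).toFun ϖ⁻¹ ≤ (-uniformizerDeg hϖ).val := by
  change ENNReal.ofReal ‖ϖ⁻¹‖ ≤ ENNReal.ofReal ‖ϖ‖⁻¹
  rw [norm_inv]

theorem val_uniformizerDeg : (fieldSeminorm ℓ).toFun ϖ ≤ (uniformizerDeg hϖ).val := le_rfl

/-- The principal symbol `t` of the uniformizer, a unit of the graded residue field. -/
def tUnit : (GrResidue ℓ)ˣ :=
  have h0 : ϖ ≠ 0 := norm_pos_iff.1 hϖ.pos
  have h1 : symbol (v := fieldSeminorm ℓ) (uniformizerDeg hϖ) ϖ (val_uniformizerDeg hϖ) *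
      symbol (-uniformizerDeg hϖ) ϖ⁻¹ (val_neg_uniformizerDeg hϖ) = 1 := by
    rw [symbol_mul]
    exact symbol_congr (add_neg_cancel _) (mul_inv_cancel₀ h0) _
      (by rw [DegGroup.val_zero]; exact (fieldSeminorm ℓ).one_le')
  ⟨symbol (uniformizerDeg hϖ) ϖ (val_uniformizerDeg hϖ),
    symbol (-uniformizerDeg hϖ) ϖ⁻¹ (val_neg_uniformizerDeg hϖ), h1, (mul_comm _ _).trans h1⟩

open Classical in
/-- The integer `i` with `γ = |ϖ|^i`, for `γ` in the value group of `ℓ` (and `0` otherwise). -/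
def ordIndex {ℓ : Type*} [NormedField ℓ] (ϖ : ℓ) (g : DegGroup) : ℤ :=
  if h : ∃ i : ℤ, (Additive.toMul g : {x : ℝ // 0 < x}).1 = ‖ϖ‖ ^ i then h.choose else 0

theorem ordIndex_eq {ℓ : Type*} [NormedField ℓ] {ϖ : ℓ} (hϖ : IsUniformizer ϖ) {g : DegGroup} {i : ℤ}
    (h : (Additive.toMul g : {x : ℝ // 0 < x}).1 = ‖ϖ‖ ^ i) : ordIndex ϖ g = i := by
  have hex : ∃ i : ℤ, (Additive.toMul g : {x : ℝ // 0 < x}).1 = ‖ϖ‖ ^ i := ⟨i, h⟩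
  rw [ordIndex, dif_pos hex]
  exact zpow_right_injective₀ hϖ.pos hϖ.lt_one.ne (hex.choose_spec.symm.trans h)

theorem symbol_eq_zero_or {g : DegGroup} {a : ℓ} (ha : (fieldSeminorm ℓ).toFun a ≤ g.val) :
    symbol g a ha = 0 ∨ (a ≠ 0 ∧ (Additive.toMul g : {x : ℝ // 0 < x}).1 = ‖a‖) := by
  rcases ha.lt_or_eq with h | h
  · exact Or.inl (symbol_eq_zero ha h)
  · right
    have hg : 0 < (Additive.toMul g : {x : ℝ // 0 < x}).1 := (Additive.toMul g).2
    have h' : ‖a‖ = (Additive.toMul g : {x : ℝ // 0 < x}).1 :=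
      (ENNReal.ofReal_eq_ofReal_iff (norm_nonneg a) hg.le).1 h
    exact ⟨norm_pos_iff.1 (h' ▸ hg), h'.symm⟩

/-- The unit `1 + t⁻¹S = (t + S)/t`. -/
def twist (m : ℕ) : (TruncPoly (GrResidue ℓ) m)ˣ :=
  (TruncPoly.isUnit_of_aug m
    (x := 1 + TruncPoly.const m _ (↑(tUnit hϖ)⁻¹ : GrResidue ℓ) * TruncPoly.S m _) (by
      simp [TruncPoly.aug_S])).unit

theorem twist_val (m : ℕ) : (twist hϖ m : TruncPoly (GrResidue ℓ) m) =
    1 + TruncPoly.const m _ (↑(tUnit hϖ)⁻¹ : GrResidue ℓ) * TruncPoly.S m _ := IsUnit.unit_spec _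

theorem aug_twist_zpow (m : ℕ) (i : ℤ) : TruncPoly.aug m (GrResidue ℓ)
    ((twist hϖ m ^ i : (TruncPoly (GrResidue ℓ) m)ˣ) : TruncPoly (GrResidue ℓ) m) = 1 := by
  have h1 : Units.map (TruncPoly.aug m (GrResidue ℓ) : TruncPoly (GrResidue ℓ) m →* GrResidue ℓ)
      (twist hϖ m) = 1 := by
    ext1
    simp [twist_val, TruncPoly.aug_S]
  have h2 := congrArg Units.val (map_zpow (Units.map (TruncPoly.aug m (GrResidue ℓ) :
    TruncPoly (GrResidue ℓ) m →* GrResidue ℓ)) (twist hϖ m) i)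
  rw [h1, one_zpow] at h2
  exact h2

/-- The ring homomorphism `ℓ̃ → ℓ̃[S]_m` underlying the standard higher derivation, see below. -/
def standardRingHom (m : ℕ) : GrResidue ℓ →+* TruncPoly (GrResidue ℓ) m :=
  liftGraded
    (fun g => (AddMonoidHom.mulRight
      ((twist hϖ m ^ ordIndex ϖ g : (TruncPoly (GrResidue ℓ) m)ˣ) :
        TruncPoly (GrResidue ℓ) m)).comp
      ((TruncPoly.const m (GrResidue ℓ) : GrResidue ℓ →+ TruncPoly (GrResidue ℓ) m).comp
        (ofPiece g)))
    (fun h => by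
      have h0 : ordIndex ϖ 0 = 0 := ordIndex_eq hϖ (by simp)
      change TruncPoly.const m (GrResidue ℓ) (symbol 0 1 h) * _ = 1
      rw [symbol_zero_one, h0, map_one]
      simp)
    (fun g h a b ha hb => by
      change TruncPoly.const m (GrResidue ℓ) (symbol (g + h) (a * b) (mul_mem_le ha hb)) * _ =
        (TruncPoly.const m (GrResidue ℓ) (symbol g a ha) * _) *
          (TruncPoly.const m (GrResidue ℓ) (symbol h b hb) * _)
      rw [← symbol_mul ha hb]
      rcases symbol_eq_zero_or ha with h1 | ⟨ha0, h1⟩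
      · rw [h1]
        simp
      rcases symbol_eq_zero_or hb with h2 | ⟨hb0, h2⟩
      · rw [h2]
        simp
      obtain ⟨i, hi⟩ := hϖ.zpow a ha0
      obtain ⟨j, hj⟩ := hϖ.zpow b hb0
      have e : ordIndex ϖ (g + h) = i + j := ordIndex_eq hϖ (by
        rw [toMul_add, Positive.val_mul, h1, h2, hi, hj, zpow_add₀ hϖ.pos.ne'])
      rw [e, ordIndex_eq hϖ (h1.trans hi), ordIndex_eq hϖ (h2.trans hj), zpow_add, map_mul,
        Units.val_mul]
      ring)

theorem standardRingHom_symbol (m : ℕ) (g : DegGroup) (a : ℓ)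
    (ha : (fieldSeminorm ℓ).toFun a ≤ g.val) :
    standardRingHom hϖ m (symbol g a ha) =
      TruncPoly.const m (GrResidue ℓ) (symbol g a ha) *
        ((twist hϖ m ^ ordIndex ϖ g : (TruncPoly (GrResidue ℓ) m)ˣ) :
          TruncPoly (GrResidue ℓ) m) := by
  unfold standardRingHom
  rw [liftGraded_symbol]
  rfl

/-- The standard higher derivation `t ↦ t + S` on the Laurent polynomial ring `ℓ̃ = ℓ̃_1[t, t⁻¹]`.
It fixes `ℓ̃_1` and hence multiplies an element of degree `|ϖ|^i`, which has the form `c t^i`, by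
`((t + S)/t)^i`. -/
def standardDerivation (m : ℕ) : HigherDerivation (GrResidue ℓ) m where
  toRingHom := standardRingHom hϖ m
  aug_apply x := by
    refine RingHom.congr_fun (f := (TruncPoly.aug m (GrResidue ℓ)).comp (standardRingHom hϖ m))
      (g := RingHom.id _) (ringHom_ext_symbol fun g a ha => ?_) x
    rw [RingHom.comp_apply, standardRingHom_symbol, map_mul, TruncPoly.aug_const, aug_twist_zpow,
      mul_one, RingHom.id_apply]

theorem standardDerivation_symbol (m : ℕ) (g : DegGroup) (a : ℓ)
    (ha : (fieldSeminorm ℓ).toFun a ≤ g.val) :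
    (standardDerivation hϖ m).toRingHom (symbol g a ha) =
      TruncPoly.const m (GrResidue ℓ) (symbol g a ha) *
        ((twist hϖ m ^ ordIndex ϖ g : (TruncPoly (GrResidue ℓ) m)ˣ) :
          TruncPoly (GrResidue ℓ) m) :=
  standardRingHom_symbol hϖ m g a ha

/-- The characterization of the standard higher derivation: `∂(t) = t + S`. -/
theorem standardDerivation_t (m : ℕ) :
    (standardDerivation hϖ m).toRingHom (tUnit hϖ : GrResidue ℓ) =
      TruncPoly.const m (GrResidue ℓ) (tUnit hϖ : GrResidue ℓ) + TruncPoly.S m (GrResidue ℓ) := by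
  have h := standardDerivation_symbol hϖ m (uniformizerDeg hϖ) ϖ (val_uniformizerDeg hϖ)
  rw [ordIndex_eq hϖ (i := 1) (by rw [zpow_one]; rfl), zpow_one, twist_val] at h
  refine h.trans ?_
  change TruncPoly.const m (GrResidue ℓ) (tUnit hϖ : GrResidue ℓ) * _ = _
  rw [mul_add, mul_one, ← mul_assoc, ← map_mul, Units.mul_inv, map_one, one_mul]

variable {k : Type*} [NormedField k] [IsUltrametricDist k] [NormedAlgebra k ℓ] {p n : ℕ}

theorem natCast_grResidue {k : Type*} [NormedField k] [NormedAlgebra k ℓ]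
    (h : IsTotallyWildlyRamified k ℓ p n) : (p : GrResidue ℓ) = 0 := by
  have hp : ‖(p : ℓ)‖ < 1 := by
    rw [← map_natCast (algebraMap k ℓ) p, norm_algebraMap']
    exact h.residueChar
  have h1 : (fieldSeminorm ℓ).toFun 1 ≤ (0 : DegGroup).val := by
    rw [DegGroup.val_zero]
    exact (fieldSeminorm ℓ).one_le'
  rw [← nsmul_one, ← symbol_zero_one h1, symbol, ← map_nsmul]
  have : p • pieceMk (v := fieldSeminorm ℓ) 0 1 h1 = 0 := by
    rw [pieceMk, ← QuotientAddGroup.mk_nsmul]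
    refine (QuotientAddGroup.eq_zero_iff _).2 ?_
    change (fieldSeminorm ℓ).toFun (p • (1 : ℓ)) < (0 : DegGroup).val
    rw [DegGroup.val_zero, nsmul_one]
    exact ENNReal.ofReal_lt_one.2 hp
  rw [this, map_zero]

theorem twist_pow {k : Type*} [NormedField k] [NormedAlgebra k ℓ] {p n : ℕ}
    (h : IsTotallyWildlyRamified k ℓ p n) : twist hϖ (p ^ n - 1) ^ (p ^ n) = 1 := by
  have hp : (p : TruncPoly (GrResidue ℓ) (p ^ n - 1)) = 0 := by
    rw [← map_natCast (TruncPoly.const (p ^ n - 1) (GrResidue ℓ)), natCast_grResidue h, map_zero]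
  ext1
  rcases subsingleton_or_nontrivial (TruncPoly (GrResidue ℓ) (p ^ n - 1)) with hs | hs
  · exact Subsingleton.elim _ _
  · have : Fact p.Prime := ⟨h.prime⟩
    have : CharP (TruncPoly (GrResidue ℓ) (p ^ n - 1)) p :=
      (CharP.charP_iff_prime_eq_zero h.prime).2 hp
    have hS : TruncPoly.S (p ^ n - 1) (GrResidue ℓ) ^ (p ^ n) = 0 := by
      have e : p ^ n = p ^ n - 1 + 1 := (Nat.sub_add_cancel (Nat.one_le_pow _ _ h.prime.pos)).symm
      exact (congrArg (TruncPoly.S (p ^ n - 1) (GrResidue ℓ) ^ ·) e).trans (TruncPoly.S_pow _)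
    rw [Units.val_pow_eq_pow_val, twist_val, add_pow_char_pow, one_pow, mul_pow, hS, mul_zero,
      add_zero, Units.val_one]

theorem exists_norm_algebraMap {k ℓ : Type*} [NormedField k] [NormedField ℓ] [NormedAlgebra k ℓ]
    {p n : ℕ} {ϖ : ℓ} (hϖ : IsUniformizer ϖ) (h : IsTotallyWildlyRamified k ℓ p n) (a : k)
    (ha : a ≠ 0) : ∃ i : ℤ, ‖algebraMap k ℓ a‖ = ‖ϖ‖ ^ ((p ^ n : ℕ) * i : ℤ) := by
  have hϖ0 : ϖ ≠ 0 := norm_pos_iff.1 hϖ.pos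
  have ha0 : algebraMap k ℓ a ≠ 0 := by simpa using ha
  set γ : valueGroup ℓ := ⟨_, ⟨Units.mk0 ϖ hϖ0, rfl⟩⟩ with hγ
  set Q := valueGroup ℓ ⧸ (valueGroup k).subgroupOf (valueGroup ℓ)
  have hval : ∀ z : ℤ, (((γ ^ z : valueGroup ℓ) : ℝˣ) : ℝ) = ‖ϖ‖ ^ z := fun z => by
    simp [hγ]
  have hgen : ∀ x : valueGroup ℓ, ∃ z : ℤ, γ ^ z = x := by
    rintro ⟨_, ⟨u, rfl⟩⟩
    obtain ⟨z, hz⟩ := hϖ.zpow u u.ne_zero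
    refine ⟨z, Subtype.ext (Units.ext ?_)⟩
    rw [hval z, ← hz]
    rfl
  have hcyc : ∀ x : Q, x ∈ Subgroup.zpowers (γ : Q) := by
    intro x
    induction x using QuotientGroup.induction_on with
    | H x =>
      obtain ⟨z, rfl⟩ := hgen x
      exact ⟨z, rfl⟩
  have hord : orderOf (γ : Q) = p ^ n := by
    rw [orderOf_eq_card_of_forall_mem_zpowers hcyc]
    exact h.index
  obtain ⟨z, hz⟩ := hϖ.zpow _ ha0
  have hmem : ((γ : Q)) ^ z = 1 := by
    rw [← QuotientGroup.mk_zpow]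
    refine (QuotientGroup.eq_one_iff _).2 ?_
    refine ⟨Units.mk0 a ha, Units.ext ?_⟩
    change ‖a‖ = _
    rw [← norm_algebraMap' ℓ a, hz]
    exact (hval z).symm
  obtain ⟨i, hi⟩ := orderOf_dvd_iff_zpow_eq_one.2 hmem
  refine ⟨i, ?_⟩
  rw [hz, hi, hord]

/-- The standard higher derivation of rank `p^n - 1` is linear over `k̃`. -/
theorem standardDerivation_algebraMap (h : IsTotallyWildlyRamified k ℓ p n) (x : GrResidue k) :
    (standardDerivation hϖ (p ^ n - 1)).toRingHom (algebraMap (GrResidue k) (GrResidue ℓ) x) =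
      TruncPoly.const (p ^ n - 1) (GrResidue ℓ) (algebraMap (GrResidue k) (GrResidue ℓ) x) := by
  refine RingHom.congr_fun
    (f := (standardDerivation hϖ (p ^ n - 1)).toRingHom.comp
      (algebraMap (GrResidue k) (GrResidue ℓ)))
    (g := (TruncPoly.const (p ^ n - 1) (GrResidue ℓ)).comp
      (algebraMap (GrResidue k) (GrResidue ℓ))) (ringHom_ext_symbol fun g a ha => ?_) x
  rw [RingHom.comp_apply, RingHom.comp_apply]
  have ha' : (fieldSeminorm ℓ).toFun (algebraMap k ℓ a) ≤ g.val := by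
    change ENNReal.ofReal _ ≤ _
    rw [norm_algebraMap']
    exact ha
  have e : algebraMap (GrResidue k) (GrResidue ℓ) (symbol g a ha) =
      symbol g (algebraMap k ℓ a) ha' := gradedMap_symbol _ _ g a ha
  rw [e, standardDerivation_symbol]
  rcases symbol_eq_zero_or ha' with h1 | ⟨ha0, h1⟩
  · rw [h1, map_zero, zero_mul]
  · have ha1 : a ≠ 0 := fun h => ha0 (by rw [h, map_zero])
    obtain ⟨i, hi⟩ := exists_norm_algebraMap hϖ h a ha1
    rw [ordIndex_eq hϖ (h1.trans hi), zpow_mul, zpow_natCast, twist_pow hϖ h, one_zpow,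
      Units.val_one, mul_one]

/-- The higher derivation `id ⊗ ∂` on `ℓ̃ ⊗ Ã`, where `∂` is the standard higher derivation of rank
`p^n - 1` on `ℓ̃`. -/
def tensorDerivation (h : IsTotallyWildlyRamified k ℓ p n) (R : Type*) [CommRing R]
    [Algebra (GrResidue k) R] :
    HigherDerivation (GrResidue ℓ ⊗[GrResidue k] R) (p ^ n - 1) where
  toRingHom := (Algebra.TensorProduct.lift
    (⟨(TruncPoly.map (p ^ n - 1) (algebraMap (GrResidue ℓ) (GrResidue ℓ ⊗[GrResidue k] R))).comp
      (standardDerivation hϖ (p ^ n - 1)).toRingHom, fun x => by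
        change TruncPoly.map _ _ ((standardDerivation hϖ (p ^ n - 1)).toRingHom _) = _
        rw [standardDerivation_algebraMap hϖ h, TruncPoly.map_const]
        rfl⟩ :
      GrResidue ℓ →ₐ[GrResidue k] TruncPoly (GrResidue ℓ ⊗[GrResidue k] R) (p ^ n - 1))
    ((Algebra.ofId _ _).restrictScalars (GrResidue k) |>.comp
      (Algebra.TensorProduct.includeRight : R →ₐ[GrResidue k] GrResidue ℓ ⊗[GrResidue k] R))
    (fun _ _ => Commute.all _ _)).toRingHom
  aug_apply x := by
    induction x using TensorProduct.induction_on with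
    | zero => simp
    | add x y hx hy => rw [map_add, map_add, hx, hy]
    | tmul a b =>
      change TruncPoly.aug _ _ (Algebra.TensorProduct.lift _ _ _ (a ⊗ₜ[GrResidue k] b)) = _
      rw [Algebra.TensorProduct.lift_tmul, map_mul]
      change TruncPoly.aug _ _ (TruncPoly.map _ (algebraMap (GrResidue ℓ)
        (GrResidue ℓ ⊗[GrResidue k] R)) ((standardDerivation hϖ (p ^ n - 1)).toRingHom a)) *
          TruncPoly.aug _ _ (TruncPoly.const _ _ ((1 : GrResidue ℓ) ⊗ₜ[GrResidue k] b)) = _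
      rw [TruncPoly.aug_map, HigherDerivation.aug_apply, TruncPoly.aug_const]
      change (a ⊗ₜ[GrResidue k] (1 : R)) * _ = _
      rw [Algebra.TensorProduct.tmul_mul_tmul, one_mul, mul_one]

end StandardDerivation

/-! ### Forms of the disc -/

open scoped Polynomial

/-- The homogeneous elements of degree `γ` of the graded polynomial ring `ℓ̃[r⁻¹T]`: polynomials
`∑ a_i T^i` with `a_i` homogeneous of degree `γ r^{-i}`. -/
def polyHomogeneous (ℓ : Type*) [NormedField ℓ] [IsUltrametricDist ℓ] (r : ℝ) (hr : 0 < r)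
    (g : DegGroup) : Set (GrResidue ℓ)[X] :=
  {f | ∀ i : ℕ, f.coeff i ∈ (fieldSeminorm ℓ).homogeneous (g - i • DegGroup.of r hr)}

/-- A trivialization of the graded reduction of `A`: an isomorphism of graded `ℓ̃`-algebras
`ℓ̃ ⊗ Ã ≃ B̃ = ℓ̃[r⁻¹T]`. -/
structure GradedTrivialization (k ℓ A : Type*) [NontriviallyNormedField k] [IsUltrametricDist k]
    [NormedField ℓ] [IsUltrametricDist ℓ] [NormedAlgebra k ℓ] [NormedCommRing A]
    [NormedAlgebra k A] (r : ℝ) (hr : 0 < r) where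
  toAlgEquiv : (GrResidue ℓ ⊗[GrResidue k] GrRed A) ≃ₐ[GrResidue ℓ] (GrResidue ℓ)[X]
  graded : ∀ (g h : DegGroup), ∀ c ∈ (fieldSeminorm ℓ).homogeneous g,
    ∀ a ∈ (spectralSeminorm A).homogeneous h,
      toAlgEquiv (c ⊗ₜ[GrResidue k] a) ∈ polyHomogeneous ℓ r hr (g + h)

/-- `A` is a form of the closed disc of radius `r` with respect to the finite extension `ℓ/k`: a
strictly affinoid `k`-algebra that becomes isomorphic to `k{r⁻¹T}` over `ℓ`. (Since `ℓ/k` is finite,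
the tensor products over `k` are already complete.) -/
structure IsFormOfDisc (k ℓ A : Type*) [NontriviallyNormedField k] [IsUltrametricDist k]
    [NormedField ℓ] [NormedAlgebra k ℓ] [NormedCommRing A] [NormedAlgebra k A] (r : ℝ) : Prop where
  affinoid : IsStrictlyAffinoid k A
  form : Nonempty ((ℓ ⊗[k] A) ≃ₐ[ℓ] (ℓ ⊗[k] discAlgebra k r))

/-- The higher derivation `∂_L`, restricted to `B̃ = ℓ̃[T] = ℓ̃ ⊗ Ã`; it is the identity on `Ã` and
the standard higher derivation `t ↦ t + S` on `ℓ̃`. (Its extension to the field of fractions `L` is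
built into the definition of logarithmic derivatives.) -/
def formDerivation {k ℓ A : Type*} [NontriviallyNormedField k] [IsUltrametricDist k]
    [NormedField ℓ] [IsUltrametricDist ℓ] [NormedAlgebra k ℓ] [NormedCommRing A]
    [NormedAlgebra k A] {p n : ℕ} (hw : IsTotallyWildlyRamified k ℓ p n) {ϖ : ℓ}
    (hϖ : IsUniformizer ϖ) {r : ℝ} {hr : 0 < r} (θ : GradedTrivialization k ℓ A r hr) :
    HigherDerivation (GrResidue ℓ)[X] (p ^ n - 1) :=
  (tensorDerivation hϖ hw (GrRed A)).transport θ.toAlgEquiv.toRingEquiv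

/-- The element `T - c` of `L^×`. -/
def paramUnit {R : Type*} [CommRing R] (c : R) : (FractionRing R[X])ˣ :=
  fracUnit (Polynomial.X - Polynomial.C c) (Polynomial.monic_X_sub_C c).mem_nonZeroDivisors

/-- The element `T` of `L^×`. -/
def tUnitL (R : Type*) [CommRing R] : (FractionRing R[X])ˣ :=
  fracUnit Polynomial.X Polynomial.monic_X.mem_nonZeroDivisors

end

/-! The degree hypothesis forces both groups to be trivial, so the cyclicity and generator
statements become formal. Three steps carry this.

First, expand $T=\sum_{i\le m}a_it^i$ with homogeneous $a_i\in\widetilde A$. Then $\partial(T)=\sum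
a_i(t+S)^i$, and its coefficients depend on the $a_i$ through a unitriangular matrix of binomials
times powers of $t$. So if those coefficients have degree at most one in $T$, the $a_i$ do too
(`TruncPoly.mem_of_coeff_mem`). Some $a_i$ has nonzero linear coefficient; it is homogeneous, hence
a unit, and $a_i=\alpha T+\beta$ is an affine coordinate already defined over $\widetilde A$
(`exists_affine_coordinate`). Comparing coordinates in the basis $t^i$ gives $\widetilde
A=\widetilde k[a_i]$ (`aeval_bijective_of_affine_coordinate`). Since $\widetilde k$ is a Laurent
polynomial ring over a field, $\widetilde A$ is factorial.

Second, let $b\in\widetilde B$ divide $\partial(b)$. By the same triangularity $b$ divides every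
coordinate of $b=\sum a_it^i$. Removing the gcd of the coordinates leaves a $b'$ whose $p^n$-th
power is an element of $\widetilde A$ dividing the $p^n$-th powers of coprime elements; so $b'$ is a
unit and $b$ is a constant times a unit (`HigherDerivation.ConstantsBasis.exists_eq_mul_unit`).
Constants have trivial logarithmic derivative, whence $\mathcal L=\mathcal L'$.

Third, $A$ is a principal ideal domain, so its Picard group vanishes
(`isPrincipalIdealRing_of_aeval_bijective`). An element of an ideal whose symbol has least degree as
a polynomial generates it: homogeneous division with remainder in $\widetilde k[a_i]$ lifts to
approximate division in $A$, and completeness makes it exact. This needs the norm of $A$ to be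
bounded by its spectral seminorm, which is obtained by comparison with the Gauss norm over $\ell$
(`exists_norm_equivalence`), and needs the spectral values to be discrete. -/

/-! ### Homogeneous components and symbols in a graded reduction -/

namespace UltraSeminorm

variable {A : Type*} [CommRing A] {v : UltraSeminorm A}

/-- The homogeneous component of degree `g` of an element of the graded reduction. -/
noncomputable def component (g : DegGroup) : v.GradedReduction →+ v.GradedReduction :=
  (ofPiece g).comp (DFinsupp.evalAddMonoidHom g)

theorem component_mem (g : DegGroup) (x : v.GradedReduction) : component g x ∈ v.homogeneous g :=
  ⟨_, rfl⟩

theorem ofPiece_apply_self (g : DegGroup) (x : v.Piece g) :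
    (DFinsupp.evalAddMonoidHom g : (DirectSum DegGroup v.Piece) →+ v.Piece g) (ofPiece g x) = x :=
  DirectSum.of_eq_same (β := v.Piece) g x

theorem ofPiece_injective (g : DegGroup) : Function.Injective (ofPiece (v := v) g) :=
  DirectSum.of_injective (β := v.Piece) g

theorem component_of_mem {g : DegGroup} {x : v.GradedReduction} (hx : x ∈ v.homogeneous g) :
    component g x = x := by
  obtain ⟨y, rfl⟩ := hx
  exact congrArg (ofPiece g) (ofPiece_apply_self g y)

theorem component_of_mem_ne {g h : DegGroup} (hgh : g ≠ h) {x : v.GradedReduction}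
    (hx : x ∈ v.homogeneous g) : component h x = 0 := by
  obtain ⟨y, rfl⟩ := hx
  have : (DFinsupp.evalAddMonoidHom h : (DirectSum DegGroup v.Piece) →+ v.Piece h)
    (ofPiece g y) = 0 := DirectSum.of_eq_of_ne (β := v.Piece) g h y hgh.symm
  exact (congrArg (ofPiece h) this).trans (map_zero _)

/-- Every larger index set is allowed, so that two elements can be expanded over a common set and a
degree of interest can be inserted. -/
theorem exists_eq_sum_component (x : v.GradedReduction) :
    ∃ s : Finset DegGroup, ∀ s', s ⊆ s' → x = ∑ g ∈ s', component g x := by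
  classical
  induction x using DirectSum.induction_on with
  | zero => exact ⟨∅, fun s' _ =>
      (Finset.sum_eq_zero fun g _ => map_zero (component (v := v) g)).symm⟩
  | of g x =>
    refine ⟨{g}, fun s' hs => ?_⟩
    have hx : (ofPiece g x) ∈ v.homogeneous g := ⟨x, rfl⟩
    change ofPiece g x = ∑ h ∈ s', component h (ofPiece g x)
    rw [Finset.sum_eq_single g (fun h _ hne => component_of_mem_ne hne.symm hx)
      (fun h => absurd (hs (Finset.mem_singleton_self g)) h), component_of_mem hx]
  | add x y hx hy =>
    obtain ⟨s, hs⟩ := hx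
    obtain ⟨u, hu⟩ := hy
    refine ⟨s ∪ u, fun s' hs' => ?_⟩
    have e : ∀ g, component (v := v) g (x + y) = component g x + component g y :=
      fun g => map_add (component (v := v) g) x y
    simp only [e, Finset.sum_add_distrib]
    rw [← hs s' (Finset.subset_union_left.trans hs'), ← hu s' (Finset.subset_union_right.trans hs')]
    rfl

theorem eq_zero_of_component {x : v.GradedReduction} (h : ∀ g, component g x = 0) : x = 0 := by
  obtain ⟨s, hs⟩ := exists_eq_sum_component x
  rw [hs s subset_rfl]
  exact Finset.sum_eq_zero fun g _ => h g

theorem symbol_mem (g : DegGroup) (a : A) (ha : v.toFun a ≤ g.val) :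
    symbol g a ha ∈ v.homogeneous g := ⟨_, rfl⟩

theorem exists_symbol {g : DegGroup} {x : v.GradedReduction} (hx : x ∈ v.homogeneous g) :
    ∃ a ha, x = symbol g a ha := by
  obtain ⟨y, rfl⟩ := hx
  obtain ⟨a, ha, rfl⟩ := pieceMk_surj y
  exact ⟨a, ha, rfl⟩

theorem symbol_eq_zero_iff {g : DegGroup} {a : A} (ha : v.toFun a ≤ g.val) :
    symbol g a ha = 0 ↔ v.toFun a < g.val := by
  refine ⟨fun h => ?_, symbol_eq_zero ha⟩
  have h1 : pieceMk g a ha = 0 := ofPiece_injective g (h.trans (map_zero _).symm)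
  exact (QuotientAddGroup.eq_zero_iff _).1 h1

theorem toFun_sub_le (a b : A) : v.toFun (a - b) ≤ max (v.toFun a) (v.toFun b) := by
  rw [sub_eq_add_neg, ← v.map_neg' b]
  exact v.add_le_max' _ _

theorem symbol_sub {g : DegGroup} {a b : A} (ha : v.toFun a ≤ g.val) (hb : v.toFun b ≤ g.val) :
    symbol g a ha - symbol g b hb = symbol g (a - b) ((toFun_sub_le a b).trans (max_le ha hb)) :=
  (map_sub (ofPiece (v := v) g) _ _).symm

theorem symbol_eq_symbol_iff {g : DegGroup} {a b : A} (ha : v.toFun a ≤ g.val)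
    (hb : v.toFun b ≤ g.val) : symbol g a ha = symbol g b hb ↔ v.toFun (a - b) < g.val := by
  rw [← sub_eq_zero, symbol_sub, symbol_eq_zero_iff]

theorem mul_mem_homogeneous {g h : DegGroup} {x y : v.GradedReduction} (hx : x ∈ v.homogeneous g)
    (hy : y ∈ v.homogeneous h) : x * y ∈ v.homogeneous (g + h) := by
  obtain ⟨a, ha, rfl⟩ := exists_symbol hx
  obtain ⟨b, hb, rfl⟩ := exists_symbol hy
  rw [symbol_mul]
  exact symbol_mem _ _ _

theorem one_mem_homogeneous : (1 : v.GradedReduction) ∈ v.homogeneous 0 := ⟨_, rfl⟩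

theorem pow_mem_homogeneous {g : DegGroup} {x : v.GradedReduction} (hx : x ∈ v.homogeneous g)
    (n : ℕ) : x ^ n ∈ v.homogeneous (n • g) := by
  induction n with
  | zero => rw [pow_zero, zero_nsmul]; exact one_mem_homogeneous
  | succ n ih => rw [pow_succ, succ_nsmul]; exact mul_mem_homogeneous ih hx

/-- A homogeneous factor only shifts degrees. This is how homogeneous coefficients are extracted
from an identity whose other factors are homogeneous. -/
theorem component_mul {g h : DegGroup} {y : v.GradedReduction} (hy : y ∈ v.homogeneous h)
    (x : v.GradedReduction) : component g (x * y) = component (g - h) x * y := by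
  classical
  obtain ⟨s, hs⟩ := exists_eq_sum_component x
  have hx := hs (insert (g - h) s) (Finset.subset_insert _ _)
  conv_lhs => rw [hx, Finset.sum_mul]
  rw [map_sum (component (v := v) g), Finset.sum_eq_single (g - h)]
  · exact component_of_mem (by simpa using mul_mem_homogeneous (component_mem (g - h) x) hy)
  · intro b _ hb
    refine component_of_mem_ne (g := b + h) ?_ (mul_mem_homogeneous (component_mem b x) hy)
    rintro rfl
    exact hb (by simp)
  · exact fun h => absurd (Finset.mem_insert_self _ s) h

theorem component_sum {ι : Type*} (s : Finset ι) (f : ι → v.GradedReduction) (g : DegGroup) :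
    component g (∑ i ∈ s, f i) = ∑ i ∈ s, component g (f i) :=
  map_sum (component (v := v) g) f s

theorem gradedMap_mem {B : Type*} [CommRing B] {w : UltraSeminorm B} (f : A →+* B)
    (hf : ∀ a, w.toFun (f a) ≤ v.toFun a) {g : DegGroup} {x : v.GradedReduction}
    (hx : x ∈ v.homogeneous g) : gradedMap f hf x ∈ w.homogeneous g := by
  obtain ⟨a, ha, rfl⟩ := exists_symbol hx
  rw [gradedMap_symbol]
  exact symbol_mem _ _ _

theorem gradedMap_component {B : Type*} [CommRing B] {w : UltraSeminorm B} (f : A →+* B)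
    (hf : ∀ a, w.toFun (f a) ≤ v.toFun a) (g : DegGroup) (x : v.GradedReduction) :
    component g (gradedMap f hf x) = gradedMap f hf (component g x) := by
  classical
  obtain ⟨s, hs⟩ := exists_eq_sum_component x
  have hx := hs (insert g s) (Finset.subset_insert _ _)
  conv_lhs => rw [hx, map_sum (gradedMap (w := w) f hf), component_sum]
  rw [Finset.sum_eq_single g]
  · exact component_of_mem (gradedMap_mem f hf (component_mem g x))
  · intro b _ hb
    exact component_of_mem_ne hb (gradedMap_mem f hf (component_mem b x))
  · exact fun h => absurd (Finset.mem_insert_self _ s) h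

/-- Injectivity can be tested on components, and a symbol vanishes exactly when a strict inequality
of seminorms holds, which an isometry reflects. -/
theorem gradedMap_injective {B : Type*} [CommRing B] {w : UltraSeminorm B} (f : A →+* B)
    (hf : ∀ a, w.toFun (f a) = v.toFun a) :
    Function.Injective (gradedMap (v := v) (w := w) f fun a => (hf a).le) := by
  rw [injective_iff_map_eq_zero]
  intro x hx
  refine eq_zero_of_component fun g => ?_
  have h1 := gradedMap_component (w := w) f (fun a => (hf a).le) g x
  rw [hx, map_zero (component (v := w) g)] at h1
  obtain ⟨a, ha, h2⟩ := exists_symbol (component_mem g x)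
  rw [h2, gradedMap_symbol, eq_comm, symbol_eq_zero_iff, hf] at h1
  rw [h2, symbol_eq_zero_iff]
  exact h1

end UltraSeminorm

/-! ### The graded residue field as a Laurent polynomial ring -/

section GrResidueField

open UltraSeminorm LaurentPolynomial

variable {K : Type*} [NormedField K] [IsUltrametricDist K]

theorem exists_norm_eq_of_symbol_ne_zero {g : DegGroup} {a : K}
    (ha : (fieldSeminorm K).toFun a ≤ g.val) (h : symbol g a ha ≠ 0) :
    ∃ h0 : a ≠ 0, g = DegGroup.of ‖a‖ (norm_pos_iff.2 h0) := by
  obtain ⟨h0, h1⟩ := (symbol_eq_zero_or ha).resolve_left h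
  exact ⟨h0, Additive.toMul.injective (Subtype.ext h1)⟩

/-- A nonzero symbol comes from an element whose norm is exactly the degree, and the symbol of its
inverse does the job. -/
theorem exists_homogeneous_inverse {g : DegGroup} {x : GrResidue K}
    (hx : x ∈ (fieldSeminorm K).homogeneous g) (h0 : x ≠ 0) :
    ∃ y ∈ (fieldSeminorm K).homogeneous (-g), x * y = 1 := by
  obtain ⟨a, ha, rfl⟩ := exists_symbol hx
  obtain ⟨ha0, rfl⟩ := exists_norm_eq_of_symbol_ne_zero ha h0
  have hb : (fieldSeminorm K).toFun a⁻¹ ≤ (-DegGroup.of ‖a‖ (norm_pos_iff.2 ha0)).val := by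
    change ENNReal.ofReal ‖a⁻¹‖ ≤ ENNReal.ofReal ‖a‖⁻¹
    rw [norm_inv]
  refine ⟨symbol _ a⁻¹ hb, symbol_mem _ _ _, ?_⟩
  rw [symbol_mul]
  exact symbol_congr (add_neg_cancel _) (mul_inv_cancel₀ ha0) _
    (by rw [DegGroup.val_zero]; exact (fieldSeminorm K).one_le')

theorem grResidue_one_ne_zero : (1 : GrResidue K) ≠ 0 := by
  have h1 : (fieldSeminorm K).toFun 1 ≤ (0 : DegGroup).val := by
    rw [DegGroup.val_zero]
    exact (fieldSeminorm K).one_le'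
  rw [← symbol_zero_one h1, Ne, symbol_eq_zero_iff, DegGroup.val_zero]
  simp [fieldSeminorm]

instance : Nontrivial (GrResidue K) := ⟨⟨1, 0, grResidue_one_ne_zero⟩⟩

variable (K) in
/-- The homogeneous part of degree zero of the graded residue field. -/
def grResidueZero : Subring (GrResidue K) where
  carrier := (fieldSeminorm K).homogeneous 0
  zero_mem' := zero_mem _
  one_mem' := one_mem_homogeneous
  add_mem' := add_mem
  neg_mem' := neg_mem
  mul_mem' ha hb := by simpa using mul_mem_homogeneous ha hb

theorem grResidueZero_isField : IsField (grResidueZero K) where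
  exists_pair_ne := ⟨1, 0, fun h => grResidue_one_ne_zero (congrArg Subtype.val h)⟩
  mul_comm := mul_comm
  mul_inv_cancel {a} ha := by
    obtain ⟨y, hy, hay⟩ := exists_homogeneous_inverse a.2 fun h => ha (Subtype.ext h)
    rw [neg_zero] at hy
    exact ⟨⟨y, hy⟩, Subtype.ext hay⟩

variable {ϖ : K} (hϖ : IsUniformizer ϖ)

theorem tUnit_mem : (tUnit hϖ : GrResidue K) ∈ (fieldSeminorm K).homogeneous (uniformizerDeg hϖ) :=
  symbol_mem _ _ _

theorem tUnit_inv_mem :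
    ((tUnit hϖ)⁻¹ : (GrResidue K)ˣ).1 ∈ (fieldSeminorm K).homogeneous (-uniformizerDeg hϖ) :=
  symbol_mem (-uniformizerDeg hϖ) ϖ⁻¹ (val_neg_uniformizerDeg hϖ)

theorem tUnit_zpow_mem (n : ℤ) : (tUnit hϖ ^ n : (GrResidue K)ˣ).1 ∈
    (fieldSeminorm K).homogeneous (n • uniformizerDeg hϖ) := by
  cases n with
  | ofNat n =>
    simpa using pow_mem_homogeneous (tUnit_mem hϖ) n
  | negSucc n =>
    rw [zpow_negSucc, negSucc_zsmul, ← inv_pow, Units.val_pow_eq_pow_val]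
    have h := pow_mem_homogeneous (tUnit_inv_mem hϖ) (n + 1)
    rwa [neg_nsmul] at h

theorem exists_zsmul_uniformizerDeg {K : Type*} [NormedField K] {ϖ : K} (hϖ : IsUniformizer ϖ) {x : K}
    (hx : x ≠ 0) :
    ∃ n : ℤ, DegGroup.of ‖x‖ (norm_pos_iff.2 hx) = n • uniformizerDeg hϖ := by
  obtain ⟨n, hn⟩ := hϖ.zpow x hx
  exact ⟨n, Additive.toMul.injective (Subtype.ext hn)⟩

theorem zsmul_uniformizerDeg_injective {K : Type*} [NormedField K] {ϖ : K} (hϖ : IsUniformizer ϖ) :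
    Function.Injective fun n : ℤ => n • uniformizerDeg hϖ := by
  intro m n h
  have : ‖ϖ‖ ^ m = ‖ϖ‖ ^ n := congrArg (fun g : DegGroup => (Additive.toMul g).1) h
  exact zpow_right_injective₀ hϖ.pos hϖ.lt_one.ne this

/-- The map from Laurent polynomials over the residue field to the graded residue field that sends
the variable to the symbol of a uniformizer. -/
noncomputable def laurentToGrResidue : (grResidueZero K)[T;T⁻¹] →+* GrResidue K :=
  LaurentPolynomial.eval₂ (grResidueZero K).subtype (tUnit hϖ)

theorem laurentToGrResidue_C_mul_T (a : grResidueZero K) (n : ℤ) :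
    laurentToGrResidue hϖ (C a * T n) = a * (tUnit hϖ ^ n : (GrResidue K)ˣ) := by
  simp [laurentToGrResidue]

/-- Distinct powers of $t$ have distinct degrees, so a single component isolates a single
coefficient; injectivity of the map follows. -/
theorem component_laurentToGrResidue (f : (grResidueZero K)[T;T⁻¹]) (n : ℤ) :
    component (n • uniformizerDeg hϖ) (laurentToGrResidue hϖ f) =
      (f.coeff n : GrResidue K) * (tUnit hϖ ^ n : (GrResidue K)ˣ) := by
  induction f using LaurentPolynomial.induction_on' with
  | add p q hp hq =>
    rw [map_add, map_add (component (v := fieldSeminorm K) _), hp, hq]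
    exact (add_mul _ _ _).symm
  | C_mul_T m a =>
    rw [laurentToGrResidue_C_mul_T]
    have hmem := mul_mem_homogeneous a.2 (tUnit_zpow_mem hϖ m)
    rw [zero_add] at hmem
    have hc : (C a * T m).coeff n = Finsupp.single m a n := by
      rw [← LaurentPolynomial.single_eq_C_mul_T]
      rfl
    rw [hc]
    rcases eq_or_ne m n with rfl | hne
    · rw [component_of_mem hmem]
      simp
    · rw [component_of_mem_ne (fun h => hne (zsmul_uniformizerDeg_injective hϖ h)) hmem]
      simp [hne]

theorem laurentToGrResidue_bijective : Function.Bijective (laurentToGrResidue hϖ) := by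
  constructor
  · rw [injective_iff_map_eq_zero]
    intro f hf
    ext n
    have := component_laurentToGrResidue hϖ f n
    rw [hf, map_zero (component (v := fieldSeminorm K) _), eq_comm, Units.mul_left_eq_zero] at this
    simpa using this
  · intro x
    obtain ⟨s, hs⟩ := exists_eq_sum_component x
    rw [hs s subset_rfl]
    change _ ∈ (laurentToGrResidue hϖ).range
    refine sum_mem fun g _ => ?_
    by_cases h0 : component g x = 0
    · rw [h0]
      exact zero_mem _
    obtain ⟨a, ha, hax⟩ := exists_symbol (component_mem g x)
    obtain ⟨ha0, hg⟩ := exists_norm_eq_of_symbol_ne_zero ha (hax ▸ h0)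
    obtain ⟨n, hn⟩ := exists_zsmul_uniformizerDeg hϖ ha0
    -- Multiplying by $t^{-n}$ moves the component into degree zero, that is, into the coefficient
    -- field.
    have hmem := mul_mem_homogeneous (component_mem g x) (tUnit_zpow_mem hϖ (-n))
    have h00 : g + -n • uniformizerDeg hϖ = 0 := by rw [hg, hn, neg_smul, add_neg_cancel]
    rw [h00] at hmem
    refine ⟨C ⟨_, hmem⟩ * T n, ?_⟩
    rw [laurentToGrResidue_C_mul_T, mul_assoc, ← Units.val_mul, ← zpow_add, neg_add_cancel,
      zpow_zero, Units.val_one, mul_one]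

/-- Laurent polynomials over a field are a localization of a polynomial ring, and factoriality
survives localization. -/
theorem grResidue_isDomain_and_ufd {ϖ : K} (hϖ : IsUniformizer ϖ) :
    IsDomain (GrResidue K) ∧ UniqueFactorizationMonoid (GrResidue K) := by
  let : Field (grResidueZero K) := grResidueZero_isField.toField
  let e := RingEquiv.ofBijective _ (laurentToGrResidue_bijective hϖ)
  have : UniqueFactorizationMonoid (grResidueZero K)[T;T⁻¹] :=
    UniqueFactorizationMonoid.of_isLocalization
      (Submonoid.powers (Polynomial.X : Polynomial (grResidueZero K))) _
  exact ⟨e.symm.toMulEquiv.isDomain _, e.toMulEquiv.uniqueFactorizationMonoid this⟩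

end GrResidueField

/-! ### Coefficients in truncated polynomial rings -/

namespace TruncPoly

variable {R R' : Type*} [CommRing R] [CommRing R'] {m : ℕ}

theorem coeff_add (j : ℕ) (x y : TruncPoly R m) : coeff m j (x + y) = coeff m j x + coeff m j y := by
  simp [coeff]

theorem coeff_sum {ι : Type*} (s : Finset ι) (f : ι → TruncPoly R m) (j : ℕ) :
    coeff m j (∑ i ∈ s, f i) = ∑ i ∈ s, coeff m j (f i) :=
  map_sum (AddMonoidHom.mk' (coeff m j) (coeff_add (R := R) j)) f s

theorem coeff_zero (j : ℕ) : coeff m j (0 : TruncPoly R m) = 0 := by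
  simp [coeff]

theorem coeff_mk {f : Polynomial R} (hf : f.natDegree ≤ m) (j : ℕ) :
    coeff m j (AdjoinRoot.mk _ f) = f.coeff j := by
  nontriviality R
  rw [coeff, AdjoinRoot.modByMonicHom_mk, (Polynomial.modByMonic_eq_self_iff
    (Polynomial.monic_X_pow (m + 1))).2]
  rw [Polynomial.degree_X_pow]
  exact (Polynomial.degree_le_of_natDegree_le hf).trans_lt (by exact_mod_cast Nat.lt_succ_self m)

theorem coeff_const_mul (a : R) (x : TruncPoly R m) (j : ℕ) :
    coeff m j (const m R a * x) = a * coeff m j x := by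
  have : const m R a * x = a • x := (Algebra.smul_def a x).symm
  rw [this, coeff, coeff, map_smul, Polynomial.coeff_smul, smul_eq_mul]

theorem eq_sum_coeff (x : TruncPoly R m) :
    x = ∑ j ∈ Finset.range (m + 1), const m R (coeff m j x) * S m R ^ j := by
  rcases subsingleton_or_nontrivial R with hs | hs
  · have : Subsingleton (TruncPoly R m) :=
      subsingleton_of_zero_eq_one (by
        rw [← map_one (const m R), ← map_zero (const m R), Subsingleton.elim (0 : R) 1])
    exact Subsingleton.elim _ _
  have hdeg : (AdjoinRoot.modByMonicHom (Polynomial.monic_X_pow (R := R) (m + 1)) x).natDegree <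
      m + 1 := by
    obtain ⟨f, rfl⟩ := AdjoinRoot.mk_surjective x
    rw [AdjoinRoot.modByMonicHom_mk]
    have := Polynomial.natDegree_modByMonic_lt f (Polynomial.monic_X_pow (R := R) (m + 1))
      (fun h => by
        have := congrArg Polynomial.natDegree h
        simp at this)
    simpa using this
  have h := AdjoinRoot.mk_leftInverse (Polynomial.monic_X_pow (R := R) (m + 1)) x
  conv_lhs => rw [← h, Polynomial.as_sum_range' _ _ hdeg]
  rw [map_sum]
  refine Finset.sum_congr rfl fun j _ => ?_
  rw [← Polynomial.C_mul_X_pow_eq_monomial, map_mul, map_pow, AdjoinRoot.mk_X, AdjoinRoot.mk_C]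
  rfl

theorem ext_coeff {x y : TruncPoly R m} (h : ∀ j ≤ m, coeff m j x = coeff m j y) : x = y := by
  rw [eq_sum_coeff x, eq_sum_coeff y]
  exact Finset.sum_congr rfl fun j hj => by rw [h j (Nat.lt_succ_iff.1 (Finset.mem_range.1 hj))]

/-- The binomial formula; because $i\le m$, truncation loses no term. -/
theorem coeff_const_mul_add_S_pow {i : ℕ} (hi : i ≤ m) (b t : R) (j : ℕ) :
    coeff m j (const m R b * (const m R t + S m R) ^ i) = (i.choose j : R) * (t ^ (i - j) * b) := by
  have h : (const m R t + S m R) ^ i = AdjoinRoot.mk _ ((Polynomial.X + Polynomial.C t) ^ i) := by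
    rw [map_pow, map_add, AdjoinRoot.mk_X, AdjoinRoot.mk_C]
    exact congrArg (· ^ i) (add_comm (const m R t) (S m R))
  rw [coeff_const_mul, h, coeff_mk, Polynomial.coeff_X_add_C_pow]
  · ring
  · refine (Polynomial.natDegree_pow_le_of_le i
      (Polynomial.natDegree_add_C.le.trans Polynomial.natDegree_X_le)).trans ?_
    simpa using hi

theorem map_coeff (f : R →+* R') (x : TruncPoly R m) (j : ℕ) (hj : j ≤ m) :
    coeff m j (map m f x) = f (coeff m j x) := by
  have hR : ∀ (a : ℕ → R'), coeff m j (∑ i ∈ Finset.range (m + 1), const m R' (a i) * S m R' ^ i)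
      = a j := fun a => by
    rw [coeff_sum, Finset.sum_eq_single j]
    · have := coeff_const_mul_add_S_pow hj (a j) 0 j
      simpa using this
    · intro i hi hij
      have := coeff_const_mul_add_S_pow (Nat.lt_succ_iff.1 (Finset.mem_range.1 hi)) (a i) 0 j
      rw [map_zero, zero_add] at this
      rw [this]
      rcases lt_or_gt_of_ne hij with h | h
      · rw [Nat.choose_eq_zero_of_lt h, Nat.cast_zero, zero_mul]
      · rw [zero_pow (Nat.sub_ne_zero_of_lt h), zero_mul, mul_zero]
    · exact fun h => absurd (Finset.mem_range.2 (Nat.lt_succ_iff.2 hj)) h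
  conv_lhs => rw [eq_sum_coeff x, map_sum]
  simp only [map_mul, map_pow, map_S, map_const]
  exact hR fun i => f (coeff m i x)

theorem map_injective {f : R →+* R'} (hf : Function.Injective f) :
    Function.Injective (map m f) := fun x y h => ext_coeff fun j hj => hf <| by
  rw [← map_coeff f x j hj, ← map_coeff f y j hj, h]

/-- Elements `b₀, …, b_m` lie in a submodule as soon as the coefficients of `∑ bᵢ (t + S)ⁱ` do. -/
theorem mem_of_coeff_mem {R₀ : Type*} [CommRing R₀] [Algebra R₀ R] (N : Submodule R₀ R) (t : R₀)
    (b : ℕ → R) (h : ∀ j ≤ m, coeff m j (∑ i ∈ Finset.range (m + 1),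
      const m R (b i) * (const m R (algebraMap R₀ R t) + S m R) ^ i) ∈ N) {i : ℕ} (hi : i ≤ m) :
    b i ∈ N := by
  -- Descending induction on $i$: the coefficient of $S^i$ is $b_i$ plus multiples of the $b_{i'}$
  -- with $i'>i$, since the binomial matrix is unitriangular.
  induction hd : m - i using Nat.strong_induction_on generalizing i with
  | _ d ih =>
    have h1 := h i hi
    have hmem : i ∈ Finset.range (m + 1) := Finset.mem_range.2 (Nat.lt_succ_iff.2 hi)
    rw [coeff_sum, ← Finset.add_sum_erase _ _ hmem, coeff_const_mul_add_S_pow hi,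
      Nat.choose_self, Nat.cast_one, Nat.sub_self, pow_zero, one_mul, one_mul] at h1
    refine (Submodule.add_mem_iff_left _ (Submodule.sum_mem _ fun i' hi' => ?_)).1 h1
    obtain ⟨hne, hi'm⟩ := Finset.mem_erase.1 hi'
    have hi'm := Nat.lt_succ_iff.1 (Finset.mem_range.1 hi'm)
    rw [coeff_const_mul_add_S_pow hi'm]
    rcases lt_or_gt_of_ne hne with hlt | hlt
    · rw [Nat.choose_eq_zero_of_lt hlt, Nat.cast_zero, zero_mul]
      exact zero_mem _
    · rw [← map_pow, ← Algebra.smul_def, ← nsmul_eq_mul]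
      exact nsmul_mem (N.smul_mem _ (ih (m - i') (by omega) hi'm rfl)) _

end TruncPoly

/-! ### Logarithmic derivatives and rings of constants -/

namespace HigherDerivation

variable {R : Type*} [CommRing R] {m : ℕ} (D : HigherDerivation R m)

theorem toFrac_algebraMap (b : R) : D.toFrac.toRingHom (algebraMap R (FractionRing R) b) =
    TruncPoly.map m (algebraMap R (FractionRing R)) (D.toRingHom b) :=
  IsLocalization.lift_eq _ b

theorem dlog_val_mul (z : (FractionRing R)ˣ) :
    (D.dlog z : TruncPoly (FractionRing R) m) * TruncPoly.const m _ (z : FractionRing R) =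
      D.toFrac.toRingHom z := by
  have : D.dlog z * Units.map (TruncPoly.const m (FractionRing R) :
      FractionRing R →* TruncPoly (FractionRing R) m) z =
    Units.map (D.toFrac.toRingHom : FractionRing R →* TruncPoly (FractionRing R) m) z :=
    div_mul_cancel _ _
  exact congrArg Units.val this

theorem fracUnit_val {z : R} (hz : z ∈ nonZeroDivisors R) :
    (fracUnit z hz : FractionRing R) = algebraMap R (FractionRing R) z := rfl

theorem dlog_eq_of_mul {z : (FractionRing R)ˣ} {w : (TruncPoly (FractionRing R) m)ˣ}
    (h : (w : TruncPoly (FractionRing R) m) * TruncPoly.const m _ (z : FractionRing R) =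
      D.toFrac.toRingHom z) : D.dlog z = w := by
  rw [← dlog_val_mul] at h
  refine Units.ext ?_
  exact ((z.isUnit.map (TruncPoly.const m (FractionRing R))).mul_left_injective h).symm

theorem dlog_fracUnit_eq {z : R} (hz : z ∈ nonZeroDivisors R) {w : (TruncPoly R m)ˣ}
    (h : D.toRingHom z = TruncPoly.const m R z * w) :
    D.dlog (fracUnit z hz) = Units.map (TruncPoly.map m (algebraMap R (FractionRing R)) :
      TruncPoly R m →* TruncPoly (FractionRing R) m) w := by
  refine D.dlog_eq_of_mul ?_
  rw [fracUnit_val, toFrac_algebraMap, h, map_mul, TruncPoly.map_const, mul_comm]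
  rfl

/-- Reducing modulo $S$ and cancelling $z$ shows that $w$ has augmentation $1$. It is therefore
automatically a unit, and it is the logarithmic derivative. -/
theorem dlog_mem_integralLog {z : R} (hz : z ∈ nonZeroDivisors R) {w : TruncPoly R m}
    (h : D.toRingHom z = TruncPoly.const m R z * w) : D.dlog (fracUnit z hz) ∈ D.integralLog := by
  have haug : TruncPoly.aug m R w = 1 := by
    have h1 := congrArg (TruncPoly.aug m R) h
    rw [D.aug_apply, map_mul, TruncPoly.aug_const] at h1
    exact ((mul_cancel_left_mem_nonZeroDivisors hz).1 ((mul_one z).trans h1)).symm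
  have hw : IsUnit w := TruncPoly.isUnit_of_aug m (by rw [haug]; exact isUnit_one)
  exact ⟨⟨_, rfl⟩, hw.unit, (D.dlog_fracUnit_eq hz h).symm⟩

/-- A generator of an ideal that is generated by constants has an integral logarithmic
derivative. -/
theorem dlog_mem_integralLog_of_map_eq {A : Type*} [CommRing A] (j : A →+* R)
    (hj : ∀ a, D.toRingHom (j a) = TruncPoly.const m R (j a)) {I : Ideal A} {z : R}
    (hz : z ∈ nonZeroDivisors R) (hI : I.map j = Ideal.span {z}) :
    D.dlog (fracUnit z hz) ∈ D.integralLog := by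
  -- The extended ideal is generated by constants, which the derivation fixes, so its image stays
  -- inside $zR[S]_m$; in particular $z$ divides $\partial(z)$.
  have hle : I.map j ≤ (Ideal.span {TruncPoly.const m R z}).comap D.toRingHom := by
    rw [Ideal.map_le_iff_le_comap]
    intro a ha
    have h1 : j a ∈ Ideal.span {z} := hI ▸ Ideal.mem_map_of_mem j ha
    obtain ⟨y, hy⟩ := Ideal.mem_span_singleton'.1 h1
    rw [Ideal.mem_comap, Ideal.mem_comap, hj, ← hy, map_mul]
    exact Ideal.mul_mem_left _ _ (Ideal.mem_span_singleton_self _)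
  have hz' : z ∈ I.map j := hI ▸ Ideal.mem_span_singleton_self z
  obtain ⟨w, hw⟩ := Ideal.mem_span_singleton'.1 (Ideal.mem_comap.1 (hle hz'))
  exact D.dlog_mem_integralLog hz (by rw [← hw, mul_comm])

theorem dlog_eq_one_of_const {z : R} (hz : z ∈ nonZeroDivisors R)
    (h : D.toRingHom z = TruncPoly.const m R z) : D.dlog (fracUnit z hz) = 1 := by
  rw [D.dlog_fracUnit_eq hz (w := 1) (by rw [h, Units.val_one, mul_one]), map_one]

theorem const_mul_cancel [IsDomain R] {z : R} (hz : z ≠ 0) {x y : TruncPoly R m}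
    (h : TruncPoly.const m R z * x = TruncPoly.const m R z * y) : x = y :=
  TruncPoly.ext_coeff fun j _ => mul_left_cancel₀ hz <| by
    rw [← TruncPoly.coeff_const_mul, h, TruncPoly.coeff_const_mul]

/-- A presentation of `R` as the free module with basis `1, t, …, t^m` over a subring `A` of
constants of a higher derivation with `t ↦ t + S`. -/
structure ConstantsBasis {A : Type*} [CommRing A] (D : HigherDerivation R m) (j : A →+* R)
    (t : R) : Prop where
  injective : Function.Injective j
  const : ∀ a, D.toRingHom (j a) = TruncPoly.const m R (j a)
  root : D.toRingHom t = TruncPoly.const m R t + TruncPoly.S m R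
  exists_sum : ∀ b, ∃ a : ℕ → A, b = ∑ i ∈ Finset.range (m + 1), j (a i) * t ^ i

namespace ConstantsBasis

variable {D} {A : Type*} [CommRing A] {j : A →+* R} {t : R} (h : D.ConstantsBasis j t)
include h

theorem apply_sum (a : ℕ → A) :
    D.toRingHom (∑ i ∈ Finset.range (m + 1), j (a i) * t ^ i) =
      ∑ i ∈ Finset.range (m + 1),
        TruncPoly.const m R (j (a i)) * (TruncPoly.const m R t + TruncPoly.S m R) ^ i := by
  rw [map_sum]
  refine Finset.sum_congr rfl fun i _ => ?_
  rw [map_mul, map_pow, h.const, h.root]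

/-- Write $c=\sum a_it^i$. Constancy turns this into $(a_0-c)+\sum_{i\ge1}a_i(t+S)^i=0$, and
triangularity over the zero submodule gives $a_0=c$. -/
theorem mem_range_of_const {c : R} (hc : D.toRingHom c = TruncPoly.const m R c) : ∃ a, j a = c := by
  obtain ⟨a, ha⟩ := h.exists_sum c
  refine ⟨a 0, ?_⟩
  have h1 := h.apply_sum a
  rw [← ha, hc] at h1
  have h2 := TruncPoly.mem_of_coeff_mem (m := m) (⊥ : Submodule R R) t
    (fun i => if i = 0 then j (a 0) - c else j (a i)) (fun i hi => ?_) (Nat.zero_le m)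
  · simpa [sub_eq_zero] using h2
  · have : ∑ i ∈ Finset.range (m + 1), TruncPoly.const m R (if i = 0 then j (a 0) - c else j (a i))
        * (TruncPoly.const m R (algebraMap R R t) + TruncPoly.S m R) ^ i = 0 := by
      rw [Finset.sum_range_succ'] at h1 ⊢
      simp only [Nat.add_eq_zero_iff, one_ne_zero, and_false, if_false, if_true, map_sub,
        Algebra.algebraMap_self_apply, pow_zero, mul_one] at h1 ⊢
      rw [h1]
      ring
    rw [this, TruncPoly.coeff_zero]
    exact zero_mem _

/-- A quotient of constants is constant after cancellation in the truncated ring, so it already lies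
in the subring. -/
theorem dvd_of_dvd [IsDomain R] {a b : A} (ha : a ≠ 0) (hab : j a ∣ j b) : a ∣ b := by
  obtain ⟨c, hc⟩ := hab
  have hc' : D.toRingHom c = TruncPoly.const m R c := by
    refine const_mul_cancel (z := j a) (by rwa [Ne, map_eq_zero_iff j h.injective]) ?_
    rw [← map_mul, ← hc, ← h.const, ← h.const, ← map_mul, ← hc]
  obtain ⟨c, rfl⟩ := h.mem_range_of_const hc'
  exact ⟨c, h.injective (by rw [hc, map_mul])⟩

/-- An element of a principal ideal that is stable under the higher derivation: its generator is a
constant up to a unit, if the constants form a factorial ring. -/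
theorem exists_eq_mul_unit [IsDomain R] [IsDomain A] [UniqueFactorizationMonoid A]
    (hpow : ∀ b, ∃ a, j a = b ^ (m + 1)) {b : R} (hb : b ≠ 0) {w : TruncPoly R m}
    (hw : D.toRingHom b = TruncPoly.const m R b * w) : ∃ (a : A) (u : Rˣ), b = j a * u := by
  classical
  obtain ⟨a, ha⟩ := h.exists_sum b
  -- All coefficients of $\partial(b)=bw$ lie in the ideal $(b)$; triangularity passes this on to
  -- the coordinates of $b$.
  have hdvd : ∀ i ∈ Finset.range (m + 1), b ∣ j (a i) := fun i hi => by
    have h1 := TruncPoly.mem_of_coeff_mem (m := m) (Ideal.span {b}) t (fun i => j (a i))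
      (fun l _ => ?_) (Nat.lt_succ_iff.1 (Finset.mem_range.1 hi))
    · exact Ideal.mem_span_singleton.1 h1
    · have h2 := h.apply_sum a
      rw [← ha, hw] at h2
      rw [Algebra.algebraMap_self_apply, ← h2, TruncPoly.coeff_const_mul]
      exact Ideal.mul_mem_right _ _ (Ideal.mem_span_singleton_self b)
  let _ : StrongNormalizationMonoid A := UniqueFactorizationMonoid.strongNormalizationMonoid
  let _ : NormalizedGCDMonoid A := UniqueFactorizationMonoid.toNormalizedGCDMonoid A
  -- Split off the content $g$ of $b$; it remains to show that the primitive part $b'$ is a unit.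
  obtain ⟨a', ha', hgcd⟩ := Finset.extract_gcd (s := Finset.range (m + 1)) a ⟨0, by simp⟩
  set g := (Finset.range (m + 1)).gcd a with hg
  set b' := ∑ i ∈ Finset.range (m + 1), j (a' i) * t ^ i with hb'
  have hbb : b = j g * b' := by
    rw [ha, hb', Finset.mul_sum]
    exact Finset.sum_congr rfl fun i hi => by rw [ha' i hi, map_mul, mul_assoc]
  have hg0 : j g ≠ 0 := by
    rintro h0
    rw [h0, zero_mul] at hbb
    exact hb hbb
  have hb'0 : b' ≠ 0 := by
    rintro h0
    rw [h0, mul_zero] at hbb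
    exact hb hbb
  have hdvd' : ∀ i ∈ Finset.range (m + 1), b' ∣ j (a' i) := fun i hi => by
    have := hdvd i hi
    rw [ha' i hi, map_mul, hbb] at this
    exact (mul_dvd_mul_iff_left hg0).1 this
  -- The power $e=b'^{m+1}$ plays the role of a norm: it moves divisibility by $b'$ into the
  -- factorial ring of constants.
  obtain ⟨e, he⟩ := hpow b'
  have he0 : e ≠ 0 := by
    rintro rfl
    rw [map_zero] at he
    exact pow_ne_zero _ hb'0 he.symm
  have hedvd : ∀ i ∈ Finset.range (m + 1), e ∣ a' i ^ (m + 1) := fun i hi => by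
    refine h.dvd_of_dvd he0 ?_
    rw [he, map_pow]
    exact pow_dvd_pow_of_dvd (hdvd' i hi) _
  -- A prime factor of $e$ would divide every $a_i'^{\,m+1}$, hence every $a'_i$, contrary to
  -- primitivity.
  have heu : IsUnit e := by
    by_contra hne
    obtain ⟨π, hπ, hπe⟩ := WfDvdMonoid.exists_irreducible_factor hne he0
    have hπ' := UniqueFactorizationMonoid.irreducible_iff_prime.1 hπ
    have : π ∣ (Finset.range (m + 1)).gcd a' := Finset.dvd_gcd fun i hi =>
      hπ'.dvd_of_dvd_pow (hπe.trans (hedvd i hi))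
    rw [hgcd] at this
    exact hπ.not_isUnit (isUnit_of_dvd_one this)
  have hb'u : IsUnit b' := (isUnit_pow_iff (Nat.succ_ne_zero m)).1 (he ▸ heu.map j)
  exact ⟨g, hb'u.unit, hbb⟩

/-- Up to a constant factor, every fraction with integral logarithmic derivative is an element of
the ring dividing its own derivative, hence a constant times a unit; only the unit contributes. -/
theorem subsingleton_logQuotient [IsDomain R] [IsDomain A] [UniqueFactorizationMonoid A]
    (hpow : ∀ b, ∃ a, j a = b ^ (m + 1)) : Subsingleton D.LogQuotient := by
  rw [QuotientGroup.subsingleton_iff, Subgroup.subgroupOf_eq_top]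
  rintro _ ⟨⟨z, rfl⟩, w, hw⟩
  obtain ⟨⟨b, s⟩, hbs⟩ := IsLocalization.surj (nonZeroDivisors R) (z : FractionRing R)
  have hinj : Function.Injective (algebraMap R (FractionRing R)) := IsFractionRing.injective _ _
  have hs0 : (s : R) ≠ 0 := nonZeroDivisors.ne_zero s.2
  have hb0 : b ≠ 0 := by
    rintro rfl
    simp only [map_zero] at hbs
    exact (z.isUnit.mul (IsLocalization.map_units _ s)).ne_zero hbs
  -- For $z=b/s$ the denominator is cleared by $s^{m+1}$ rather than $s$, because $s^{m+1}$ is a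
  -- constant and does not change the logarithmic derivative.
  have hc0 : b * s ^ m ≠ 0 := mul_ne_zero hb0 (pow_ne_zero _ hs0)
  have hsm := mem_nonZeroDivisors_of_ne_zero (pow_ne_zero (m + 1) hs0)
  have hz : fracUnit _ (mem_nonZeroDivisors_of_ne_zero hc0) = z * fracUnit _ hsm := by
    refine Units.ext ?_
    rw [Units.val_mul, fracUnit_val, fracUnit_val, map_mul, ← hbs]
    simp only [map_pow]
    ring
  have hz' : D.dlog (fracUnit _ (mem_nonZeroDivisors_of_ne_zero hc0)) = D.dlog z := by
    obtain ⟨a, ha⟩ := hpow s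
    rw [hz, map_mul, D.dlog_eq_one_of_const hsm (by rw [← ha, h.const]), mul_one]
  have hw' : D.toRingHom (b * s ^ m) = TruncPoly.const m R (b * s ^ m) * w := by
    refine TruncPoly.map_injective hinj ?_
    rw [← D.toFrac_algebraMap, map_mul (TruncPoly.map _ _), TruncPoly.map_const]
    have h1 := D.dlog_val_mul (fracUnit _ (mem_nonZeroDivisors_of_ne_zero hc0))
    rw [hz', ← hw, fracUnit_val] at h1
    rw [← h1, mul_comm]
    rfl
  obtain ⟨a, u, hau⟩ := h.exists_eq_mul_unit hpow hc0 hw'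
  have ha0 : j a ≠ 0 := by
    rintro h0
    rw [h0, zero_mul] at hau
    exact hc0 hau
  refine ⟨u, ?_⟩
  rw [← hz', MonoidHom.comp_apply]
  have : fracUnit _ (mem_nonZeroDivisors_of_ne_zero hc0) =
      fracUnit _ (mem_nonZeroDivisors_of_ne_zero ha0) *
        Units.map (algebraMap R (FractionRing R) : R →* FractionRing R) u := by
    refine Units.ext ?_
    rw [Units.val_mul, fracUnit_val, fracUnit_val, hau, map_mul]
    rfl
  rw [this, map_mul, D.dlog_eq_one_of_const _ (h.const a), one_mul]

end ConstantsBasis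

end HigherDerivation

/-! ### Constancy of $p^n$-th powers and uniqueness of coordinates -/

namespace TruncPoly

variable {R : Type*} [CommRing R] {m : ℕ}

theorem pow_eq_zero_of_aug {x : TruncPoly R m} (hx : aug m R x = 0) : x ^ (m + 1) = 0 := by
  obtain ⟨q, rfl⟩ := AdjoinRoot.mk_surjective x
  have h0 : aug m R (AdjoinRoot.mk _ q) = q.coeff 0 := by
    rw [aug, AdjoinRoot.lift_mk, Polynomial.eval₂_id, Polynomial.coeff_zero_eq_eval_zero]
  have h2 := congrArg (AdjoinRoot.mk (Polynomial.X ^ (m + 1) : Polynomial R))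
    (Polynomial.divX_mul_X_add q)
  rw [map_add, map_mul, AdjoinRoot.mk_X, ← h0, hx, map_zero, map_zero, add_zero] at h2
  rw [← h2, mul_pow, S_pow, mul_zero]

end TruncPoly

namespace HigherDerivation

variable {R : Type*} [CommRing R] {m : ℕ}

/-- The difference $\partial(b)-b$ is divisible by $S$, so its power with exponent $m+1=p^n$
vanishes; that power is additive in characteristic $p$. -/
theorem apply_pow_char_pow (D : HigherDerivation R m) {p n : ℕ} [Fact p.Prime] [CharP R p]
    [Nontrivial R] (hm : m + 1 = p ^ n) (b : R) :
    D.toRingHom (b ^ (m + 1)) = TruncPoly.const m R (b ^ (m + 1)) := by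
  have hp : (p : TruncPoly R m) = 0 := by
    rw [← map_natCast (TruncPoly.const m R), CharP.cast_eq_zero, map_zero]
  have : Nontrivial (TruncPoly R m) := (TruncPoly.aug m R).domain_nontrivial
  have : CharP (TruncPoly R m) p := (CharP.charP_iff_prime_eq_zero Fact.out).2 hp
  have h := TruncPoly.pow_eq_zero_of_aug (x := D.toRingHom b - TruncPoly.const m R b)
    (by rw [map_sub, D.aug_apply, TruncPoly.aug_const, sub_self])
  have h' := (congrArg ((D.toRingHom b - TruncPoly.const m R b) ^ ·) hm.symm).trans h
  change _ ^ p ^ n = 0 at h'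
  rw [sub_pow_char_pow, sub_eq_zero, ← map_pow, ← map_pow] at h'
  have hb : b ^ (m + 1) = b ^ p ^ n := congrArg (b ^ ·) hm
  rwa [hb]

theorem ConstantsBasis.exists_eq_pow {D : HigherDerivation R m} {A : Type*} [CommRing A]
    {j : A →+* R} {t : R} (h : D.ConstantsBasis j t) {p n : ℕ} [Fact p.Prime] [CharP R p]
    [Nontrivial R] (hm : m + 1 = p ^ n) (b : R) : ∃ a, j a = b ^ (m + 1) :=
  h.mem_range_of_const (D.apply_pow_char_pow hm b)

/-- Independence of $1,t,\dots,t^m$ is not an axiom of a constants basis: applying the derivation to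
the difference and using triangularity over the zero submodule proves it. -/
theorem ConstantsBasis.sum_injective {D : HigherDerivation R m} {A : Type*} [CommRing A]
    {j : A →+* R} {t : R} (h : D.ConstantsBasis j t) {a b : ℕ → A}
    (hab : ∑ i ∈ Finset.range (m + 1), j (a i) * t ^ i =
      ∑ i ∈ Finset.range (m + 1), j (b i) * t ^ i) {i : ℕ} (hi : i ≤ m) : a i = b i := by
  have h1 := TruncPoly.mem_of_coeff_mem (m := m) (⊥ : Submodule R R) t
    (fun i => j (a i - b i)) (fun l _ => ?_) hi
  · exact sub_eq_zero.1 ((map_eq_zero_iff j h.injective).1 h1)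
  · rw [Algebra.algebraMap_self_apply, ← h.apply_sum fun i => a i - b i]
    simp only [map_sub, sub_mul, Finset.sum_sub_distrib]
    simp only [hab, sub_self, TruncPoly.coeff_zero]
    exact zero_mem _

end HigherDerivation

/-! ### Graded residue fields of a totally ramified extension -/

section Ramified

open UltraSeminorm

variable {k ℓ : Type*} [NormedField k] [IsUltrametricDist k] [NormedField ℓ] [IsUltrametricDist ℓ]
  [NormedAlgebra k ℓ] {p n : ℕ} {ϖ : ℓ}

theorem grResidue_algebraMap_symbol {g : DegGroup} {a : k} (ha : (fieldSeminorm k).toFun a ≤ g.val)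
    (ha' : (fieldSeminorm ℓ).toFun (algebraMap k ℓ a) ≤ g.val) :
    algebraMap (GrResidue k) (GrResidue ℓ) (symbol g a ha) = symbol g (algebraMap k ℓ a) ha' :=
  gradedMap_symbol _ _ g a ha

theorem grResidue_algebraMap_injective :
    Function.Injective (algebraMap (GrResidue k) (GrResidue ℓ)) :=
  gradedMap_injective _ fun a => by simp only [fieldSeminorm, norm_algebraMap']

/-- The quotient of the value groups has order $p^n$, which therefore annihilates the class of
$|\varpi|$. -/
theorem exists_norm_eq_uniformizer_pow {k ℓ : Type*} [NormedField k] [NormedField ℓ]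
    [NormedAlgebra k ℓ] {p n : ℕ} {ϖ : ℓ} (hϖ : IsUniformizer ϖ)
    (hw : IsTotallyWildlyRamified k ℓ p n) : ∃ c : k, c ≠ 0 ∧ ‖c‖ = ‖ϖ‖ ^ (p ^ n) := by
  have hϖ0 : ϖ ≠ 0 := norm_pos_iff.1 hϖ.pos
  set γ : valueGroup ℓ := ⟨_, ⟨Units.mk0 ϖ hϖ0, rfl⟩⟩ with hγ
  have h1 : γ ^ (p ^ n) ∈ (valueGroup k).subgroupOf (valueGroup ℓ) := by
    rw [← QuotientGroup.eq_one_iff, QuotientGroup.mk_pow, ← hw.index]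
    exact pow_card_eq_one'
  obtain ⟨u, hu⟩ := h1
  refine ⟨u, u.ne_zero, ?_⟩
  have := congrArg Units.val hu
  simpa [hγ] using this

/-- A nonzero $x$ is the symbol of some $a$ of exact norm. Matching its norm by $c^e\varpi^i$ with
$c\in k$ and $0\le i<p^n$, and then the residue of the quotient by some $b\in k$, shows that
$bc^e\varpi^i$ has the same symbol as $a$. -/
theorem exists_homogeneous_mul_tUnit_pow (hϖ : IsUniformizer ϖ)
    (hw : IsTotallyWildlyRamified k ℓ p n) {g : DegGroup} {x : GrResidue ℓ}
    (hx : x ∈ (fieldSeminorm ℓ).homogeneous g) :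
    ∃ i < p ^ n, ∃ c : GrResidue k,
      x = algebraMap (GrResidue k) (GrResidue ℓ) c * (tUnit hϖ : GrResidue ℓ) ^ i := by
  have hq : 0 < p ^ n := Nat.pow_pos hw.prime.pos
  obtain ⟨a, ha, rfl⟩ := exists_symbol hx
  by_cases h0 : symbol g a ha = 0
  · exact ⟨0, hq, 0, by rw [h0, map_zero, zero_mul]⟩
  obtain ⟨ha0, rfl⟩ := exists_norm_eq_of_symbol_ne_zero ha h0
  obtain ⟨z, hz⟩ := hϖ.zpow a ha0
  obtain ⟨c, hc0, hc⟩ := exists_norm_eq_uniformizer_pow hϖ hw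
  have hϖ0 : ϖ ≠ 0 := norm_pos_iff.1 hϖ.pos
  have hqz : ((p ^ n : ℕ) : ℤ) ≠ 0 := by exact_mod_cast hq.ne'
  -- Euclidean division of the exponent: $p^n$ steps are absorbed by $c\in k$, and the remainder $i$
  -- is the power of $t$.
  set i := (z % (p ^ n : ℕ)).toNat with hi
  have hi' : (i : ℤ) = z % (p ^ n : ℕ) := Int.toNat_of_nonneg (Int.emod_nonneg _ hqz)
  have hilt : i < p ^ n := by
    have := Int.emod_lt_of_pos z (b := ((p ^ n : ℕ) : ℤ)) (by exact_mod_cast hq)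
    omega
  set e := z / (p ^ n : ℕ) with he
  have hnorm : ‖a‖ = ‖algebraMap k ℓ c ^ e * ϖ ^ i‖ := by
    rw [norm_mul, norm_zpow, norm_pow, norm_algebraMap', hc, hz, ← zpow_natCast, ← zpow_mul,
      ← zpow_natCast, ← zpow_add₀ hϖ.pos.ne', hi', Int.mul_ediv_add_emod]
  set y := algebraMap k ℓ c ^ e * ϖ ^ i with hy
  have hy0 : y ≠ 0 := by
    rw [← norm_pos_iff, ← hnorm, norm_pos_iff]
    exact ha0
  obtain ⟨b, hb, hab⟩ := hw.residue (a / y) (by rw [norm_div, hnorm, div_self (by simpa using hy0)])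
  have hsub : ‖a - algebraMap k ℓ (b * c ^ e) * ϖ ^ i‖ < ‖a‖ := by
    have : a - algebraMap k ℓ (b * c ^ e) * ϖ ^ i = (a / y - algebraMap k ℓ b) * y := by
      rw [sub_mul, div_mul_cancel₀ _ hy0, hy, map_mul, map_zpow₀]
      ring
    rw [this, norm_mul, hnorm]
    exact (mul_lt_iff_lt_one_left (norm_pos_iff.2 hy0)).2 hab
  have hpos := norm_pos_iff.2 ha0
  have hbc : ‖b * c ^ e‖ * ‖ϖ‖ ^ i ≤ ‖a‖ := by
    rw [hnorm, hy, norm_mul, norm_mul, norm_zpow, norm_zpow, norm_algebraMap', norm_pow, mul_assoc]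
    exact mul_le_of_le_one_left (by positivity) hb
  set g' : DegGroup := DegGroup.of ‖a‖ hpos - i • uniformizerDeg hϖ with hg'
  have hg'val : (Additive.toMul g').1 * ‖ϖ‖ ^ i = ‖a‖ := by
    have : g' + i • uniformizerDeg hϖ = DegGroup.of ‖a‖ hpos := sub_add_cancel _ _
    exact congrArg (fun g : DegGroup => (Additive.toMul g).1) this
  have hle : (fieldSeminorm k).toFun (b * c ^ e) ≤ g'.val := by
    refine ENNReal.ofReal_le_ofReal ?_
    rw [← hg'val] at hbc
    exact le_of_mul_le_mul_right hbc (pow_pos hϖ.pos i)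
  have hle' : (fieldSeminorm ℓ).toFun (algebraMap k ℓ (b * c ^ e)) ≤ g'.val := by
    change ENNReal.ofReal _ ≤ _
    rw [norm_algebraMap']
    exact hle
  refine ⟨i, hilt, symbol g' (b * c ^ e) hle, ?_⟩
  have hti : ∀ i : ℕ, ∃ hh, (tUnit hϖ : GrResidue ℓ) ^ i =
      symbol (v := fieldSeminorm ℓ) (i • uniformizerDeg hϖ) (ϖ ^ i) hh := by
    intro i
    induction i with
    | zero =>
      refine ⟨?_, ?_⟩
      · rw [zero_nsmul, pow_zero, DegGroup.val_zero]
        exact (fieldSeminorm ℓ).one_le'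
      · rw [pow_zero]
        exact symbol_congr (zero_nsmul _).symm (pow_zero ϖ).symm
          (by rw [DegGroup.val_zero]; exact (fieldSeminorm ℓ).one_le') _
    | succ i ih =>
      obtain ⟨hh, e⟩ := ih
      have := mul_mem_le hh (val_uniformizerDeg hϖ)
      refine ⟨by rwa [pow_succ, succ_nsmul], ?_⟩
      rw [pow_succ, e]
      exact (symbol_mul hh (val_uniformizerDeg hϖ)).trans
        (symbol_congr (succ_nsmul _ _).symm (pow_succ _ _).symm _ _)
  obtain ⟨hh, e⟩ := hti i
  rw [grResidue_algebraMap_symbol hle hle', e, symbol_mul]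
  have hadd : g' + i • uniformizerDeg hϖ = DegGroup.of ‖a‖ hpos := sub_add_cancel _ _
  have hle2 := mul_mem_le hle' hh
  rw [hadd] at hle2
  rw [symbol_congr hadd rfl _ hle2, symbol_eq_symbol_iff]
  exact (ENNReal.ofReal_lt_ofReal_iff hpos).2 hsub

theorem exists_eq_sum_algebraMap_mul_tUnit_pow (hϖ : IsUniformizer ϖ)
    (hw : IsTotallyWildlyRamified k ℓ p n) (x : GrResidue ℓ) :
    ∃ c : ℕ → GrResidue k, x = ∑ i ∈ Finset.range (p ^ n - 1 + 1),
      algebraMap (GrResidue k) (GrResidue ℓ) (c i) * (tUnit hϖ : GrResidue ℓ) ^ i := by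
  classical
  have hq : p ^ n - 1 + 1 = p ^ n := Nat.sub_add_cancel (Nat.pow_pos hw.prime.pos)
  obtain ⟨s, hs⟩ := exists_eq_sum_component x
  rw [hs s subset_rfl]
  refine Finset.sum_induction _ (fun x : GrResidue ℓ => ∃ c : ℕ → GrResidue k,
    x = ∑ i ∈ Finset.range (p ^ n - 1 + 1),
      algebraMap (GrResidue k) (GrResidue ℓ) (c i) * (tUnit hϖ : GrResidue ℓ) ^ i) ?_ ?_ ?_
  · rintro _ _ ⟨c, rfl⟩ ⟨d, rfl⟩
    refine ⟨fun i => c i + d i, ?_⟩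
    rw [← Finset.sum_add_distrib]
    exact Finset.sum_congr rfl fun i _ => by rw [map_add, add_mul]
  · exact ⟨fun _ => 0, by simp⟩
  · intro g _
    obtain ⟨i, hi, c, hc⟩ := exists_homogeneous_mul_tUnit_pow hϖ hw (component_mem g x)
    refine ⟨fun l => if l = i then c else 0, ?_⟩
    rw [hc, Finset.sum_eq_single i]
    · simp
    · intro l _ hl
      simp [hl]
    · intro h
      exact absurd (Finset.mem_range.2 (hq ▸ hi)) h

theorem standardDerivation_constantsBasis (hϖ : IsUniformizer ϖ)
    (hw : IsTotallyWildlyRamified k ℓ p n) :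
    (standardDerivation hϖ (p ^ n - 1)).ConstantsBasis
      (algebraMap (GrResidue k) (GrResidue ℓ)) (tUnit hϖ : GrResidue ℓ) where
  injective := grResidue_algebraMap_injective
  const := standardDerivation_algebraMap hϖ hw
  root := standardDerivation_t hϖ _
  exists_sum := exists_eq_sum_algebraMap_mul_tUnit_pow hϖ hw

/-- The basis `1, t, …` of the graded residue field of a totally ramified extension. -/
theorem exists_basis_tUnit_pow (hϖ : IsUniformizer ϖ) (hw : IsTotallyWildlyRamified k ℓ p n) :
    Nonempty (Module.Basis (Fin (p ^ n - 1 + 1)) (GrResidue k) (GrResidue ℓ)) := by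
  have h := standardDerivation_constantsBasis hϖ hw
  refine ⟨Module.Basis.mk (v := fun i : Fin (p ^ n - 1 + 1) => (tUnit hϖ : GrResidue ℓ) ^ (i : ℕ))
    ?_ ?_⟩
  · rw [Fintype.linearIndependent_iff]
    intro c hc i
    -- Linear independence comes from the derivation; the coefficients are extended by zero to all
    -- natural numbers to fit the statement.
    have h1 := h.sum_injective (a := fun i => if hi : i < p ^ n - 1 + 1 then c ⟨i, hi⟩ else 0)
      (b := fun _ => 0) ?_ (Nat.lt_succ_iff.1 i.2)
    · simpa [i.is_le] using h1
    · rw [Finset.sum_range, Finset.sum_range]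
      simp only [map_zero, zero_mul, Finset.sum_const_zero]
      rw [← hc]
      exact Finset.sum_congr rfl fun i _ => by simp [Algebra.smul_def, i.is_le]
  · intro x _
    obtain ⟨c, rfl⟩ := exists_eq_sum_algebraMap_mul_tUnit_pow hϖ hw x
    rw [Finset.sum_range]
    refine Submodule.sum_mem _ fun i _ => ?_
    rw [← Algebra.smul_def]
    exact Submodule.smul_mem _ _ (Submodule.subset_span ⟨i, rfl⟩)

end Ramified

/-! ### The form derivation, and an affine coordinate over $\widetilde A$ -/

section Structure

open UltraSeminorm
open scoped Polynomial

variable {k ℓ A : Type*} [NontriviallyNormedField k] [IsUltrametricDist k]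
  [NormedField ℓ] [IsUltrametricDist ℓ] [NormedAlgebra k ℓ] [NormedCommRing A] [NormedAlgebra k A]
  {p n : ℕ} {ϖ : ℓ} {r : ℝ} {hr : 0 < r}

/-- The inclusion of the graded reduction of `A` into the graded polynomial ring that is given by a
trivialization. -/
noncomputable abbrev GradedTrivialization.incl (θ : GradedTrivialization k ℓ A r hr) :
    GrRed A →+* (GrResidue ℓ)[X] :=
  (θ.toAlgEquiv : (GrResidue ℓ ⊗[GrResidue k] GrRed A) →+* (GrResidue ℓ)[X]).comp
    (Algebra.TensorProduct.includeRight :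
      GrRed A →ₐ[GrResidue k] GrResidue ℓ ⊗[GrResidue k] GrRed A).toRingHom

theorem GradedTrivialization.apply_tmul (θ : GradedTrivialization k ℓ A r hr) (c : GrResidue ℓ)
    (a : GrRed A) :
    θ.toAlgEquiv (c ⊗ₜ[GrResidue k] a) = Polynomial.C c * θ.incl a := by
  have : c ⊗ₜ[GrResidue k] a = c • ((1 : GrResidue ℓ) ⊗ₜ[GrResidue k] a) := by
    rw [TensorProduct.smul_tmul', smul_eq_mul, mul_one]
  rw [this, map_smul, ← Polynomial.smul_eq_C_mul]
  rfl

theorem GradedTrivialization.incl_algebraMap (θ : GradedTrivialization k ℓ A r hr)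
    (c : GrResidue k) : θ.incl (algebraMap (GrResidue k) (GrRed A) c) =
      Polynomial.C (algebraMap (GrResidue k) (GrResidue ℓ) c) := by
  change θ.toAlgEquiv ((1 : GrResidue ℓ) ⊗ₜ[GrResidue k] (algebraMap (GrResidue k) (GrRed A) c)) = _
  rw [← mul_one (algebraMap (GrResidue k) (GrRed A) c), ← Algebra.smul_def,
    TensorProduct.tmul_smul, TensorProduct.smul_tmul', Algebra.smul_def, mul_one]
  rw [θ.apply_tmul, map_one, mul_one]

variable (hw : IsTotallyWildlyRamified k ℓ p n) (hϖ : IsUniformizer ϖ)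
  (θ : GradedTrivialization k ℓ A r hr)

theorem formDerivation_apply (x : GrResidue ℓ ⊗[GrResidue k] GrRed A) :
    (formDerivation hw hϖ θ).toRingHom (θ.toAlgEquiv x) =
      TruncPoly.map _ (θ.toAlgEquiv : (GrResidue ℓ ⊗[GrResidue k] GrRed A) →+* (GrResidue ℓ)[X])
        ((tensorDerivation hϖ hw (GrRed A)).toRingHom x) := by
  refine congrArg (fun x => TruncPoly.map _ _ ((tensorDerivation hϖ hw (GrRed A)).toRingHom x)) ?_
  exact θ.toAlgEquiv.symm_apply_apply x

theorem tensorDerivation_tmul (c : GrResidue ℓ) (a : GrRed A) :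
    (tensorDerivation hϖ hw (GrRed A)).toRingHom (c ⊗ₜ[GrResidue k] a) =
      TruncPoly.map _ (algebraMap (GrResidue ℓ) (GrResidue ℓ ⊗[GrResidue k] GrRed A))
        ((standardDerivation hϖ (p ^ n - 1)).toRingHom c) *
      TruncPoly.const _ _ ((1 : GrResidue ℓ) ⊗ₜ[GrResidue k] a) :=
  Algebra.TensorProduct.lift_tmul _ _ (fun _ _ => Commute.all _ _) _ _

theorem formDerivation_incl (a : GrRed A) :
    (formDerivation hw hϖ θ).toRingHom (θ.incl a) = TruncPoly.const _ _ (θ.incl a) := by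
  refine (formDerivation_apply hw hϖ θ ((1 : GrResidue ℓ) ⊗ₜ[GrResidue k] a)).trans ?_
  rw [tensorDerivation_tmul, map_one, map_one, one_mul, TruncPoly.map_const]
  rfl

theorem formDerivation_C (c : GrResidue ℓ) :
    (formDerivation hw hϖ θ).toRingHom (Polynomial.C c) =
      TruncPoly.map _ Polynomial.C ((standardDerivation hϖ (p ^ n - 1)).toRingHom c) := by
  have h1 := θ.apply_tmul c 1
  rw [map_one, mul_one] at h1
  rw [← h1, formDerivation_apply, tensorDerivation_tmul]
  have h2 : ((1 : GrResidue ℓ) ⊗ₜ[GrResidue k] (1 : GrRed A)) = 1 := rfl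
  rw [h2, map_one, mul_one]
  have h3 : Polynomial.C = (θ.toAlgEquiv : (GrResidue ℓ ⊗[GrResidue k] GrRed A) →+*
      (GrResidue ℓ)[X]).comp (algebraMap (GrResidue ℓ) (GrResidue ℓ ⊗[GrResidue k] GrRed A)) :=
    RingHom.ext fun c => (θ.toAlgEquiv.commutes c).symm
  rw [h3]
  refine TruncPoly.ext_coeff fun j hj => ?_
  rw [TruncPoly.map_coeff _ _ j hj, TruncPoly.map_coeff _ _ j hj, TruncPoly.map_coeff _ _ j hj]
  rfl

/-- The ring $\widetilde\ell$ is free and nonzero over $\widetilde k$, hence faithfully flat. -/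
theorem GradedTrivialization.incl_injective (hw : IsTotallyWildlyRamified k ℓ p n)
    (hϖ : IsUniformizer ϖ) (θ : GradedTrivialization k ℓ A r hr) :
    Function.Injective θ.incl := by
  obtain ⟨b⟩ := exists_basis_tUnit_pow hϖ hw
  have : Module.Free (GrResidue k) (GrResidue ℓ) := Module.Free.of_basis b
  have h : Function.Injective (fun a : GrRed A => (1 : GrResidue ℓ) ⊗ₜ[GrResidue k] a) :=
    Module.FaithfullyFlat.tensorProduct_mk_injective (A := GrResidue k) (B := GrResidue ℓ) (GrRed A)
  exact θ.toAlgEquiv.injective.comp h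

/-- The powers of $t$ span $\widetilde\ell$ over $\widetilde k$, and they still span after base
change to $\widetilde A$; the derivation on constants and on $t$ is known by construction. -/
theorem formDerivation_constantsBasis :
    (formDerivation hw hϖ θ).ConstantsBasis θ.incl
      (Polynomial.C (tUnit hϖ : GrResidue ℓ)) where
  injective := θ.incl_injective hw hϖ
  const := formDerivation_incl hw hϖ θ
  root := by
    rw [formDerivation_C, standardDerivation_t, map_add, TruncPoly.map_const, TruncPoly.map_S]
  exists_sum b := by
    obtain ⟨x, rfl⟩ := θ.toAlgEquiv.surjective b
    induction x using TensorProduct.induction_on with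
    | zero => exact ⟨fun _ => 0, by simp⟩
    | add x y hx hy =>
      obtain ⟨a, ha⟩ := hx
      obtain ⟨b, hb⟩ := hy
      refine ⟨fun i => a i + b i, ?_⟩
      rw [map_add, ha, hb, ← Finset.sum_add_distrib]
      exact Finset.sum_congr rfl fun i _ => by rw [map_add, add_mul]
    | tmul c a =>
      obtain ⟨d, rfl⟩ := exists_eq_sum_algebraMap_mul_tUnit_pow (k := k) hϖ hw c
      refine ⟨fun i => algebraMap (GrResidue k) (GrRed A) (d i) * a, ?_⟩
      rw [θ.apply_tmul, map_sum, Finset.sum_mul]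
      refine Finset.sum_congr rfl fun i _ => ?_
      rw [map_mul θ.incl, θ.incl_algebraMap, map_mul, map_pow]
      ring

/-- The trivialization respects gradings, so the coefficient of $T^i$ in an element of degree $h$
has degree $h-i\cdot r$ (additively written). -/
theorem GradedTrivialization.coeff_incl_component (θ : GradedTrivialization k ℓ A r hr)
    (g : DegGroup) (y : GrRed A) (i : ℕ) :
    (θ.incl (component g y)).coeff i =
      component (g - i • DegGroup.of r hr) ((θ.incl y).coeff i) := by
  classical
  have hom : ∀ h, (θ.incl (component h y)).coeff i ∈
      (fieldSeminorm ℓ).homogeneous (h - i • DegGroup.of r hr) := fun h => by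
    have := θ.graded 0 h 1 one_mem_homogeneous _ (component_mem h y) i
    rwa [zero_add] at this
  obtain ⟨s, hs⟩ := exists_eq_sum_component y
  have hy := hs (insert g s) (Finset.subset_insert _ _)
  conv_rhs => rw [hy, map_sum θ.incl, Polynomial.finsetSum_coeff, component_sum]
  rw [Finset.sum_eq_single g, component_of_mem (hom g)]
  · intro h _ hne
    exact component_of_mem_ne (fun e => hne (sub_left_injective e)) (hom h)
  · exact fun h => absurd (Finset.mem_insert_self _ s) h

/-- Both $T$ and the $t^i$ are homogeneous. Hence the coordinates of $T$ may be replaced by their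
components of the degree that makes each summand have degree $r$. -/
theorem exists_homogeneous_sum_eq_X (hw : IsTotallyWildlyRamified k ℓ p n) (hϖ : IsUniformizer ϖ)
    (θ : GradedTrivialization k ℓ A r hr) : ∃ (g : ℕ → DegGroup) (a : ℕ → GrRed A),
    (∀ i, a i ∈ (spectralSeminorm A).homogeneous (g i)) ∧
    Polynomial.X = ∑ i ∈ Finset.range (p ^ n - 1 + 1),
      θ.incl (a i) * Polynomial.C (tUnit hϖ : GrResidue ℓ) ^ i := by
  obtain ⟨a, ha⟩ := (formDerivation_constantsBasis hw hϖ θ).exists_sum Polynomial.X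
  refine ⟨fun i => DegGroup.of r hr - i • uniformizerDeg hϖ,
    fun i => component (DegGroup.of r hr - i • uniformizerDeg hϖ) (a i),
    fun i => component_mem _ _, ?_⟩
  ext j
  have h1 := congrArg (fun f => component (DegGroup.of r hr - j • DegGroup.of r hr)
    (Polynomial.coeff f j)) ha
  simp only [Polynomial.finsetSum_coeff, component_sum, ← map_pow, Polynomial.coeff_mul_C] at h1 ⊢
  have h2 : component (DegGroup.of r hr - j • DegGroup.of r hr)
      ((Polynomial.X : (GrResidue ℓ)[X]).coeff j) = (Polynomial.X : (GrResidue ℓ)[X]).coeff j := by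
    rw [Polynomial.coeff_X]
    split_ifs with hj
    · subst hj
      refine component_of_mem ?_
      rw [one_nsmul, sub_self]
      exact one_mem_homogeneous
    · exact map_zero (component (v := fieldSeminorm ℓ) _)
  rw [← h2, h1]
  refine Finset.sum_congr rfl fun i _ => ?_
  rw [component_mul (pow_mem_homogeneous (tUnit_mem hϖ) i), θ.coeff_incl_component]
  congr 2
  rw [sub_right_comm]

/-- If `∂(T)` is of degree one in `T`, then the graded reduction of `A` contains a homogeneous
element that is an affine coordinate of the graded polynomial ring. -/
theorem exists_affine_coordinate
    (hdeg : TruncPoly.degT _ ((formDerivation hw hϖ θ).toRingHom Polynomial.X) = 1) :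
    ∃ (s : DegGroup) (a : GrRed A) (α : (GrResidue ℓ)ˣ) (β : GrResidue ℓ),
      a ∈ (spectralSeminorm A).homogeneous s ∧
      θ.incl a = Polynomial.C (α : GrResidue ℓ) * Polynomial.X + Polynomial.C β := by
  obtain ⟨g, a, hag, ha⟩ := exists_homogeneous_sum_eq_X hw hϖ θ
  have hle : ∀ i ≤ p ^ n - 1, (θ.incl (a i)).natDegree ≤ 1 := fun i hi => by
    -- Triangularity for the $\widetilde\ell$-submodule of polynomials of degree at most one: it
    -- contains the coefficients of $\partial(T)$, hence the coordinates of $T$.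
    have h1 := TruncPoly.mem_of_coeff_mem (m := p ^ n - 1) (Polynomial.degreeLE (GrResidue ℓ) 1)
      (tUnit hϖ : GrResidue ℓ) (fun i => θ.incl (a i)) (fun j hj => ?_) hi
    · exact Polynomial.natDegree_le_of_degree_le (Polynomial.mem_degreeLE.1 h1)
    · have h2 := (formDerivation_constantsBasis hw hϖ θ).apply_sum a
      rw [← ha] at h2
      rw [Polynomial.algebraMap_eq, ← h2, Polynomial.mem_degreeLE]
      refine Polynomial.degree_le_of_natDegree_le ?_
      refine le_trans ?_ hdeg.le
      exact Finset.le_sup (f := fun j => (TruncPoly.coeff (p ^ n - 1) j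
        ((formDerivation hw hϖ θ).toRingHom Polynomial.X)).natDegree)
        (Finset.mem_range.2 (Nat.lt_succ_iff.2 hj))
  -- Comparing coefficients of $T$ gives $1$ on the left, so at least one coordinate is not a
  -- constant polynomial.
  have h1 := congrArg (fun f => Polynomial.coeff f 1) ha
  simp only [Polynomial.finsetSum_coeff, ← map_pow, Polynomial.coeff_mul_C,
    Polynomial.coeff_X_one] at h1
  obtain ⟨i, hi, hne⟩ : ∃ i ∈ Finset.range (p ^ n - 1 + 1), (θ.incl (a i)).coeff 1 ≠ 0 := by
    by_contra! h0
    rw [Finset.sum_eq_zero fun i hi => by rw [h0 i hi, zero_mul]] at h1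
    exact grResidue_one_ne_zero h1
  -- Homogeneity of the coordinate is what turns a nonzero linear coefficient into a unit.
  have hhom := θ.graded 0 _ 1 one_mem_homogeneous _ (hag i) 1
  obtain ⟨y, -, hy⟩ := exists_homogeneous_inverse hhom hne
  refine ⟨g i, a i, Units.mkOfMulEqOne _ y hy, (θ.incl (a i)).coeff 0, hag i, ?_⟩
  exact Polynomial.eq_X_add_C_of_natDegree_le_one (hle i (Nat.lt_succ_iff.1 (Finset.mem_range.1 hi)))

end Structure

/-! ### $\widetilde A$ as a polynomial ring over $\widetilde k$ -/

section AffineCoordinate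

open UltraSeminorm
open scoped Polynomial

/-- Composition with an affine coordinate is invertible. -/
theorem Polynomial.comp_affine_inverse {R : Type*} [CommRing R] (α : Rˣ) (β : R) :
    ((C ((α⁻¹ : Rˣ) : R) * (X - C β)).comp (C (α : R) * X + C β) = X) ∧
      (C (α : R) * X + C β).comp (C ((α⁻¹ : Rˣ) : R) * (X - C β)) = X := by
  constructor
  · simp only [mul_comp, C_comp, sub_comp, X_comp, add_sub_cancel_right]
    rw [← mul_assoc, ← C_mul, Units.inv_mul, C_1, one_mul]
  · simp only [mul_comp, C_comp, add_comp, X_comp]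
    rw [← mul_assoc, ← C_mul, Units.mul_inv, C_1, one_mul, sub_add_cancel]

variable {k ℓ A : Type*} [NontriviallyNormedField k] [IsUltrametricDist k]
  [NormedField ℓ] [IsUltrametricDist ℓ] [NormedAlgebra k ℓ] [NormedCommRing A] [NormedAlgebra k A]
  {p n : ℕ} {ϖ : ℓ} {r : ℝ} {hr : 0 < r}

theorem GradedTrivialization.incl_aeval (θ : GradedTrivialization k ℓ A r hr) (a : GrRed A)
    (f : (GrResidue k)[X]) : θ.incl (Polynomial.aeval a f) =
      (f.map (algebraMap (GrResidue k) (GrResidue ℓ))).comp (θ.incl a) := by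
  induction f using Polynomial.induction_on' with
  | add f g hf hg => rw [map_add, map_add θ.incl, hf, hg, Polynomial.map_add, Polynomial.add_comp]
  | monomial n c =>
    rw [Polynomial.aeval_monomial, Polynomial.map_monomial, Polynomial.monomial_comp,
      map_mul θ.incl, map_pow, θ.incl_algebraMap]

/-- The graded reduction of `A` is a polynomial ring over the graded reduction of `k` as soon as it
contains an affine coordinate. -/
theorem aeval_bijective_of_affine_coordinate (hw : IsTotallyWildlyRamified k ℓ p n)
    (hϖ : IsUniformizer ϖ) (θ : GradedTrivialization k ℓ A r hr) {a : GrRed A}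
    {α : (GrResidue ℓ)ˣ} {β : GrResidue ℓ}
    (ha : θ.incl a = Polynomial.C (α : GrResidue ℓ) * Polynomial.X + Polynomial.C β) :
    Function.Bijective (Polynomial.aeval a : (GrResidue k)[X] →ₐ[GrResidue k] GrRed A) := by
  obtain ⟨h1, h2⟩ := Polynomial.comp_affine_inverse α β
  constructor
  · rw [injective_iff_map_eq_zero]
    intro f hf
    have h3 := θ.incl_aeval a f
    rw [hf, map_zero θ.incl, ha] at h3
    -- Undoing the coordinate change over $\widetilde\ell$ recovers $f$ from its value at $a$.
    have h4 := congrArg (Polynomial.comp · (Polynomial.C ((α⁻¹ : (GrResidue ℓ)ˣ) : GrResidue ℓ) *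
      (Polynomial.X - Polynomial.C β))) h3
    simp only [Polynomial.zero_comp, Polynomial.comp_assoc, h2, Polynomial.comp_X] at h4
    exact (Polynomial.map_eq_zero_iff grResidue_algebraMap_injective).1 h4.symm
  · intro y
    have hb := formDerivation_constantsBasis hw hϖ θ
    -- Splitting the coefficients of $F$ along the powers of $t$ puts the coordinates of $F(a)$ into
    -- $\widetilde k[a]$.
    have key : ∀ F : (GrResidue ℓ)[X], ∃ f : ℕ → (GrResidue k)[X], F.comp (θ.incl a) =
        ∑ i ∈ Finset.range (p ^ n - 1 + 1), θ.incl (Polynomial.aeval a (f i)) *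
          Polynomial.C (tUnit hϖ : GrResidue ℓ) ^ i := by
      intro F
      induction F using Polynomial.induction_on' with
      | add F G hF hG =>
        obtain ⟨f, hf⟩ := hF
        obtain ⟨g, hg⟩ := hG
        refine ⟨fun i => f i + g i, ?_⟩
        rw [Polynomial.add_comp, hf, hg, ← Finset.sum_add_distrib]
        exact Finset.sum_congr rfl fun i _ => by rw [map_add, map_add θ.incl, add_mul]
      | monomial l c =>
        obtain ⟨d, rfl⟩ := exists_eq_sum_algebraMap_mul_tUnit_pow (k := k) hϖ hw c
        refine ⟨fun i => Polynomial.monomial l (d i), ?_⟩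
        rw [Polynomial.monomial_comp, map_sum, Finset.sum_mul]
        refine Finset.sum_congr rfl fun i _ => ?_
        rw [Polynomial.aeval_monomial, map_mul θ.incl, map_pow, θ.incl_algebraMap, map_mul, map_pow]
        ring
    obtain ⟨f, hf⟩ := key ((θ.incl y).comp (Polynomial.C ((α⁻¹ : (GrResidue ℓ)ˣ) : GrResidue ℓ) *
      (Polynomial.X - Polynomial.C β)))
    rw [Polynomial.comp_assoc, ha, h1, Polynomial.comp_X] at hf
    -- An element $y\in\widetilde A$ has coordinates $(y,0,\dots,0)$; by uniqueness $y$ is the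
    -- zeroth coordinate found in $\widetilde k[a]$.
    have h3 := hb.sum_injective (a := fun i => if i = 0 then y else 0)
      (b := fun i => Polynomial.aeval a (f i)) ?_ (Nat.zero_le _)
    · exact ⟨f 0, by simpa using h3.symm⟩
    · rw [← hf, Finset.sum_eq_single 0]
      · rw [if_pos rfl, pow_zero, mul_one]
      · intro i _ hi
        rw [if_neg hi, map_zero, zero_mul]
      · simp

end AffineCoordinate

/-! ### The Gauss norm on a closed disc -/

section DiscNorm

open Filter Topology

variable {K : Type*} [NormedField K] [IsUltrametricDist K] {r : ℝ}

theorem discAlgebra_tendsto (f : discAlgebra K r) :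
    Tendsto (fun i => ‖PowerSeries.coeff i f.1‖ * r ^ i) atTop (𝓝 0) :=
  (PowerSeries.isRestricted_iff' r f.1).1 f.2

theorem discAlgebra_hasGaussNorm (f : discAlgebra K r) :
    PowerSeries.HasGaussNorm (fun a : K => ‖a‖) r f.1 :=
  (discAlgebra_tendsto f).bddAbove_range

/-- The Gauss norm on the algebra of the closed disc of radius `r`. -/
noncomputable def discNorm (f : discAlgebra K r) : ℝ :=
  PowerSeries.gaussNorm (fun a : K => ‖a‖) r f.1

theorem coeff_le_discNorm (f : discAlgebra K r) (i : ℕ) :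
    ‖PowerSeries.coeff i f.1‖ * r ^ i ≤ discNorm f :=
  PowerSeries.le_gaussNorm _ r f.1 (discAlgebra_hasGaussNorm f) i

theorem discNorm_le {f : discAlgebra K r} {C : ℝ}
    (h : ∀ i, ‖PowerSeries.coeff i f.1‖ * r ^ i ≤ C) : discNorm f ≤ C := by
  rw [discNorm, PowerSeries.gaussNorm_eq]
  exact ciSup_le h

theorem discNorm_nonneg (f : discAlgebra K r) : 0 ≤ discNorm f :=
  PowerSeries.gaussNorm_nonneg _ r f.1 fun _ => norm_nonneg _

theorem discNorm_zero : discNorm (0 : discAlgebra K r) = 0 :=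
  PowerSeries.gaussNorm_zero _ r norm_zero

theorem discNorm_neg (f : discAlgebra K r) : discNorm (-f) = discNorm f := by
  rw [discNorm, discNorm, PowerSeries.gaussNorm_eq, PowerSeries.gaussNorm_eq]
  refine iSup_congr fun i => ?_
  change ‖PowerSeries.coeff i (-f.1)‖ * _ = _
  rw [map_neg, norm_neg]

theorem discNorm_one : discNorm (1 : discAlgebra K r) = 1 := by
  refine le_antisymm (discNorm_le fun i => ?_) ?_
  · change ‖PowerSeries.coeff i (1 : PowerSeries K)‖ * _ ≤ _
    rw [PowerSeries.coeff_one]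
    split_ifs with h
    · simp [h]
    · simp
  · have := coeff_le_discNorm (1 : discAlgebra K r) 0
    change ‖PowerSeries.coeff 0 (1 : PowerSeries K)‖ * _ ≤ _ at this
    simpa using this

theorem discNorm_add_le_max (hr : 0 < r) (f g : discAlgebra K r) :
    discNorm (f + g) ≤ max (discNorm f) (discNorm g) :=
  PowerSeries.gaussNorm_add_le_max _ r f.1 g.1 hr.le (fun _ => norm_nonneg _)
    (fun x y => IsUltrametricDist.norm_add_le_max x y) (discAlgebra_hasGaussNorm f)
    (discAlgebra_hasGaussNorm g)

theorem eq_zero_of_discNorm_eq_zero (hr : 0 < r) {f : discAlgebra K r} (h : discNorm f = 0) :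
    f = 0 :=
  Subtype.ext <| (PowerSeries.gaussNorm_eq_zero_iff _ r f.1 norm_zero (fun _ => norm_nonneg _)
    (fun _ => norm_eq_zero.1) hr (discAlgebra_hasGaussNorm f)).1 h

/-- The Gauss norm is attained, for the first time at a certain index. -/
theorem exists_coeff_eq_discNorm (hr : 0 < r) {f : discAlgebra K r} (hf : f ≠ 0) :
    ∃ i, ‖PowerSeries.coeff i f.1‖ * r ^ i = discNorm f ∧
      ∀ j < i, ‖PowerSeries.coeff j f.1‖ * r ^ j < discNorm f := by
  classical
  have hpos : 0 < discNorm f := (discNorm_nonneg f).lt_of_ne' fun h =>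
    hf (eq_zero_of_discNorm_eq_zero hr h)
  have hex : ∃ i, ‖PowerSeries.coeff i f.1‖ * r ^ i = discNorm f := by
    -- If the supremum were not attained, the finitely many early terms would be bounded by some $M$
    -- below it and the tail by half of it.
    by_contra! hne
    obtain ⟨N, hN⟩ := eventually_atTop.1
      ((discAlgebra_tendsto f).eventually (gt_mem_nhds (half_pos hpos)))
    obtain ⟨M, hM, hMN⟩ : ∃ M < discNorm f, ∀ i < N, ‖PowerSeries.coeff i f.1‖ * r ^ i ≤ M := by
      clear hN
      induction N with
      | zero => exact ⟨discNorm f / 2, half_lt_self hpos, fun i hi => absurd hi (Nat.not_lt_zero i)⟩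
      | succ N ih =>
        obtain ⟨M, hM, h⟩ := ih
        refine ⟨max M (‖PowerSeries.coeff N f.1‖ * r ^ N),
          max_lt hM ((coeff_le_discNorm f N).lt_of_ne (hne N)), fun i hi => ?_⟩
        rcases Nat.lt_succ_iff_lt_or_eq.1 hi with h1 | rfl
        · exact (h i h1).trans (le_max_left _ _)
        · exact le_max_right _ _
    have : discNorm f ≤ max M (discNorm f / 2) := discNorm_le fun i => by
      rcases lt_or_ge i N with h | h
      · exact (hMN i h).trans (le_max_left _ _)
      · exact (hN i h).le.trans (le_max_right _ _)
    exact absurd this (not_le.2 (max_lt hM (half_lt_self hpos)))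
  refine ⟨Nat.find hex, Nat.find_spec hex, fun j hj => ?_⟩
  exact (coeff_le_discNorm f j).lt_of_ne (Nat.find_min hex hj)

/-- Gauss's lemma: if $i$ and $j$ are the first indices where the two norms are attained, the term
$f_ig_j$ strictly dominates the coefficient of index $i+j$ in the product. -/
theorem discNorm_mul (hr : 0 < r) (f g : discAlgebra K r) :
    discNorm (f * g) = discNorm f * discNorm g := by
  rcases eq_or_ne f 0 with rfl | hf
  · rw [zero_mul, discNorm_zero, zero_mul]
  rcases eq_or_ne g 0 with rfl | hg
  · rw [mul_zero, discNorm_zero, mul_zero]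
  have hna : ∀ x y : K, ‖x + y‖ ≤ max ‖x‖ ‖y‖ := IsUltrametricDist.norm_add_le_max
  refine le_antisymm ?_ ?_
  · exact MvPowerSeries.gaussNorm_mul_le (fun a : K => ‖a‖) (fun _ => r) f.1 g.1 (fun _ => hr.le)
      (fun _ => norm_nonneg _) (fun a b => (norm_mul a b).le) hna norm_zero
      (discAlgebra_hasGaussNorm f).hasMvGaussNorm (discAlgebra_hasGaussNorm g).hasMvGaussNorm
  · obtain ⟨i, hi, hi'⟩ := exists_coeff_eq_discNorm hr hf
    obtain ⟨j, hj, hj'⟩ := exists_coeff_eq_discNorm hr hg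
    have hfg : ‖PowerSeries.coeff (i + j) (f.1 * g.1)‖ =
        ‖PowerSeries.coeff i f.1‖ * ‖PowerSeries.coeff j g.1‖ := by
      have hmem : (i, j) ∈ Finset.HasAntidiagonal.antidiagonal (i + j) := Finset.HasAntidiagonal.mem_antidiagonal.2 rfl
      have hpos : 0 < discNorm f * discNorm g := mul_pos
        ((discNorm_nonneg f).lt_of_ne' fun h => hf (eq_zero_of_discNorm_eq_zero hr h))
        ((discNorm_nonneg g).lt_of_ne' fun h => hg (eq_zero_of_discNorm_eq_zero hr h))
      have hpos' : 0 < ‖PowerSeries.coeff i f.1 * PowerSeries.coeff j g.1‖ := by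
        rw [← hi, ← hj] at hpos
        rw [norm_mul]
        by_contra! h0
        have : ‖PowerSeries.coeff i f.1‖ * r ^ i * (‖PowerSeries.coeff j g.1‖ * r ^ j) =
          ‖PowerSeries.coeff i f.1‖ * ‖PowerSeries.coeff j g.1‖ * (r ^ i * r ^ j) := by ring
        rw [this] at hpos
        exact absurd hpos (not_lt.2 (mul_nonpos_of_nonpos_of_nonneg h0 (by positivity)))
      -- Any other pair has its first index below $i$ or its second below $j$, where minimality
      -- makes the inequality strict.
      have hlt : ‖∑ x ∈ (Finset.HasAntidiagonal.antidiagonal (i + j)).erase (i, j),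
          PowerSeries.coeff x.1 f.1 * PowerSeries.coeff x.2 g.1‖ <
          ‖PowerSeries.coeff i f.1 * PowerSeries.coeff j g.1‖ := by
        rcases ((Finset.HasAntidiagonal.antidiagonal (i + j)).erase (i, j)).eq_empty_or_nonempty
          with he | he
        · rwa [he, Finset.sum_empty, norm_zero]
        obtain ⟨⟨a, b⟩, hab, hle⟩ := IsUltrametricDist.exists_norm_finsetSum_le_of_nonempty he
          fun x : ℕ × ℕ => PowerSeries.coeff x.1 f.1 * PowerSeries.coeff x.2 g.1
        refine hle.trans_lt ?_
        obtain ⟨hne, hab⟩ := Finset.mem_erase.1 hab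
        have hab := Finset.HasAntidiagonal.mem_antidiagonal.1 hab
        change a + b = i + j at hab
        change ‖PowerSeries.coeff a f.1 * PowerSeries.coeff b g.1‖ < _
        have hr' : 0 < r ^ (i + j) := pow_pos hr _
        refine lt_of_mul_lt_mul_right ?_ hr'.le
        have e1 : ‖PowerSeries.coeff a f.1 * PowerSeries.coeff b g.1‖ * r ^ (i + j) =
            (‖PowerSeries.coeff a f.1‖ * r ^ a) * (‖PowerSeries.coeff b g.1‖ * r ^ b) := by
          rw [← hab, norm_mul, pow_add]
          ring
        have e2 : ‖PowerSeries.coeff i f.1 * PowerSeries.coeff j g.1‖ * r ^ (i + j) =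
            discNorm f * discNorm g := by
          rw [norm_mul, pow_add, ← hi, ← hj]
          ring
        rw [e1, e2]
        have hfp := pos_of_mul_pos_left hpos (discNorm_nonneg g)
        have hgp := pos_of_mul_pos_right hpos (discNorm_nonneg f)
        rcases lt_trichotomy a i with h | h | h
        · exact (mul_le_mul_of_nonneg_left (coeff_le_discNorm g b) (by positivity)).trans_lt
            (mul_lt_mul_of_pos_right (hi' a h) hgp)
        · exact absurd (Prod.ext h (by simp only; omega)) hne
        · exact mul_lt_mul' (coeff_le_discNorm f a) (hj' b (by omega)) (by positivity) hfp
      rw [PowerSeries.coeff_mul, ← Finset.add_sum_erase _ _ hmem, ← norm_mul]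
      rw [IsUltrametricDist.norm_add_eq_max_of_norm_ne_norm hlt.ne']
      exact max_eq_left hlt.le
    have := coeff_le_discNorm (f * g) (i + j)
    change ‖PowerSeries.coeff (i + j) (f.1 * g.1)‖ * _ ≤ _ at this
    rw [hfg, pow_add] at this
    rw [← hi, ← hj]
    refine le_trans (le_of_eq ?_) this
    ring

/-- The algebra of a disc, normed by the Gauss norm. -/
noncomputable abbrev discNormedAddCommGroup (hr : 0 < r) : NormedAddCommGroup (discAlgebra K r) :=
  AddGroupNorm.toNormedAddCommGroup
    { toFun := discNorm
      map_zero' := discNorm_zero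
      add_le' := fun f g => (discNorm_add_le_max hr f g).trans
        (max_le_add_of_nonneg (discNorm_nonneg f) (discNorm_nonneg g))
      neg' := discNorm_neg
      eq_zero_of_map_eq_zero' := fun _ h => eq_zero_of_discNorm_eq_zero hr h }

/-- Take coefficientwise limits. The Cauchy estimates are uniform in the index, so they pass to the
limit and show both that the limit series is restricted and that the convergence is in norm. -/
theorem disc_completeSpace [CompleteSpace K] (hr : 0 < r) :
    letI := discNormedAddCommGroup (K := K) hr
    CompleteSpace (discAlgebra K r) := by
  let _ := discNormedAddCommGroup (K := K) hr
  refine Metric.complete_of_cauchySeq_tendsto fun u hu => ?_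
  have hsub : ∀ f g : discAlgebra K r, dist f g = discNorm (f - g) := fun f g => dist_eq_norm f g
  have hco : ∀ (f g : discAlgebra K r) i,
      ‖PowerSeries.coeff i f.1 - PowerSeries.coeff i g.1‖ * r ^ i ≤ dist f g := fun f g i => by
    rw [hsub, ← map_sub]
    exact coeff_le_discNorm (f - g) i
  have hcauchy : ∀ i, CauchySeq fun n => PowerSeries.coeff i (u n).1 := fun i => by
    rw [Metric.cauchySeq_iff'] at hu ⊢
    intro ε hε
    obtain ⟨N, hN⟩ := hu (ε * r ^ i) (by positivity)
    refine ⟨N, fun n hn => ?_⟩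
    rw [dist_eq_norm]
    exact lt_of_mul_lt_mul_right ((hco (u n) (u N) i).trans_lt (hN n hn)) (by positivity)
  choose b hb using fun i => cauchySeq_tendsto_of_complete (hcauchy i)
  have hlim : ∀ ε > 0, ∃ N, ∀ n ≥ N, ∀ i,
      ‖PowerSeries.coeff i (u n).1 - b i‖ * r ^ i ≤ ε := by
    intro ε hε
    obtain ⟨N, hN⟩ := Metric.cauchySeq_iff.1 hu ε hε
    refine ⟨N, fun n hn i => ?_⟩
    refine le_of_tendsto ((((tendsto_const_nhds).sub (hb i)).norm).mul_const (r ^ i))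
      (eventually_atTop.2 ⟨N, fun m hm => ?_⟩)
    exact (hco (u n) (u m) i).trans (hN n hn m hm).le
  have hres : PowerSeries.IsRestricted r (PowerSeries.mk b) := by
    rw [PowerSeries.isRestricted_iff', Metric.tendsto_atTop]
    intro ε hε
    obtain ⟨N, hN⟩ := hlim (ε / 3) (by positivity)
    obtain ⟨M, hM⟩ := Metric.tendsto_atTop.1 (discAlgebra_tendsto (u N)) (ε / 3) (by positivity)
    refine ⟨M, fun i hi => ?_⟩
    have h1 := hN N le_rfl i
    have h2 := hM i hi
    rw [Real.dist_eq, sub_zero, abs_of_nonneg (by positivity)] at h2 ⊢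
    rw [PowerSeries.coeff_mk]
    have h3 : ‖b i‖ ≤ ‖PowerSeries.coeff i (u N).1 - b i‖ + ‖PowerSeries.coeff i (u N).1‖ := by
      rw [norm_sub_rev]
      exact norm_le_norm_sub_add _ _
    have h4 := mul_le_mul_of_nonneg_right h3 (pow_nonneg hr.le i)
    rw [add_mul] at h4
    linarith
  refine ⟨⟨_, hres⟩, Metric.tendsto_atTop.2 fun ε hε => ?_⟩
  obtain ⟨N, hN⟩ := hlim (ε / 2) (by positivity)
  refine ⟨N, fun n hn => ?_⟩
  rw [hsub]
  refine (discNorm_le fun i => ?_).trans_lt (half_lt_self hε)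
  change ‖PowerSeries.coeff i ((u n).1 - PowerSeries.mk b)‖ * _ ≤ _
  rw [map_sub, PowerSeries.coeff_mk]
  exact hN n hn i

end DiscNorm

/-! ### Evaluation at interior points of a disc -/

section DiscEvaluation

open Filter Topology

variable {K : Type*} [NormedField K] [IsUltrametricDist K] {r : ℝ}

theorem norm_coeff_mul_pow_le (f : discAlgebra K r) {α : K} (hα : ‖α‖ < r) (i : ℕ) :
    ‖PowerSeries.coeff i f.1 * α ^ i‖ ≤ discNorm f * (‖α‖ / r) ^ i := by
  have hr : 0 < r := (norm_nonneg α).trans_lt hα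
  rw [norm_mul, norm_pow, div_pow, mul_div_assoc', le_div_iff₀ (pow_pos hr i)]
  have := mul_le_mul_of_nonneg_right (coeff_le_discNorm f i) (pow_nonneg (norm_nonneg α) i)
  refine le_trans (le_of_eq ?_) this
  ring

theorem summable_geometric_disc {K : Type*} [NormedField K] {r : ℝ} {α : K} (hα : ‖α‖ < r) : Summable fun i : ℕ => (‖α‖ / r) ^ i := by
  have hr : 0 < r := (norm_nonneg α).trans_lt hα
  exact summable_geometric_of_lt_one (by positivity) ((div_lt_one hr).2 hα)

theorem summable_norm_coeff_mul_pow (f : discAlgebra K r) {α : K} (hα : ‖α‖ < r) :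
    Summable fun i => ‖PowerSeries.coeff i f.1 * α ^ i‖ :=
  Summable.of_nonneg_of_le (fun _ => norm_nonneg _) (norm_coeff_mul_pow_le f hα)
    ((summable_geometric_disc hα).mul_left _)

variable [CompleteSpace K]

/-- Evaluation of the functions on a disc at an interior point. -/
noncomputable def discEval (α : K) (hα : ‖α‖ < r) : discAlgebra K r →ₐ[K] K where
  toFun f := ∑' i, PowerSeries.coeff i f.1 * α ^ i
  map_one' := by
    rw [tsum_eq_single 0]
    · change PowerSeries.coeff 0 (1 : PowerSeries K) * _ = 1
      simp
    · intro i hi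
      change PowerSeries.coeff i (1 : PowerSeries K) * _ = 0
      simp [PowerSeries.coeff_one, hi]
  map_zero' := by
    change ∑' i, PowerSeries.coeff i (0 : PowerSeries K) * α ^ i = 0
    simp
  map_add' f g := by
    rw [← (summable_norm_coeff_mul_pow f hα).of_norm.tsum_add
      (summable_norm_coeff_mul_pow g hα).of_norm]
    refine tsum_congr fun i => ?_
    change PowerSeries.coeff i (f.1 + g.1) * _ = _
    rw [map_add, add_mul]
  map_mul' f g := by
    rw [tsum_mul_tsum_eq_tsum_sum_antidiagonal_of_summable_norm
      (summable_norm_coeff_mul_pow f hα) (summable_norm_coeff_mul_pow g hα)]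
    refine tsum_congr fun i => ?_
    change PowerSeries.coeff i (f.1 * g.1) * _ = _
    rw [PowerSeries.coeff_mul, Finset.sum_mul]
    refine Finset.sum_congr rfl fun x hx => ?_
    rw [← Finset.HasAntidiagonal.mem_antidiagonal.1 hx, pow_add]
    ring
  commutes' a := by
    rw [tsum_eq_single 0]
    · change PowerSeries.coeff 0 (PowerSeries.C a) * _ = a
      simp
    · intro i hi
      change PowerSeries.coeff i (PowerSeries.C a) * _ = 0
      simp [PowerSeries.coeff_C, hi]

/-- The geometric constant is not sharp, but only continuity of evaluation is needed. -/
theorem norm_discEval_le {α : K} (hα : ‖α‖ < r) (f : discAlgebra K r) :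
    ‖discEval α hα f‖ ≤ discNorm f * ∑' i : ℕ, (‖α‖ / r) ^ i := by
  rw [← tsum_mul_left]
  exact tsum_of_norm_bounded ((summable_geometric_disc hα).mul_left _).hasSum
    (norm_coeff_mul_pow_le f hα)

/-- Functions on a disc are determined by their values at interior points. -/
theorem eq_zero_of_discEval_eq_zero (hr : 0 < r) {ϖ : K} (hϖ : IsUniformizer ϖ)
    {f : discAlgebra K r} (h : ∀ α (hα : ‖α‖ < r), discEval α hα f = 0) : f = 0 := by
  refine Subtype.ext (PowerSeries.ext fun i => ?_)
  refine Eq.trans ?_ (map_zero (PowerSeries.coeff i)).symm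
  induction i using Nat.strong_induction_on with
  | _ i ih =>
    set c := ‖PowerSeries.coeff i f.1‖ * r ^ i with hc
    have hlim : Tendsto (fun N : ℕ => ‖ϖ‖ ^ N / r) atTop (𝓝 0) := by
      rw [← zero_div r]
      exact (tendsto_pow_atTop_nhds_zero_of_lt_one hϖ.pos.le hϖ.lt_one).div_const r
    -- Evaluate at $\varpi^N$, close to the centre. The lower coefficients already vanish, so the
    -- $i$-th term is minus the tail, which is smaller by a factor of order $|\varpi|^N/r$.
    have hbound : ∀ᶠ N : ℕ in atTop,
        c ≤ discNorm f * ((‖ϖ‖ ^ N / r) * (1 - ‖ϖ‖ ^ N / r)⁻¹) := by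
      filter_upwards [hlim.eventually (gt_mem_nhds one_pos)] with N hN
      have hα : ‖ϖ ^ N‖ < r := by
        rw [norm_pow]
        exact (div_lt_one hr).1 hN
      have h1 := h _ hα
      change ∑' i, PowerSeries.coeff i f.1 * (ϖ ^ N) ^ i = 0 at h1
      set α := ϖ ^ N with hαdef
      have hsum := (summable_norm_coeff_mul_pow f hα).of_norm
      rw [← hsum.sum_add_tsum_nat_add (i + 1), Finset.sum_range_succ,
        Finset.sum_eq_zero fun j hj => by rw [ih j (Finset.mem_range.1 hj), zero_mul],
        zero_add] at h1
      have h2 : ‖∑' j, PowerSeries.coeff (j + (i + 1)) f.1 * α ^ (j + (i + 1))‖ ≤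
          discNorm f * (‖α‖ / r) ^ (i + 1) * (1 - ‖α‖ / r)⁻¹ := by
        rw [← tsum_geometric_of_lt_one (by positivity) ((div_lt_one hr).2 hα), ← tsum_mul_left]
        refine tsum_of_norm_bounded ((summable_geometric_disc hα).mul_left _).hasSum fun j => ?_
        refine (norm_coeff_mul_pow_le f hα _).trans (le_of_eq ?_)
        rw [pow_add]
        ring
      rw [← norm_neg, ← eq_neg_of_add_eq_zero_left h1, norm_mul, norm_pow] at h2
      have hα0 : 0 < ‖α‖ := by
        rw [hαdef, norm_pow]
        exact pow_pos hϖ.pos N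
      have hαi : 0 < ‖α‖ ^ i := pow_pos hα0 i
      refine le_of_mul_le_mul_right ?_ (div_pos hαi (pow_pos hr i))
      have e1 : c * (‖α‖ ^ i / r ^ i) = ‖PowerSeries.coeff i f.1‖ * ‖α‖ ^ i := by
        rw [hc]
        field_simp
      rw [e1]
      refine h2.trans (le_of_eq ?_)
      rw [← norm_pow, ← hαdef, pow_succ, div_pow]
      ring
    have hlim2 : Tendsto (fun N : ℕ => discNorm f * ((‖ϖ‖ ^ N / r) * (1 - ‖ϖ‖ ^ N / r)⁻¹)) atTop
        (𝓝 0) := by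
      have := ((hlim.mul ((tendsto_const_nhds (x := (1 : ℝ))).sub hlim |>.inv₀ (by simp)))).const_mul
        (discNorm f)
      simpa using this
    have hc0 : c ≤ 0 := ge_of_tendsto hlim2 hbound
    by_contra hne
    exact absurd hc0 (not_le.2 (mul_pos (norm_pos_iff.2 hne) (pow_pos hr i)))

end DiscEvaluation

/-! ### Automatic continuity of characters -/

/-- A homomorphism from a Banach algebra to a finite field extension is continuous. -/
theorem AlgHom.continuous_of_finite_field {k A F : Type*} [NontriviallyNormedField k]
    [CompleteSpace k] [NormedCommRing A] [NormedAlgebra k A] [CompleteSpace A]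
    [NormedField F] [NormedAlgebra k F] [FiniteDimensional k F] (χ : A →ₐ[k] F) :
    Continuous χ := by
  -- The image is a subalgebra of an algebraic extension, hence a field.
  have hmax : (RingHom.ker χ).IsMaximal := by
    have hf : IsField χ.range := by
      have : Algebra.IsAlgebraic k F := Algebra.IsAlgebraic.of_finite k F
      exact Subalgebra.isField_of_algebraic χ.range
    let _ := hf.toField
    have h := RingHom.ker_isMaximal_of_surjective (χ.rangeRestrict : A →+* χ.range)
      χ.rangeRestrict_surjective
    have e : RingHom.ker χ = RingHom.ker (χ.rangeRestrict : A →+* χ.range) := by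
      ext a
      rw [RingHom.mem_ker, RingHom.mem_ker]
      exact (Subtype.ext_iff (a1 := χ.rangeRestrict a) (a2 := 0)).symm
    rw [e]
    exact h
  -- Maximal ideals of a complete normed ring are closed, so $\chi$ factors through a
  -- finite-dimensional normed quotient.
  have hclosed : IsClosed ((LinearMap.ker χ.toLinearMap : Submodule k A) : Set A) :=
    Ideal.IsMaximal.isClosed (I := RingHom.ker χ)
  let N := LinearMap.ker χ.toLinearMap
  have : IsClosed (N : Set A) := hclosed
  have : FiniteDimensional k (A ⧸ N) :=
    Module.Finite.equiv χ.toLinearMap.quotKerEquivRange.symm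
  have h1 : Continuous (N.liftQ χ.toLinearMap le_rfl) := LinearMap.continuous_of_finiteDimensional _
  exact h1.comp (Submodule.mkQL N).continuous

/-! ### Base change of discs and of their forms -/

section BaseChange

open Filter Topology

variable {k ℓ A : Type*} [NontriviallyNormedField k] [IsUltrametricDist k]
  [NormedField ℓ] [IsUltrametricDist ℓ] [NormedAlgebra k ℓ] {r : ℝ}

variable (k ℓ r) in
/-- The inclusion of the algebra of the disc over `k` into that of the disc over `ℓ`. -/
noncomputable def discBaseChange : discAlgebra k r →ₐ[k] discAlgebra ℓ r where
  toFun f := ⟨PowerSeries.map (algebraMap k ℓ) f.1, by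
    refine (PowerSeries.isRestricted_iff' r _).2 ((discAlgebra_tendsto f).congr fun i => ?_)
    rw [PowerSeries.coeff_map, norm_algebraMap']⟩
  map_one' := Subtype.ext (map_one _)
  map_zero' := Subtype.ext (map_zero _)
  map_add' f g := Subtype.ext (map_add _ _ _)
  map_mul' f g := Subtype.ext (map_mul _ _ _)
  commutes' a := Subtype.ext ((PowerSeries.map_C (algebraMap k ℓ) a).trans
    (PowerSeries.algebraMap_apply (A := ℓ)).symm)

theorem coeff_sum_smul_discBaseChange {ι : Type*} [Fintype ι] (b : ι → ℓ) (f : ι → discAlgebra k r)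
    (n : ℕ) : PowerSeries.coeff n (∑ i, b i • discBaseChange k ℓ r (f i)).1 =
      ∑ i, PowerSeries.coeff n (f i).1 • b i := by
  have h1 : (∑ i, b i • discBaseChange k ℓ r (f i)).1 =
      ∑ i, b i • (discBaseChange k ℓ r (f i)).1 := by
    rw [AddSubmonoidClass.coe_finsetSum]
    rfl
  rw [h1, map_sum]
  refine Finset.sum_congr rfl fun i _ => ?_
  change PowerSeries.coeff n (b i • PowerSeries.map (algebraMap k ℓ) (f i).1) = _
  rw [map_smul, PowerSeries.coeff_map, smul_eq_mul, Algebra.smul_def, mul_comm]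

variable [CompleteSpace k]

/-- Coordinates are taken coefficient by coefficient. They again form restricted series because
coordinate functionals on a finite-dimensional space over a complete field are bounded. -/
theorem bijective_sum_smul_discBaseChange {ι : Type*} [Fintype ι] (b : Module.Basis ι k ℓ) :
    Function.Bijective fun f : ι → discAlgebra k r => ∑ i, b i • discBaseChange k ℓ r (f i) := by
  constructor
  · intro f g hfg
    funext i
    refine Subtype.ext (PowerSeries.ext fun n => ?_)
    have h1 := congrArg (fun w : discAlgebra ℓ r => b.repr (PowerSeries.coeff n w.1) i) hfg
    simpa only [coeff_sum_smul_discBaseChange, b.repr_sum_self] using h1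
  · intro w
    obtain ⟨C, hC⟩ : ∃ C : ℝ, ∀ i x, ‖b.repr x i‖ ≤ C * ‖x‖ := by
      refine ⟨‖(b.equivFunL : ℓ →L[k] (ι → k))‖, fun i x => ?_⟩
      exact (norm_le_pi_norm (b.equivFunL x) i).trans
        ((b.equivFunL : ℓ →L[k] (ι → k)).le_opNorm x)
    have hres : ∀ i, PowerSeries.IsRestricted r
        (PowerSeries.mk fun n => b.repr (PowerSeries.coeff n w.1) i) := fun i => by
      -- The sign of $r$ is not assumed here, so the estimates are made with $|r|$.
      rw [← PowerSeries.isRestricted_abs_iff, PowerSeries.isRestricted_iff']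
      have h1 := (PowerSeries.isRestricted_iff' |r| w.1).1
        ((PowerSeries.isRestricted_abs_iff r w.1).2 w.2)
      refine squeeze_zero (fun n => by positivity) (fun n => ?_)
        (by simpa only [mul_zero] using h1.const_mul C)
      rw [PowerSeries.coeff_mk, ← mul_assoc]
      exact mul_le_mul_of_nonneg_right (hC i _) (by positivity)
    refine ⟨fun i => ⟨_, hres i⟩, Subtype.ext (PowerSeries.ext fun n => ?_)⟩
    change PowerSeries.coeff n (∑ i, b i • discBaseChange k ℓ r _).1 = _
    rw [coeff_sum_smul_discBaseChange]
    simp only [PowerSeries.coeff_mk]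
    exact b.sum_repr _

variable [FiniteDimensional k ℓ]

variable (k ℓ r) in
/-- The comparison of `ℓ ⊗ k{r⁻¹T}` with `ℓ{r⁻¹T}`. -/
noncomputable def tensorDiscHom : ℓ ⊗[k] discAlgebra k r →ₐ[ℓ] discAlgebra ℓ r :=
  Algebra.TensorProduct.lift (Algebra.ofId ℓ (discAlgebra ℓ r)) (discBaseChange k ℓ r)
    (fun _ _ => Commute.all _ _)

theorem tensorDiscHom_bijective : Function.Bijective (tensorDiscHom k ℓ r) := by
  let b := Module.finBasis k ℓ
  let e := TensorProduct.equivFinsuppOfBasisLeft (N := discAlgebra k r) b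
  let e' := e.toEquiv.trans Finsupp.equivFunOnFinite
  have h : ∀ f, tensorDiscHom k ℓ r (e'.symm f) = ∑ i, b i • discBaseChange k ℓ r (f i) := by
    intro f
    change tensorDiscHom k ℓ r (e.symm (Finsupp.equivFunOnFinite.symm f)) = _
    rw [TensorProduct.equivFinsuppOfBasisLeft_symm_apply, Finsupp.sum_fintype _ _ (by simp), map_sum]
    refine Finset.sum_congr rfl fun i _ => ?_
    rw [Algebra.smul_def]
    exact Algebra.TensorProduct.lift_tmul _ _ (fun _ _ => Commute.all _ _) _ _
  have := bijective_sum_smul_discBaseChange (r := r) b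
  rw [← funext h] at this
  exact (Function.Bijective.of_comp_iff _ e'.symm.bijective).1 this

variable [NormedCommRing A] [NormedAlgebra k A]

/-- A form of a disc embeds into the disc over `ℓ`, which is free over it. -/
theorem IsFormOfDisc.exists_embedding (hA : IsFormOfDisc k ℓ A r) {ι : Type*} [Fintype ι]
    (b : Module.Basis ι k ℓ) : ∃ φ : A →ₐ[k] discAlgebra ℓ r,
      Function.Bijective fun a : ι → A => ∑ i, b i • φ (a i) := by
  classical
  obtain ⟨F⟩ := hA.form
  let G : ℓ ⊗[k] A →ₐ[ℓ] discAlgebra ℓ r := (tensorDiscHom k ℓ r).comp F.toAlgHom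
  have hG : Function.Bijective G := tensorDiscHom_bijective.comp F.bijective
  refine ⟨(G.restrictScalars k).comp Algebra.TensorProduct.includeRight, ?_⟩
  let e := TensorProduct.equivFinsuppOfBasisLeft (N := A) b
  let e' := e.toEquiv.trans Finsupp.equivFunOnFinite
  have h : ∀ a, G (e'.symm a) = ∑ i, b i •
      ((G.restrictScalars k).comp Algebra.TensorProduct.includeRight) (a i) := by
    intro a
    change G (e.symm (Finsupp.equivFunOnFinite.symm a)) = _
    rw [TensorProduct.equivFinsuppOfBasisLeft_symm_apply, Finsupp.sum_fintype _ _ (by simp), map_sum]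
    refine Finset.sum_congr rfl fun i _ => ?_
    change G (b i ⊗ₜ[k] a i) = b i • G ((1 : ℓ) ⊗ₜ[k] a i)
    rw [← map_smul, TensorProduct.smul_tmul', smul_eq_mul, mul_one]
  rw [← funext h]
  exact hG.comp e'.symm.bijective

end BaseChange

/-! ### Comparison of the norm, the Gauss norm and the spectral seminorm -/

section NormComparison

open Filter Topology

variable {k ℓ A : Type*} [NontriviallyNormedField k] [IsUltrametricDist k] [CompleteSpace k]
  [NormedField ℓ] [IsUltrametricDist ℓ] [NormedAlgebra k ℓ] [FiniteDimensional k ℓ]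
  [NormedCommRing A] [CompleteSpace A] [NormedAlgebra k A] {r : ℝ}

theorem discNorm_smul_le {k ℓ : Type*} [NormedField k] [NormedField ℓ] [IsUltrametricDist ℓ]
    [NormedAlgebra k ℓ] {r : ℝ} (c : k) (f : discAlgebra ℓ r) : discNorm (c • f) ≤ ‖c‖ * discNorm f := by
  refine discNorm_le fun i => ?_
  change ‖PowerSeries.coeff i (c • f.1)‖ * _ ≤ _
  have h1 : PowerSeries.coeff i (c • f.1) = algebraMap k ℓ c * PowerSeries.coeff i f.1 := by
    rw [Algebra.smul_def, PowerSeries.algebraMap_apply, PowerSeries.coeff_C_mul]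
  rw [h1, norm_mul, norm_algebraMap', mul_assoc]
  exact mul_le_mul_of_nonneg_left (coeff_le_discNorm f i) (norm_nonneg c)

variable (k) in
/-- The algebra of a disc over `ℓ` as a normed space over `k`. -/
noncomputable abbrev discNormedSpace (hr : 0 < r) :
    @NormedSpace k (discAlgebra ℓ r) _ (discNormedAddCommGroup hr).toSeminormedAddCommGroup :=
  letI := discNormedAddCommGroup (K := ℓ) hr
  { (inferInstance : Module k (discAlgebra ℓ r)) with
    norm_smul_le := discNorm_smul_le }

omit [IsUltrametricDist k] in
/-- The norm of a form of a disc is equivalent to the Gauss norm over `ℓ`. -/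
theorem exists_norm_equivalence (hr : 0 < r) {ϖ : ℓ} (hϖ : IsUniformizer ϖ)
    {ι : Type*} [Fintype ι] (b : Module.Basis ι k ℓ) (φ : A →ₐ[k] discAlgebra ℓ r)
    (hφ : Function.Bijective fun a : ι → A => ∑ i, b i • φ (a i)) :
    ∃ C : ℝ, ∀ a, discNorm (φ a) ≤ C * ‖a‖ ∧ ‖a‖ ≤ C * discNorm (φ a) := by
  let _ := discNormedAddCommGroup (K := ℓ) hr
  let _ := discNormedSpace (ℓ := ℓ) k hr
  have : CompleteSpace ℓ := FiniteDimensional.complete k ℓ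
  have : CompleteSpace (discAlgebra ℓ r) := disc_completeSpace hr
  let Ψ₀ : (ι → A) →ₗ[k] discAlgebra ℓ r :=
    { toFun := fun a => ∑ i, b i • φ (a i)
      map_add' := fun a a' => by
        rw [← Finset.sum_add_distrib]
        exact Finset.sum_congr rfl fun i _ => by rw [Pi.add_apply, map_add, smul_add]
      map_smul' := fun c a => by
        rw [RingHom.id_apply, Finset.smul_sum]
        exact Finset.sum_congr rfl fun i _ => by
          rw [Pi.smul_apply, map_smul φ c (a i)]
          exact smul_comm _ _ _ }
  let Ψ : (ι → A) ≃ₗ[k] discAlgebra ℓ r := LinearEquiv.ofBijective Ψ₀ hφ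
  have heval : ∀ α (hα : ‖α‖ < r), Continuous (discEval (K := ℓ) α hα) := fun α hα =>
    AddMonoidHomClass.continuous_of_bound (discEval (K := ℓ) α hα) (∑' i : ℕ, (‖α‖ / r) ^ i)
      fun f => (norm_discEval_le hα f).trans_eq (mul_comm _ _)
  have hcont : Continuous Ψ₀ := by
    -- Closed graph theorem. Limits are compared at interior points, which separate functions: there
    -- $\varphi$ followed by evaluation is a character of $A$ into $\ell$, continuous without any
    -- prior bound on $\varphi$.
    refine LinearMap.continuous_of_seq_closed_graph (g := Ψ₀) fun u x y hu hy => ?_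
    rw [← sub_eq_zero]
    refine eq_zero_of_discEval_eq_zero hr hϖ fun α hα => ?_
    rw [map_sub, sub_eq_zero]
    let χ : A →ₐ[k] ℓ := ((discEval α hα).restrictScalars k).comp φ
    have hχ : Continuous χ := χ.continuous_of_finite_field
    have h1 : ∀ a, discEval α hα (Ψ₀ a) = ∑ i, b i * χ (a i) := fun a => by
      change discEval α hα (∑ i, b i • φ (a i)) = _
      rw [map_sum]
      exact Finset.sum_congr rfl fun i _ => by rw [map_smul]; rfl
    have h2 : Continuous fun a : ι → A => ∑ i, b i * χ (a i) := by fun_prop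
    have h3 : Tendsto (fun n => discEval α hα (Ψ₀ (u n))) atTop (𝓝 (discEval α hα y)) :=
      ((heval α hα).tendsto y).comp hy
    have h4 : Tendsto (fun n => discEval α hα (Ψ₀ (u n))) atTop (𝓝 (discEval α hα (Ψ₀ x))) := by
      simp only [h1]
      exact (h2.tendsto x).comp hu
    exact tendsto_nhds_unique h3 h4
  -- The open mapping theorem makes the inverse continuous as well.
  let Φ := Ψ.toContinuousLinearEquivOfContinuous hcont
  -- The vector $\kappa(a)$ is $a$ times the coordinates of $1\in\ell$, so it is the preimage of
  -- $\varphi(a)$. This works for a basis not containing $1$.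
  let κ : A →L[k] (ι → A) := ContinuousLinearMap.pi fun i =>
    (b.repr 1 i) • ContinuousLinearMap.id k A
  have hκ : ∀ a, Φ (κ a) = φ a := fun a => by
    change ∑ i, b i • φ (b.repr 1 i • a) = φ a
    have h1 : ∀ i, b i • φ (b.repr 1 i • a) = (b.repr 1 i • b i) • φ a := fun i => by
      rw [map_smul φ, smul_assoc]
      exact smul_comm _ _ _
    rw [Finset.sum_congr rfl fun i _ => h1 i, ← Finset.sum_smul, b.sum_repr, one_smul]
  obtain ⟨i, hi⟩ : ∃ i, b.repr 1 i ≠ 0 := by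
    by_contra! h0
    exact one_ne_zero (b.repr.map_eq_zero_iff.1 (Finsupp.ext h0))
  set C₁ := ‖(Φ : (ι → A) →L[k] discAlgebra ℓ r).comp κ‖
  set C₂ := ‖(Φ.symm : discAlgebra ℓ r →L[k] (ι → A))‖
  refine ⟨max C₁ (‖b.repr 1 i‖⁻¹ * C₂), fun a => ⟨?_, ?_⟩⟩
  · have h1 := ((Φ : (ι → A) →L[k] discAlgebra ℓ r).comp κ).le_opNorm a
    have h2 : ((Φ : (ι → A) →L[k] discAlgebra ℓ r).comp κ) a = φ a := hκ a
    rw [h2] at h1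
    exact h1.trans (mul_le_mul_of_nonneg_right (le_max_left _ _) (norm_nonneg a))
  · have h1 := (Φ.symm : discAlgebra ℓ r →L[k] (ι → A)).le_opNorm (φ a)
    have h2 : (Φ.symm : discAlgebra ℓ r →L[k] (ι → A)) (φ a) = κ a := by
      rw [← hκ]
      exact Φ.symm_apply_apply (κ a)
    rw [h2] at h1
    have h3 : ‖b.repr 1 i‖ * ‖a‖ ≤ C₂ * discNorm (φ a) := by
      rw [← norm_smul]
      exact (norm_le_pi_norm (κ a) i).trans h1
    refine le_trans ?_ (mul_le_mul_of_nonneg_right (le_max_right _ _) (discNorm_nonneg _))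
    rw [mul_assoc, ← div_eq_inv_mul, le_div_iff₀' (norm_pos_iff.2 hi)]
    exact h3

/-- The Gauss norm over `ℓ` as a point of the Berkovich spectrum of a form of a disc. -/
noncomputable def gaussPoint (hr : 0 < r) (φ : A →+* discAlgebra ℓ r)
    (hφ : ∃ C : ℝ, ∀ a, discNorm (φ a) ≤ C * ‖a‖) : BerkovichSpectrum A :=
  ⟨{ toFun := fun a => discNorm (φ a)
     map_zero' := by rw [map_zero, discNorm_zero]
     add_le' := fun a b => by
       rw [map_add]
       exact (discNorm_add_le_max hr _ _).trans
         (max_le_add_of_nonneg (discNorm_nonneg _) (discNorm_nonneg _))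
     neg' := fun a => by rw [map_neg, discNorm_neg]
     map_one' := by rw [map_one, discNorm_one]
     map_mul' := fun a b => by rw [map_mul, discNorm_mul hr] },
   fun a b => by
     change discNorm (φ (a + b)) ≤ max (discNorm (φ a)) (discNorm (φ b))
     rw [map_add]
     exact discNorm_add_le_max hr _ _, hφ⟩

/-- The norm of a form of a disc is bounded by a multiple of the spectral seminorm. -/
theorem IsFormOfDisc.exists_norm_le_spectralSeminorm (hr : 0 < r) {ϖ : ℓ} (hϖ : IsUniformizer ϖ)
    (hA : IsFormOfDisc k ℓ A r) : ∃ C : ℝ, 0 < C ∧ ∀ (a : A) (g : ℝ), 0 ≤ g →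
      (spectralSeminorm A).toFun a ≤ ENNReal.ofReal g → ‖a‖ ≤ C * g := by
  obtain ⟨φ, hφ⟩ := hA.exists_embedding (Module.finBasis k ℓ)
  obtain ⟨C, hC⟩ := exists_norm_equivalence hr hϖ _ φ hφ
  refine ⟨max C 1, lt_max_of_lt_right one_pos, fun a g hg h => ?_⟩
  -- The Gauss norm is one of the points over which the spectral supremum is taken.
  have h1 : ENNReal.ofReal (discNorm (φ a)) ≤ ENNReal.ofReal g :=
    (le_iSup (fun x : BerkovichSpectrum A => ENNReal.ofReal (x.1 a))
      (gaussPoint hr (φ : A →+* discAlgebra ℓ r) ⟨C, fun a => (hC a).1⟩)).trans h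
  have h2 := (ENNReal.ofReal_le_ofReal_iff hg).1 h1
  calc ‖a‖ ≤ C * discNorm (φ a) := (hC a).2
    _ ≤ max C 1 * discNorm (φ a) :=
      mul_le_mul_of_nonneg_right (le_max_left _ _) (discNorm_nonneg _)
    _ ≤ max C 1 * g := mul_le_mul_of_nonneg_left h2 (by positivity)

theorem IsFormOfDisc.nontrivial {k ℓ A : Type*} [NontriviallyNormedField k] [IsUltrametricDist k]
    [NormedField ℓ] [NormedAlgebra k ℓ] [NormedCommRing A] [NormedAlgebra k A] {r : ℝ}
    (hA : IsFormOfDisc k ℓ A r) : Nontrivial A := by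
  obtain ⟨F⟩ := hA.form
  by_contra h
  rw [not_nontrivial_iff_subsingleton] at h
  have h1 : (1 : ℓ ⊗[k] A) = 0 := by
    change (1 : ℓ) ⊗ₜ[k] (1 : A) = 0
    rw [Subsingleton.elim (1 : A) 0, TensorProduct.tmul_zero]
  have h2 : (1 : ℓ ⊗[k] discAlgebra k r) = 0 := by rw [← map_one F, h1, map_zero]
  exact one_ne_zero h2

/-- The spectral seminorm is bounded by the norm. -/
theorem spectralSeminorm_le_norm (A : Type*) [NormedCommRing A] (a : A) :
    (spectralSeminorm A).toFun a ≤ ENNReal.ofReal ‖a‖ := by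
  refine iSup_le fun x => ENNReal.ofReal_le_ofReal ?_
  obtain ⟨C, hC⟩ := x.2.2
  by_contra! hlt
  -- Powers remove the constant $C$; the exponent is kept positive because the norm of $1$ need not
  -- be $1$.
  have hx : ∀ N : ℕ, x.1 a ^ (N + 1) ≤ C * ‖a‖ ^ (N + 1) := fun N => by
    rw [← map_pow]
    have hC0 : 0 ≤ C := by
      by_contra! hneg
      have h2 := hC 1
      rw [map_one] at h2
      nlinarith [norm_nonneg (1 : A)]
    exact (hC _).trans (mul_le_mul_of_nonneg_left (norm_pow_le' a N.succ_pos) hC0)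
  rcases (norm_nonneg a).eq_or_lt with h0 | h0
  · have := hx 0
    rw [← h0] at this hlt
    simp only [zero_add, pow_one, mul_zero] at this
    exact absurd this (not_le.2 hlt)
  · obtain ⟨N, hN⟩ := pow_unbounded_of_one_lt C ((one_lt_div h0).2 hlt)
    have h1 : C < (x.1 a / ‖a‖) ^ (N + 1) :=
      hN.trans_le (pow_le_pow_right₀ ((one_lt_div h0).2 hlt).le N.le_succ)
    rw [div_pow, lt_div_iff₀ (pow_pos h0 _)] at h1
    exact absurd (hx N) (not_le.2 h1)

end NormComparison

/-! ### Homogeneous division with remainder -/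

section HomogeneousDivision

open UltraSeminorm
open scoped Polynomial

variable {k A : Type*} [NontriviallyNormedField k] [IsUltrametricDist k] [NormedCommRing A]
  [NormedAlgebra k A]

/-- The part of degree `g` of a polynomial whose variable has degree `s`. -/
noncomputable def polyComponent (s g : DegGroup) (f : (GrResidue k)[X]) : (GrResidue k)[X] :=
  ∑ i ∈ f.support, Polynomial.monomial i (component (g - i • s) (f.coeff i))

theorem coeff_polyComponent (s g : DegGroup) (f : (GrResidue k)[X]) (i : ℕ) :
    (polyComponent s g f).coeff i = component (g - i • s) (f.coeff i) := by
  rw [polyComponent, Polynomial.finsetSum_coeff]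
  simp only [Polynomial.coeff_monomial, Finset.sum_ite_eq']
  split_ifs with h
  · rfl
  · rw [Polynomial.notMem_support_iff.1 h]
    exact (map_zero (component (v := fieldSeminorm k) _)).symm

theorem degree_polyComponent_le (s g : DegGroup) (f : (GrResidue k)[X]) :
    (polyComponent s g f).degree ≤ f.degree := by
  rw [Polynomial.degree_le_iff_coeff_zero]
  intro m hm
  rw [coeff_polyComponent, Polynomial.coeff_eq_zero_of_degree_lt hm]
  exact map_zero (component (v := fieldSeminorm k) _)

theorem aeval_polyComponent {s : DegGroup} {a : GrRed A}
    (has : a ∈ (spectralSeminorm A).homogeneous s) (g : DegGroup) (f : (GrResidue k)[X]) :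
    Polynomial.aeval a (polyComponent s g f) = component g (Polynomial.aeval a f) := by
  rw [polyComponent, map_sum]
  conv_rhs => rw [Polynomial.as_sum_support f, map_sum, component_sum]
  refine Finset.sum_congr rfl fun i _ => ?_
  rw [Polynomial.aeval_monomial, Polynomial.aeval_monomial,
    component_mul (pow_mem_homogeneous has i)]
  congr 1
  exact (gradedMap_component _ _ _ _).symm

/-- The polynomial and its homogeneous part have the same value at $a$, so they coincide by
injectivity of evaluation. -/
theorem coeff_mem_homogeneous {s : DegGroup} {a : GrRed A}
    (has : a ∈ (spectralSeminorm A).homogeneous s)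
    (hinj : Function.Injective (Polynomial.aeval a : (GrResidue k)[X] →ₐ[GrResidue k] GrRed A))
    {g : DegGroup} {f : (GrResidue k)[X]}
    (hf : Polynomial.aeval a f ∈ (spectralSeminorm A).homogeneous g) (i : ℕ) :
    f.coeff i ∈ (fieldSeminorm k).homogeneous (g - i • s) := by
  have h : polyComponent s g f = f :=
    hinj ((aeval_polyComponent has g f).trans (component_of_mem hf))
  rw [← h, coeff_polyComponent]
  exact component_mem _ _

/-- Homogeneous division with remainder. -/
theorem exists_homogeneous_division {s : DegGroup} {a : GrRed A}
    (has : a ∈ (spectralSeminorm A).homogeneous s)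
    (hbij : Function.Bijective (Polynomial.aeval a : (GrResidue k)[X] →ₐ[GrResidue k] GrRed A))
    {g g' : DegGroup} {f : (GrResidue k)[X]} (hf0 : f ≠ 0)
    (hf : Polynomial.aeval a f ∈ (spectralSeminorm A).homogeneous g) {y : GrRed A}
    (hy : y ∈ (spectralSeminorm A).homogeneous g') :
    ∃ q ∈ (spectralSeminorm A).homogeneous (g' - g), ∃ R : (GrResidue k)[X],
      y = q * Polynomial.aeval a f + Polynomial.aeval a R ∧ R.degree < f.degree := by
  -- The leading coefficient is homogeneous and nonzero, hence invertible, and ordinary division by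
  -- a monic polynomial applies.
  obtain ⟨u, -, hu⟩ := exists_homogeneous_inverse (coeff_mem_homogeneous has hbij.1 hf f.natDegree)
    (Polynomial.leadingCoeff_ne_zero.2 hf0)
  obtain ⟨Y, rfl⟩ := hbij.2 y
  have hmonic : (f * Polynomial.C u).Monic := Polynomial.monic_mul_C_of_leadingCoeff_mul_eq_one hu
  have hdiv := Polynomial.modByMonic_add_div Y (f * Polynomial.C u)
  have hdeg : (Y %ₘ (f * Polynomial.C u)).degree < f.degree := by
    refine (Polynomial.degree_modByMonic_lt Y hmonic).trans_le ?_
    refine (Polynomial.degree_mul_le _ _).trans ?_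
    exact (add_le_add_right Polynomial.degree_C_le _).trans (add_zero _).le
  -- Quotient and remainder are cut down to the relevant degrees; this preserves the identity and
  -- does not raise the degree of the remainder.
  refine ⟨component (g' - g) (Polynomial.aeval a (Polynomial.C u * (Y /ₘ (f * Polynomial.C u)))),
    component_mem _ _, polyComponent s g' (Y %ₘ (f * Polynomial.C u)), ?_,
    (degree_polyComponent_le _ _ _).trans_lt hdeg⟩
  rw [aeval_polyComponent has, ← component_mul hf]
  rw [← map_mul, ← map_add (component (v := spectralSeminorm A) g'), ← map_add]
  refine (component_of_mem hy).symm.trans (congrArg (fun p => component g' (Polynomial.aeval a p)) ?_)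
  conv_lhs => rw [← hdiv]
  ring

end HomogeneousDivision

/-! ### Successive approximation in a complete ring -/

section Approximation

/-- A complete ring in which elements of an ideal can be approximated by multiples of `f`. -/
theorem mem_span_of_approximation {A : Type*} [NormedCommRing A] [CompleteSpace A] {J : Ideal A}
    {f : A} {W : A → ℝ} {C D ρ : ℝ} (hρ0 : 0 ≤ ρ) (hρ1 : ρ < 1)
    (hC : ∀ a, ‖a‖ ≤ C * W a) (hC0 : 0 ≤ C) (hD0 : 0 ≤ D)
    (step : ∀ h ∈ J, ∃ q, h - q * f ∈ J ∧ W (h - q * f) ≤ ρ * W h ∧ W q ≤ D * W h)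
    {h : A} (hh : h ∈ J) : h ∈ Ideal.span {f} := by
  choose! Q hQ1 hQ2 hQ3 using step
  -- The sequence of successive remainders, which decays geometrically with ratio $\rho$.
  let u : ℕ → A := fun n => (fun x => x - Q x * f)^[n] h
  have hu : ∀ n, u (n + 1) = u n - Q (u n) * f := fun n => Function.iterate_succ_apply' _ _ _
  have huJ : ∀ n, u n ∈ J := fun n => by
    induction n with
    | zero => exact hh
    | succ n ih => rw [hu]; exact hQ1 _ ih
  have huW : ∀ n, W (u n) ≤ ρ ^ n * W h := fun n => by
    induction n with
    | zero => rw [pow_zero, one_mul]; exact le_rfl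
    | succ n ih =>
      rw [hu, pow_succ', mul_assoc]
      exact (hQ2 _ (huJ n)).trans (mul_le_mul_of_nonneg_left ih hρ0)
  have hgeo := summable_geometric_of_lt_one hρ0 hρ1
  -- The partial quotients inherit the geometric decay; their sum is the exact quotient of $h$ by
  -- $f$.
  have hsum : Summable fun n => Q (u n) := by
    refine Summable.of_norm_bounded (g := fun n => C * (D * W h) * ρ ^ n) (hgeo.mul_left _) fun n => ?_
    refine (hC _).trans ?_
    have := (hQ3 _ (huJ n)).trans (mul_le_mul_of_nonneg_left (huW n) hD0)
    refine (mul_le_mul_of_nonneg_left this hC0).trans (le_of_eq ?_)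
    ring
  have hpart : ∀ n, (∑ i ∈ Finset.range n, Q (u i)) * f = h - u n := fun n => by
    induction n with
    | zero => simp [u]
    | succ n ih => rw [Finset.sum_range_succ, add_mul, ih, hu]; ring
  have hlim0 : Filter.Tendsto u Filter.atTop (nhds 0) := by
    refine squeeze_zero_norm (a := fun n => C * W h * ρ ^ n) (fun n => ?_) ?_
    · refine (hC _).trans ((mul_le_mul_of_nonneg_left (huW n) hC0).trans (le_of_eq ?_))
      ring
    · have := (tendsto_pow_atTop_nhds_zero_of_lt_one hρ0 hρ1).const_mul (C * W h)
      rwa [mul_zero] at this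
  have h1 : Filter.Tendsto (fun n => (∑ i ∈ Finset.range n, Q (u i)) * f) Filter.atTop
      (nhds ((∑' n, Q (u n)) * f)) := hsum.hasSum.tendsto_sum_nat.mul_const f
  have h2 : Filter.Tendsto (fun n => (∑ i ∈ Finset.range n, Q (u i)) * f) Filter.atTop
      (nhds (h - 0)) := by
    simp only [hpart]
    exact tendsto_const_nhds.sub hlim0
  have h3 := tendsto_nhds_unique h1 h2
  rw [sub_zero] at h3
  exact Ideal.mem_span_singleton'.2 ⟨_, h3⟩

end Approximation

theorem subsingleton_pic_of_isPrincipalIdealRing (A : Type*) [CommRing A] [IsDomain A]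
    [IsPrincipalIdealRing A] : Subsingleton (CommRing.Pic A) := by
  rw [CommRing.Pic.subsingleton_iff]
  intro M _ _ _
  infer_instance

/-! ### Principal ideals from a polynomial graded reduction -/

section PrincipalIdeals

open UltraSeminorm
open scoped Polynomial

/-- The positive real number underlying a degree. -/
noncomputable def DegGroup.toReal (g : DegGroup) : ℝ := (Additive.toMul g : {x : ℝ // 0 < x}).1

theorem DegGroup.toReal_pos (g : DegGroup) : 0 < g.toReal := (Additive.toMul g).2

theorem DegGroup.toReal_val (g : DegGroup) : g.val.toReal = g.toReal :=
  ENNReal.toReal_ofReal g.toReal_pos.le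

theorem DegGroup.toReal_sub (g h : DegGroup) : (g - h).toReal = g.toReal / h.toReal := by
  have h1 : (g - h).toReal * h.toReal = g.toReal :=
    congrArg (fun g : DegGroup => (Additive.toMul g).1) (sub_add_cancel g h)
  rw [← h1, mul_div_cancel_right₀ _ h.toReal_pos.ne']

theorem DegGroup.toReal_lt_of_val_lt {g h : DegGroup} (hgh : g.val < h.val) :
    g.toReal < h.toReal :=
  (ENNReal.ofReal_lt_ofReal_iff h.toReal_pos).1 hgh

theorem DegGroup.toReal_pow_eq {K : Type*} [NormedField K] {π : K} (hπ : IsUniformizer π)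
    {g : DegGroup} {N : ℕ} {z : ℤ} (h : N • g = z • uniformizerDeg hπ) :
    g.toReal ^ N = ‖π‖ ^ z :=
  congrArg (fun g : DegGroup => (Additive.toMul g).1) h

/-- After raising to the power $N$, these degrees become integral powers of $|\pi|$. A strict
inequality thus gains at least one factor $|\pi|$, and $\rho=|\pi|^{1/N}$ works uniformly. -/
theorem exists_toReal_le_of_lt {K : Type*} [NormedField K] {π : K} (hπ : IsUniformizer π)
    {N : ℕ} (hN : N ≠ 0) : ∃ ρ : ℝ, 0 ≤ ρ ∧ ρ < 1 ∧ ∀ g h : DegGroup,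
      (∃ z : ℤ, N • g = z • uniformizerDeg hπ) → (∃ z : ℤ, N • h = z • uniformizerDeg hπ) →
      g.toReal < h.toReal → g.toReal ≤ ρ * h.toReal := by
  have hNR : (N : ℝ) ≠ 0 := by exact_mod_cast hN
  refine ⟨‖π‖ ^ (N : ℝ)⁻¹, by positivity,
    Real.rpow_lt_one hπ.pos.le hπ.lt_one (by positivity), ?_⟩
  rintro g h ⟨y, hy⟩ ⟨z, hz⟩ hlt
  have hg := DegGroup.toReal_pow_eq hπ hy
  have hh := DegGroup.toReal_pow_eq hπ hz
  have hpow := pow_lt_pow_left₀ hlt g.toReal_pos.le hN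
  rw [hg, hh] at hpow
  have hzy : z < y := (zpow_lt_zpow_iff_right_of_lt_one₀ hπ.pos hπ.lt_one).1 hpow
  refine le_of_pow_le_pow_left₀ hN (mul_nonneg (by positivity) h.toReal_pos.le) ?_
  rw [mul_pow, hg, hh, ← Real.rpow_natCast, ← Real.rpow_mul hπ.pos.le, inv_mul_cancel₀ hNR,
    Real.rpow_one, ← zpow_one_add₀ hπ.pos.ne']
  exact zpow_le_zpow_right_of_le_one₀ hπ.pos hπ.lt_one.le (by omega)

variable {k A : Type*} [NontriviallyNormedField k] [IsUltrametricDist k] [NormedCommRing A]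
  [NormedAlgebra k A]

/-- The bound by the norm excludes $\infty$ and the reverse bound excludes $0$, so every nonzero
element has a nonzero principal symbol. -/
theorem exists_spectralSeminorm_eq_val {C : ℝ}
    (hC : ∀ (a : A) (g : ℝ), 0 ≤ g → (spectralSeminorm A).toFun a ≤ ENNReal.ofReal g → ‖a‖ ≤ C * g)
    {a : A} (ha : a ≠ 0) : ∃ g : DegGroup, (spectralSeminorm A).toFun a = g.val := by
  have h0 : (spectralSeminorm A).toFun a ≠ 0 := fun h => by
    have := hC a 0 le_rfl (by rw [h]; exact zero_le)
    rw [mul_zero] at this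
    exact ha (norm_le_zero_iff.1 this)
  have htop : (spectralSeminorm A).toFun a ≠ ⊤ :=
    ne_top_of_le_ne_top ENNReal.ofReal_ne_top (spectralSeminorm_le_norm A a)
  exact ⟨DegGroup.of _ (ENNReal.toReal_pos h0 htop), (ENNReal.ofReal_toReal htop).symm⟩

theorem symbol_ne_zero_of_eq {v : UltraSeminorm A} {g : DegGroup} {a : A} (h : v.toFun a = g.val) :
    symbol g a h.le ≠ 0 := by
  rw [Ne, symbol_eq_zero_iff, h]
  exact lt_irrefl _

/-- A Banach algebra whose graded reduction is a polynomial ring in a homogeneous variable over the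
graded reduction of a discretely valued field is a principal ideal domain. -/
theorem isPrincipalIdealRing_of_aeval_bijective [CompleteSpace A] [Nontrivial A] {π : k}
    (hπ : IsUniformizer π) {C : ℝ} (hC0 : 0 < C)
    (hC : ∀ (a : A) (g : ℝ), 0 ≤ g → (spectralSeminorm A).toFun a ≤ ENNReal.ofReal g → ‖a‖ ≤ C * g)
    {s : DegGroup} {x : GrRed A} (hx : x ∈ (spectralSeminorm A).homogeneous s)
    (hbij : Function.Bijective (Polynomial.aeval x : (GrResidue k)[X] →ₐ[GrResidue k] GrRed A))
    {N : ℕ} (hN : N ≠ 0) (hs : ∃ z : ℤ, N • s = z • uniformizerDeg hπ) :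
    IsDomain A ∧ IsPrincipalIdealRing A := by
  classical
  have : IsDomain (GrResidue k) := (grResidue_isDomain_and_ufd hπ).1
  let e : (GrResidue k)[X] ≃ₐ[GrResidue k] GrRed A := AlgEquiv.ofBijective _ hbij
  have : IsDomain (GrRed A) := e.symm.toMulEquiv.isDomain _
  -- Writing the symbol as a polynomial of degree $d$ in $x$, its leading coefficient shows that
  -- $g-d\cdot s$ is a value of $k$.
  have hval : ∀ {a : A} (g : DegGroup), (spectralSeminorm A).toFun a = g.val →
      ∃ z : ℤ, N • g = z • uniformizerDeg hπ := fun {a} g hg => by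
    have hne := symbol_ne_zero_of_eq hg
    obtain ⟨f, hf⟩ := hbij.2 (symbol g a hg.le)
    have hf0 : f ≠ 0 := by
      rintro rfl
      rw [map_zero] at hf
      exact hne hf.symm
    have hmem := coeff_mem_homogeneous hx hbij.1 (f := f) (g := g)
      (by rw [hf]; exact symbol_mem _ _ _) f.natDegree
    obtain ⟨c, hc, hcf⟩ := exists_symbol hmem
    obtain ⟨hc0, hg'⟩ := exists_norm_eq_of_symbol_ne_zero hc
      (hcf ▸ Polynomial.leadingCoeff_ne_zero.2 hf0)
    obtain ⟨y, hy⟩ := exists_zsmul_uniformizerDeg hπ hc0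
    obtain ⟨z, hz⟩ := hs
    refine ⟨N * y + f.natDegree * z, ?_⟩
    rw [hy, sub_eq_iff_eq_add] at hg'
    rw [hg', nsmul_add, ← mul_nsmul, mul_nsmul', hz, add_zsmul, mul_zsmul, mul_zsmul,
      natCast_zsmul, natCast_zsmul]
  -- Two nonzero elements with product zero would have nonzero symbols with product zero in a
  -- domain.
  have hdomain : IsDomain A := by
    refine (isDomain_iff_noZeroDivisors_and_nontrivial A).2 ⟨⟨fun {a b} hab => ?_⟩, inferInstance⟩
    by_contra! h
    obtain ⟨g, hg⟩ := exists_spectralSeminorm_eq_val hC h.1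
    obtain ⟨g', hg'⟩ := exists_spectralSeminorm_eq_val hC h.2
    have h1 := symbol_mul hg.le hg'.le
    rw [symbol_eq_zero (a := a * b) _ (by
      rw [hab, (spectralSeminorm A).map_zero']
      exact DegGroup.val_pos _)] at h1
    exact mul_ne_zero (symbol_ne_zero_of_eq hg) (symbol_ne_zero_of_eq hg') h1
  refine ⟨hdomain, ⟨fun J => ?_⟩⟩
  by_cases hJ : J = ⊥
  · rw [hJ]
    exact inferInstanceAs (Submodule.IsPrincipal (⊥ : Ideal A))
  -- The generator will be a nonzero element of $J$ whose symbol has least possible degree as a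
  -- polynomial in $x$.
  let P : ℕ → Prop := fun d => ∃ (F : (GrResidue k)[X]) (f : A) (g : DegGroup)
    (hg : (spectralSeminorm A).toFun f = g.val), f ∈ J ∧
      Polynomial.aeval x F = symbol g f hg.le ∧ F.natDegree = d
  have hP : ∃ d, P d := by
    obtain ⟨f, hfJ, hf0⟩ := Submodule.exists_mem_ne_zero_of_ne_bot hJ
    obtain ⟨g, hg⟩ := exists_spectralSeminorm_eq_val hC hf0
    obtain ⟨F, hF⟩ := hbij.2 (symbol g f hg.le)
    exact ⟨_, F, f, g, hg, hfJ, hF, rfl⟩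
  obtain ⟨F, f, g, hg, hfJ, hF, hFd⟩ := Nat.find_spec hP
  have hF0 : F ≠ 0 := by
    rintro rfl
    rw [map_zero] at hF
    exact symbol_ne_zero_of_eq hg hF.symm
  obtain ⟨ρ, hρ0, hρ1, hρ⟩ := exists_toReal_le_of_lt hπ hN
  set W : A → ℝ := fun a => ((spectralSeminorm A).toFun a).toReal with hW
  have hW0 : W 0 = 0 := by
    simp only [hW, (spectralSeminorm A).map_zero', ENNReal.toReal_zero]
  have hWg : ∀ {a : A} {g : DegGroup}, (spectralSeminorm A).toFun a = g.val → W a = g.toReal :=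
    fun {a g} h => by simp only [hW, h, DegGroup.toReal_val]
  have hWC : ∀ a, ‖a‖ ≤ C * W a := fun a => by
    refine hC a _ ENNReal.toReal_nonneg ?_
    rw [ENNReal.ofReal_toReal]
    exact ne_top_of_le_ne_top ENNReal.ofReal_ne_top (spectralSeminorm_le_norm A a)
  have hstep : ∀ h ∈ J, ∃ q, h - q * f ∈ J ∧ W (h - q * f) ≤ ρ * W h ∧
      W q ≤ g.toReal⁻¹ * W h := by
    intro h hhJ
    by_cases h0 : h = 0
    · refine ⟨0, ?_, ?_, ?_⟩
      · rwa [zero_mul, sub_zero]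
      · rw [h0, zero_mul, sub_zero, hW0, mul_zero]
      · rw [h0, hW0, mul_zero]
    obtain ⟨g', hg'⟩ := exists_spectralSeminorm_eq_val hC h0
    obtain ⟨q', hq', R, hR, hRd⟩ := exists_homogeneous_division hx hbij hF0
      (g := g) (by rw [hF]; exact symbol_mem _ _ _) (symbol_mem g' h hg'.le)
    obtain ⟨q, hq, rfl⟩ := exists_symbol hq'
    have hsub : g' - g + g = g' := sub_add_cancel _ _
    have hqf := mul_mem_le hq hg.le
    rw [hsub] at hqf
    have hsJ : h - q * f ∈ J := J.sub_mem hhJ (J.mul_mem_left q hfJ)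
    have hsle := (toFun_sub_le (v := spectralSeminorm A) h (q * f)).trans (max_le hg'.le hqf)
    have hRs : Polynomial.aeval x R = symbol g' (h - q * f) hsle := by
      rw [← symbol_sub hg'.le hqf, hR, hF, symbol_mul, symbol_congr hsub rfl _ hqf,
        add_sub_cancel_left]
    -- If subtracting $qf$ did not lower the seminorm, the remainder $R$ would be a nonzero symbol
    -- of an element of $J$ of smaller polynomial degree than that of $f$.
    have hlt : (spectralSeminorm A).toFun (h - q * f) < g'.val := by
      refine hsle.lt_of_ne fun heq => ?_
      have hR0 : R ≠ 0 := by
        rintro rfl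
        rw [map_zero] at hRs
        exact symbol_ne_zero_of_eq heq hRs.symm
      have hdlt : R.natDegree < Nat.find hP := hFd ▸ Polynomial.natDegree_lt_natDegree hR0 hRd
      exact Nat.find_min hP hdlt ⟨R, h - q * f, g', heq, hsJ, hRs, rfl⟩
    refine ⟨q, hsJ, ?_, ?_⟩
    · rw [hWg hg']
      by_cases hs0 : h - q * f = 0
      · rw [hs0, hW0]
        exact mul_nonneg hρ0 g'.toReal_pos.le
      obtain ⟨g₁, hg₁⟩ := exists_spectralSeminorm_eq_val hC hs0
      rw [hWg hg₁]
      exact hρ _ _ (hval _ hg₁) (hval _ hg') (DegGroup.toReal_lt_of_val_lt (hg₁ ▸ hlt))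
    · rw [hWg hg', ← div_eq_inv_mul, ← DegGroup.toReal_sub, ← DegGroup.toReal_val]
      exact ENNReal.toReal_mono (DegGroup.val_ne_top _) hq
  refine ⟨f, le_antisymm (fun h hh => ?_) ?_⟩
  · exact mem_span_of_approximation hρ0 hρ1 hWC hC0.le (inv_nonneg.2 g.toReal_pos.le) hstep hh
  · exact (Submodule.span_singleton_le_iff_mem f J).2 hfJ

end PrincipalIdeals

/-! ### Consequences of an affine coordinate for a form of the disc -/

section FormsOfDiscs

open UltraSeminorm
open scoped Polynomial

variable {k ℓ A : Type*} [NontriviallyNormedField k] [IsUltrametricDist k]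
  [NormedField ℓ] [IsUltrametricDist ℓ] [NormedAlgebra k ℓ] [NormedCommRing A] [NormedAlgebra k A]
  {p n : ℕ} {ϖ : ℓ} {r : ℝ} {hr : 0 < r}

omit [IsUltrametricDist k] in
theorem charP_polynomial_grResidue (hw : IsTotallyWildlyRamified k ℓ p n) :
    CharP (GrResidue ℓ)[X] p := by
  have h : CharP (GrResidue ℓ) p :=
    (CharP.charP_iff_prime_eq_zero hw.prime).2 (natCast_grResidue hw)
  infer_instance

/-- If `∂(T)` is of degree one in `T`, then every integral logarithmic derivative is the logarithmic
derivative of a unit. -/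
theorem subsingleton_logQuotient_of_affine_coordinate {π : k} (hπ : IsUniformizer π)
    (hw : IsTotallyWildlyRamified k ℓ p n) (hϖ : IsUniformizer ϖ)
    (θ : GradedTrivialization k ℓ A r hr) {a : GrRed A} {α : (GrResidue ℓ)ˣ} {β : GrResidue ℓ}
    (ha : θ.incl a = Polynomial.C (α : GrResidue ℓ) * Polynomial.X + Polynomial.C β) :
    Subsingleton (formDerivation hw hϖ θ).LogQuotient := by
  obtain ⟨hd, hu⟩ := grResidue_isDomain_and_ufd hπ
  have hdℓ := (grResidue_isDomain_and_ufd hϖ).1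
  let e : (GrResidue k)[X] ≃ₐ[GrResidue k] GrRed A :=
    AlgEquiv.ofBijective _ (aeval_bijective_of_affine_coordinate hw hϖ θ ha)
  have : IsDomain (GrRed A) := e.symm.toMulEquiv.isDomain _
  have : UniqueFactorizationMonoid (GrRed A) :=
    e.toMulEquiv.uniqueFactorizationMonoid inferInstance
  have : Fact p.Prime := ⟨hw.prime⟩
  have := charP_polynomial_grResidue hw
  have hb := formDerivation_constantsBasis hw hϖ θ
  exact hb.subsingleton_logQuotient
    (hb.exists_eq_pow (Nat.sub_add_cancel (Nat.pow_pos hw.prime.pos)))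

/-- With $c=-\beta\alpha^{-1}$ one has $T-c=\alpha^{-1}a$, a unit times a constant, so $T-c$ divides
its own derivative. -/
theorem dlog_paramUnit_mem_integralLog (hw : IsTotallyWildlyRamified k ℓ p n)
    (hϖ : IsUniformizer ϖ) (θ : GradedTrivialization k ℓ A r hr) {a : GrRed A}
    {α : (GrResidue ℓ)ˣ} {β : GrResidue ℓ}
    (ha : θ.incl a = Polynomial.C (α : GrResidue ℓ) * Polynomial.X + Polynomial.C β) :
    (formDerivation hw hϖ θ).dlog (paramUnit (-(β * (α⁻¹ : (GrResidue ℓ)ˣ)))) ∈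
      (formDerivation hw hϖ θ).integralLog := by
  set D := formDerivation hw hϖ θ
  set c : GrResidue ℓ := -(β * (α⁻¹ : (GrResidue ℓ)ˣ)) with hc
  have h1 : Polynomial.C (α : GrResidue ℓ) * (Polynomial.X - Polynomial.C c) = θ.incl a := by
    rw [ha, mul_sub, ← Polynomial.C_mul, hc, mul_neg, mul_left_comm, Units.mul_inv, mul_one,
      Polynomial.C_neg, sub_neg_eq_add]
  have h2 : Polynomial.X - Polynomial.C c =
      Polynomial.C ((α⁻¹ : (GrResidue ℓ)ˣ) : GrResidue ℓ) * θ.incl a := by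
    rw [← h1, ← mul_assoc, ← Polynomial.C_mul, Units.inv_mul, Polynomial.C_1, one_mul]
  refine D.dlog_mem_integralLog (w := TruncPoly.const _ _ (Polynomial.C (α : GrResidue ℓ)) *
    D.toRingHom (Polynomial.C ((α⁻¹ : (GrResidue ℓ)ˣ) : GrResidue ℓ))) _ ?_
  conv_lhs => rw [h2, map_mul, formDerivation_incl, ← h1, map_mul (TruncPoly.const _ _)]
  ring

/-- The degree $s$ is the sum of the degrees of $\alpha$ and of $T$. The first becomes a value of
$k$ after multiplication by $p^n$, the second by the assumption on $r$. -/
theorem exists_nsmul_eq_zsmul_uniformizerDeg {π : k} (hπ : IsUniformizer π)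
    (hw : IsTotallyWildlyRamified k ℓ p n) (hϖ : IsUniformizer ϖ)
    (hr' : ∃ N : ℕ, 0 < N ∧ ∃ a : k, a ≠ 0 ∧ r ^ N = ‖a‖)
    (θ : GradedTrivialization k ℓ A r hr) {s : DegGroup} {a : GrRed A}
    (has : a ∈ (spectralSeminorm A).homogeneous s) {α : (GrResidue ℓ)ˣ} {β : GrResidue ℓ}
    (ha : θ.incl a = Polynomial.C (α : GrResidue ℓ) * Polynomial.X + Polynomial.C β) :
    ∃ N : ℕ, N ≠ 0 ∧ ∃ z : ℤ, N • s = z • uniformizerDeg hπ := by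
  obtain ⟨N, hN, b, hb0, hb⟩ := hr'
  obtain ⟨y, hy⟩ := exists_zsmul_uniformizerDeg hπ hb0
  have hNr : N • DegGroup.of r hr = y • uniformizerDeg hπ := by
    rw [← hy]
    exact Additive.toMul.injective (Subtype.ext hb)
  obtain ⟨c, hc0, hc⟩ := exists_norm_eq_uniformizer_pow hϖ hw
  obtain ⟨z, hz⟩ := exists_zsmul_uniformizerDeg hπ hc0
  have hqd : (p ^ n) • uniformizerDeg hϖ = z • uniformizerDeg hπ := by
    rw [← hz]
    exact Additive.toMul.injective (Subtype.ext hc.symm)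
  have hcoeff := θ.graded 0 s 1 one_mem_homogeneous a has 1
  have hcoeff' : (α : GrResidue ℓ) ∈ (fieldSeminorm ℓ).homogeneous (s - DegGroup.of r hr) := by
    have h1 : θ.toAlgEquiv ((1 : GrResidue ℓ) ⊗ₜ[GrResidue k] a) = θ.incl a := rfl
    rw [h1, ha, zero_add, one_nsmul] at hcoeff
    simpa using hcoeff
  obtain ⟨u, hu, hαu⟩ := exists_symbol hcoeff'
  obtain ⟨hu0, hg⟩ := exists_norm_eq_of_symbol_ne_zero hu (hαu ▸ α.ne_zero)
  obtain ⟨i, hi⟩ := exists_zsmul_uniformizerDeg hϖ hu0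
  rw [hi, sub_eq_iff_eq_add] at hg
  refine ⟨N * p ^ n, mul_ne_zero hN.ne' (pow_ne_zero _ hw.prime.ne_zero),
    N * (i * z) + (p ^ n : ℕ) * y, ?_⟩
  have e1 : (N * p ^ n) • (i • uniformizerDeg hϖ) = (N * (i * z) : ℤ) • uniformizerDeg hπ := by
    rw [mul_nsmul', ← natCast_zsmul _ (p ^ n), ← mul_zsmul, mul_comm, mul_zsmul, natCast_zsmul,
      hqd, mul_zsmul, mul_zsmul, natCast_zsmul]
  have e2 : (N * p ^ n) • DegGroup.of r hr = ((p ^ n : ℕ) * y : ℤ) • uniformizerDeg hπ := by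
    rw [mul_nsmul, hNr, mul_zsmul, natCast_zsmul]
  rw [hg, nsmul_add, e1, e2, add_zsmul]

end FormsOfDiscs

/-! ### The theorem -/

open scoped TensorProduct Polynomial in
theorem mainTheorem9 {k ℓ A : Type*}
    [NontriviallyNormedField k] [IsUltrametricDist k] [CompleteSpace k]
    (hk : ∃ π : k, IsUniformizer π)
    [NormedField ℓ] [IsUltrametricDist ℓ] [NormedAlgebra k ℓ] [FiniteDimensional k ℓ]
    {p n : ℕ} (hw : IsTotallyWildlyRamified k ℓ p n)
    {ϖ : ℓ} (hϖ : IsUniformizer ϖ)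
    {r : ℝ} (hr : 0 < r) (hr' : ∃ N : ℕ, 0 < N ∧ ∃ a : k, a ≠ 0 ∧ r ^ N = ‖a‖)
    [NormedCommRing A] [IsUltrametricDist A] [CompleteSpace A] [NormedAlgebra k A]
    (hA : IsFormOfDisc k ℓ A r)
    (hred : IsReduced (GrAlgClosure k ⊗[GrResidue k] GrRed A))
    (θ : GradedTrivialization k ℓ A r hr)
    (hdeg : TruncPoly.degT _ ((formDerivation hw hϖ θ).toRingHom Polynomial.X) = 1) :
    (Finite (formDerivation hw hϖ θ).LogQuotient ∧ IsCyclic (formDerivation hw hϖ θ).LogQuotient ∧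
      Monoid.exponent (formDerivation hw hϖ θ).LogQuotient ∣ p ^ n) ∧
    (∀ hT : (formDerivation hw hϖ θ).dlog (tUnitL (GrResidue ℓ)) ∈
        (formDerivation hw hϖ θ).integralLog,
      Subgroup.zpowers ((formDerivation hw hϖ θ).logClass _ hT) = ⊤) ∧
    (∃ (c : GrResidue ℓ) (hc : (formDerivation hw hϖ θ).dlog (paramUnit c) ∈
        (formDerivation hw hϖ θ).integralLog),
      Subgroup.zpowers ((formDerivation hw hϖ θ).logClass _ hc) = ⊤) ∧
    (Finite (CommRing.Pic A) ∧ IsCyclic (CommRing.Pic A) ∧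
      Monoid.exponent (CommRing.Pic A) ∣ p ^ n) ∧
    (∃ e : CommRing.Pic A ≃* (formDerivation hw hϖ θ).LogQuotient,
      ∀ (J : Ideal A) [Module.Invertible A J] (z : (GrResidue ℓ)[X])
        (hz : z ∈ nonZeroDivisors (GrResidue ℓ)[X]),
        (symbolIdeal J).map ((θ.toAlgEquiv : (GrResidue ℓ ⊗[GrResidue k] GrRed A) →+*
            (GrResidue ℓ)[X]).comp (Algebra.TensorProduct.includeRight :
            GrRed A →ₐ[GrResidue k] GrResidue ℓ ⊗[GrResidue k] GrRed A).toRingHom) =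
          Ideal.span {z} →
        ∃ h : (formDerivation hw hϖ θ).dlog (fracUnit z hz) ∈
            (formDerivation hw hϖ θ).integralLog,
          e (CommRing.Pic.mk A J) = (formDerivation hw hϖ θ).logClass _ h) := by
  obtain ⟨π, hπ⟩ := hk
  obtain ⟨s, a, α, β, has, ha⟩ := exists_affine_coordinate hw hϖ θ hdeg
  have hlog := subsingleton_logQuotient_of_affine_coordinate hπ hw hϖ θ ha
  obtain ⟨C, hC0, hC⟩ := hA.exists_norm_le_spectralSeminorm hr hϖ
  obtain ⟨N, hN, hs⟩ := exists_nsmul_eq_zsmul_uniformizerDeg hπ hw hϖ hr' θ has ha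
  have := hA.nontrivial
  obtain ⟨hdom, hpid⟩ := isPrincipalIdealRing_of_aeval_bijective hπ hC0 hC has
    (aeval_bijective_of_affine_coordinate hw hϖ θ ha) hN hs
  have hpic := subsingleton_pic_of_isPrincipalIdealRing A
  -- Both groups are trivial, so every equality of classes is automatic; what has content is that
  -- the named logarithmic derivatives are integral.
  refine ⟨⟨inferInstance, inferInstance, Monoid.exponent_dvd_of_forall_pow_eq_one
    fun g => Subsingleton.elim _ _⟩, fun _ => Subsingleton.elim _ _, ⟨_,
    dlog_paramUnit_mem_integralLog hw hϖ θ ha, Subsingleton.elim _ _⟩, ⟨inferInstance,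
    inferInstance, Monoid.exponent_dvd_of_forall_pow_eq_one fun g => Subsingleton.elim _ _⟩,
    { toFun := fun _ => 1
      invFun := fun _ => 1
      left_inv := fun _ => Subsingleton.elim _ _
      right_inv := fun _ => Subsingleton.elim _ _
      map_mul' := fun _ _ => Subsingleton.elim _ _ },
    fun J _ z hz hJ => ⟨?_, Subsingleton.elim _ _⟩⟩
  -- The extension of the symbol ideal to $\widetilde B$ is generated by elements of $\widetilde A$,
  -- which are constants.
  exact (formDerivation hw hϖ θ).dlog_mem_integralLog_of_map_eq θ.incl
    (formDerivation_incl hw hϖ θ) hz hJ
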